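/- Consider general relativity ($8\pi G=c=1$) with a canonical, minimally coupled scalar field $\psi$ of potential $V(\psi)=V_0e^{-\lambda\psi}$, $V_0\ge 0$ (unless said otherwise), and static spherically symmetric solutions $$ds^2=-A\,dt^2+d\ell^2+r^2d\Omega^2,\qquad A=N^2,\ N>0,\ r>0,\qquad B=(dr/d\ell)^2.$$ Put $K=1/r^2$, let $\hat f=df/d\ell$, $f'=\hat f/\sqrt K$, and $$x_2=\hat r,\quad x_3=r\hat N/N,\quad y_1=r\hat\psi/\sqrt2,\quad (X_2,X_3,Y_1)=\frac{(x_2,x_3,y_1)}{\sqrt{1+x_2^2+x_3^2+y_1^2}},\quad \tilde f=\sqrt{1-X_2^2-X_3^2-Y_1^2}\,f' .$$ With $\mathcal I=2X_2^2+2X_2X_3+X_3^2-1$ the field equations give the system $$\tilde X_2=-\tfrac{\lambda}{\sqrt2}X_2Y_1\mathcal I+Y_1^2[X_2(2X_2+X_3)-1]-X_2X_3[X_2(3X_2+X_3)-2],$$ $$\tilde X_3=-\tfrac{\lambda}{\sqrt2}X_3Y_1\mathcal I-3X_2^2X_3^2+2X_2^2-X_2X_3^3+X_3Y_1^2(2X_2+X_3)+X_2X_3+X_3^2-1,$$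 $$\tilde Y_1=\tfrac{\lambda}{\sqrt2}(1-Y_1^2)\mathcal I-X_2Y_1(3X_2X_3+X_3^2+1)+Y_1^3(2X_2+X_3)$$ on the compact phase space $\{\mathcal I\le 0,\ X_2^2+X_3^2+Y_1^2\le1\}$. An orbit is finite if $X_2^2+X_3^2+Y_1^2<1$ along it. Every solution parametrized as above (parameter $\tau\in\mathbb R$, $d/d\tau=\tilde{\ }$) gives a finite orbit, with $\mathcal I=0$ if $V_0=0$ and $\mathcal I<0$ if $V_0>0$; conversely each finite orbit with $\mathcal I=0$ (resp. $\mathcal I<0$) comes from a solution with $V_0=0$ (resp. with any prescribed $V_0>0$). Let $M$ and $\bar M$ be the parts $X_2+X_3=\sqrt{1-X_2^2}$ and $X_2+X_3=-\sqrt{1-X_2^2}$ of the closed unit ball, and $\mathcal C\subset M$, $\bar{\mathcal C}\subset\bar M$ the curves where in addition $X_2^2+X_3^2+Y_1^2=1$. Let $P_M=(\frac1{\sqrt2},0,0)$ (Minkowski), $P_H=(0,1,0)$ (horizon), $P_\lambda=\frac{1}{\sqrt{\lambda^2+4}}(\sqrt2,\sqrt2,\lambda)$, and $\bar P_M,\bar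 P_H,\bar P_\lambda$ their opposites. A naked singularity at an end of the orbit means: $r\to0$, $B\to\infty$, the Kretschmann scalar tends to $\infty$, and the end lies at finite proper distance and finite light-travel time $\int d\ell/N$. 1. $\{\mathcal I=0\}$ is an invariant surface of the system; within the closed ball it is the disjoint union of $M$ and $\bar M$, each of which is invariant. The map $\gamma(\tau)\mapsto-\gamma(-\tau)$ sends orbits to orbits, and $p\mapsto -p$ interchanges $M$ and $\bar M$. 2. On $M$ write $X_2=\cos\theta$, $X_3=\sin\theta-\cos\theta$, $\theta\in[\arccos\frac2{\sqrt5},\frac\pi2]$. Then $$\tilde\theta=-\tfrac{\cos\theta-\sin\theta}2\,[1+2Y_1^2+\cos2\theta-2\sin2\theta],\qquad \tilde Y_1=Y_1\tfrac{\cos\theta+\sin\theta}2\,[1+2Y_1^2+\cos2\theta-2\sin2\theta],$$ and along each orbit on $M$ either $Y_1=c_1(\cos\theta-\sin\theta)$ for a constant $c_1$, or $\theta\equiv\pi/4$. 3. Up to a shift of $\tau$ there is exactly one orbit in the phase space from $P_H$ to $P_M$; it is finite and lies on $M$. It and its reverse (from $\bar P_M$ to $\bar P_H$) are the exterior Schwarzschild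 solution of positive mass, with $V_0=0$ and constant $\psi$. 4. Every finite orbit on $M$ other than $P_M$ tends to $P_M$ as $\tau\to\infty$ and to a point $p\in\mathcal C$ as $\tau\to-\infty$; if $p\ne P_H$ the solution has a naked singularity there. The reversed statement holds on $\bar M$. 5. Let $\lambda\ne0$. Every finite orbit with $\mathcal I<0$ tends, as $\tau\to-\infty$, to a point $p$ that is $P_M$, or in $\mathcal C$, or $P_\lambda$ with $\lambda^2>6$; and, as $\tau\to+\infty$, to a point $q$ that is $\bar P_M$, or in $\bar{\mathcal C}$, or $\bar P_\lambda$ with $\lambda^2>6$. One of the following holds. (a) $X_2$ vanishes at exactly one $\tau_0$, is positive before and negative after it; $r$ has its strict global maximum at $\tau_0$, where $x_2=0$, $x_2'=-y_1^2\le 0$, and the flare-out condition ($d^2r/dz^2>0$ for the embedding $dz^2=(1-B)\,d\ell^2$) fails. (b) $X_2>0$ throughout, $q=\bar P_H$, and $r$ increases to a finite positive limit while $N\to0$, as $\tau\to+\infty$ (the maximum radius is reached only at the horizon). (c) $X_2<0$ throughout, $p=P_H$, and $r$ is decreasing in $\tau$, with a finite positive limit while $N\to0$, as $\tau\to-\infty$.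 The solution has a naked singularity at $p$ unless $p\in\{P_M,P_H\}$, and at $q$ unless $q\in\{\bar P_M,\bar P_H\}$; and it is impossible that both $p\in\{P_M,P_H\}$ and $q\in\{\bar P_M,\bar P_H\}$. 6. Hence, for $\lambda\neq0$ and $V_0\ge0$, every such solution whose orbit is not one of the fixed points $P_M,\bar P_M$ is exterior Schwarzschild or has a naked singularity at one of its ends. 7. Let $\lambda\ne0$. The points $\pm(\frac1{\sqrt2},\frac1{\sqrt2},0)$, which represent anti-de Sitter space, are not critical points, and no integral curve of the system in the closed ball (with any sign of $\mathcal I$) tends to one of them as $\tau\to\pm\infty$. For no $V_0\in\mathbb R$ of either sign is there a static spherically symmetric solution that is asymptotically anti-de Sitter, that is, with $r\to\infty$, $B/r^2\to1/L^2$ for some $L>0$, and $d\ln A/d\ln r\to2$ at an end. -/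

import Mathlib

open Filter Topology

noncomputable section

namespace ExpPotential

/-! ### The compactified dynamical system -/

/-- Points `(X₂, X₃, Y₁)` of the compactified (Poincare) phase space. -/
abbrev Pt : Type := ℝ × ℝ × ℝ

/-- `X₂² + X₃² + Y₁²`; the value `1` is the boundary at infinity. -/
def normSq (p : Pt) : ℝ := p.1 ^ 2 + p.2.1 ^ 2 + p.2.2 ^ 2

/-- `I = 2 X₂² + 2 X₂ X₃ + X₃² - 1`. -/
def surf (p : Pt) : ℝ := 2 * p.1 ^ 2 + 2 * p.1 * p.2.1 + p.2.1 ^ 2 - 1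

/-- The vector field of the compactified system for `V = V₀ exp (-lam ψ)` and a canonical field. -/
def field (lam : ℝ) (p : Pt) : Pt :=
  let a := p.1
  let b := p.2.1
  let y := p.2.2
  ( -(lam / √2) * a * y * (2 * a ^ 2 + 2 * a * b + b ^ 2 - 1)
      + y ^ 2 * (a * (2 * a + b) - 1) - a * b * (a * (3 * a + b) - 2),
    -(lam / √2) * b * y * (2 * a ^ 2 + 2 * a * b + b ^ 2 - 1)
      - 3 * a ^ 2 * b ^ 2 + 2 * a ^ 2 - a * b ^ 3 + b * y ^ 2 * (2 * a + b)
      + a * b + b ^ 2 - 1,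
    lam / √2 * (1 - y ^ 2) * (2 * a ^ 2 + 2 * a * b + b ^ 2 - 1)
      - a * y * (3 * a * b + b ^ 2 + 1) + y ^ 3 * (2 * a + b) )

/-- Phase space of the non-negative potentials. -/
def phaseSpace : Set Pt := {p | surf p ≤ 0 ∧ normSq p ≤ 1}

/-- The surface `M`. -/
def surfM : Set Pt := {p | p.1 + p.2.1 = √(1 - p.1 ^ 2) ∧ p.1 ^ 2 ≤ 1 ∧ normSq p ≤ 1}

/-- The surface `M̄`. -/
def surfMbar : Set Pt := {p | p.1 + p.2.1 = -√(1 - p.1 ^ 2) ∧ p.1 ^ 2 ≤ 1 ∧ normSq p ≤ 1}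

/-- The critical curve, the part at infinity of `M`. -/
def critCurve : Set Pt := {p | p ∈ surfM ∧ normSq p = 1}

/-- The critical curve at infinity of `M̄`. -/
def critCurveBar : Set Pt := {p | p ∈ surfMbar ∧ normSq p = 1}

/-- Minkowski point `(x₂, x₃, y₁) = (1, 0, 0)`. -/
def PM : Pt := (1 / √2, 0, 0)

/-- Minkowski point `(x₂, x₃, y₁) = (-1, 0, 0)`. -/
def PMbar : Pt := (-(1 / √2), 0, 0)

/-- The horizon point. -/
def PH : Pt := (0, 1, 0)

/-- The dual horizon point. -/
def PHbar : Pt := (0, -1, 0)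

/-- The point `P_lam`. -/
def Plam (lam : ℝ) : Pt := (√2 / √(lam ^ 2 + 4), √2 / √(lam ^ 2 + 4), lam / √(lam ^ 2 + 4))

/-- The point `P̄_lam`. -/
def PlamBar (lam : ℝ) : Pt :=
  (-(√2 / √(lam ^ 2 + 4)), -(√2 / √(lam ^ 2 + 4)), -(lam / √(lam ^ 2 + 4)))

/-- The anti-de Sitter point. -/
def PAdS : Pt := (1 / √2, 1 / √2, 0)

/-- The dual anti-de Sitter point. -/
def PAdSbar : Pt := (-(1 / √2), -(1 / √2), 0)

/-- Integral curves on the whole time line. -/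
def IsFlowLine (lam : ℝ) (γ : ℝ → Pt) : Prop := ∀ τ, HasDerivAt γ (field lam (γ τ)) τ

/-- Parametrized orbits in the phase space of the non-negative potentials (they are complete, the
phase space being compact). -/
def IsOrbit (lam : ℝ) (γ : ℝ → Pt) : Prop := IsFlowLine lam γ ∧ ∀ τ, γ τ ∈ phaseSpace

/-- The curve does not lie in the boundary at infinity. -/
def IsFinite (γ : ℝ → Pt) : Prop := ∀ τ, normSq (γ τ) < 1

/-! ### Static spherically symmetric spacetimes -/

/-- The potential `V₀ exp (-lam ψ)`. -/
def expPotential (V0 lam : ℝ) (ψ : ℝ) : ℝ := V0 * Real.exp (-lam * ψ)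

/-- The metric `-lapse² dt² + density² dτ² + radius² dΩ²` together with a scalar field. -/
structure Config where
  radius : ℝ → ℝ
  lapse : ℝ → ℝ
  density : ℝ → ℝ
  scalar : ℝ → ℝ

namespace Config

variable (S : Config)

/-- Derivative along the unit radial vector. -/
def hat (f : ℝ → ℝ) (τ : ℝ) : ℝ := deriv f τ / S.density τ

/-- Sheet expansion `φ`. -/
def sheetExp (τ : ℝ) : ℝ := 2 * S.hat S.radius τ / S.radius τ

/-- Acceleration of the static observers. -/
def accel (τ : ℝ) : ℝ := S.hat S.lapse τ / S.lapse τ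

/-- Gaussian curvature of the sheets. -/
def gaussK (τ : ℝ) : ℝ := 1 / S.radius τ ^ 2

/-- `Ψ`, the derivative of the scalar field along the unit radial vector. -/
def scalarHat (τ : ℝ) : ℝ := S.hat S.scalar τ

/-- The electric Weyl scalar, as given by the first constraint. -/
def weyl (V : ℝ → ℝ) (τ : ℝ) : ℝ :=
  -S.accel τ * S.sheetExp τ - 2 * V (S.scalar τ) / 3 + S.scalarHat τ ^ 2 / 3

/-- The field equations of general relativity with a canonical minimally coupled scalar field of
potential `V`, in `1+1+2` form (`8πG = c = 1`). The propagation equation of the Gaussian curvature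
holds by the definition of `gaussK`; that of the Weyl scalar follows from the other ones. -/
structure IsSolution (V : ℝ → ℝ) : Prop where
  radius_smooth : ContDiff ℝ 2 S.radius
  lapse_smooth : ContDiff ℝ 2 S.lapse
  scalar_smooth : ContDiff ℝ 2 S.scalar
  density_smooth : ContDiff ℝ 1 S.density
  radius_pos : ∀ τ, 0 < S.radius τ
  lapse_pos : ∀ τ, 0 < S.lapse τ
  density_pos : ∀ τ, 0 < S.density τ
  sheetExp_eq : ∀ τ, S.hat S.sheetExp τ =
    -(1 / 2) * S.sheetExp τ ^ 2 - 2 / 3 * (S.scalarHat τ ^ 2 + V (S.scalar τ)) - S.weyl V τ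
  accel_eq : ∀ τ, S.hat S.accel τ =
    -(S.accel τ + S.sheetExp τ) * S.accel τ - V (S.scalar τ)
  scalar_eq : ∀ τ, S.hat S.scalarHat τ =
    -(S.accel τ + S.sheetExp τ) * S.scalarHat τ + deriv V (S.scalar τ)
  gauss_eq : ∀ τ, S.gaussK τ =
    S.accel τ * S.sheetExp τ + V (S.scalar τ) - S.scalarHat τ ^ 2 / 2 + S.sheetExp τ ^ 2 / 4

/-- `x₂ = φ / (2 √K)`. -/
def x2 (τ : ℝ) : ℝ := S.sheetExp τ / (2 * √(S.gaussK τ))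

/-- `x₃ = 𝒜 / √K`. -/
def x3 (τ : ℝ) : ℝ := S.accel τ / √(S.gaussK τ)

/-- `y₁ = Ψ / √(2 K)`. -/
def y1 (τ : ℝ) : ℝ := S.scalarHat τ / √(2 * S.gaussK τ)

/-- The normalized radial derivative `f̂ / √K`. -/
def normDeriv (f : ℝ → ℝ) (τ : ℝ) : ℝ := S.hat f τ / √(S.gaussK τ)

/-- The compactified variables `(X₂, X₃, Y₁)`. -/
def poincare (τ : ℝ) : Pt :=
  let D := √(1 + S.x2 τ ^ 2 + S.x3 τ ^ 2 + S.y1 τ ^ 2)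
  (S.x2 τ / D, S.x3 τ / D, S.y1 τ / D)

/-- The radial parameter is the one of the compactified system: the derivative with respect to it is
`√(1 - X₂² - X₃² - Y₁²)` times the normalized radial derivative. -/
def HasPoincareParam : Prop :=
  ∀ τ, S.density τ = √(1 - normSq (S.poincare τ)) / √(S.gaussK τ)

/-- `S` is a solution for the potential `V₀ exp (-lam ψ)` whose orbit is `γ`. -/
def Realizes (V0 lam : ℝ) (γ : ℝ → Pt) : Prop :=
  S.IsSolution (expPotential V0 lam) ∧ S.HasPoincareParam ∧ ∀ τ, S.poincare τ = γ τ

/-- The metric function `B`, where the metric is `-A dt² + dr² / B + r² dΩ²`. -/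
def metricB (τ : ℝ) : ℝ := S.hat S.radius τ ^ 2

/-- The Kretschmann scalar, four times the sum of the squares of the six sectional curvatures of
the orthonormal coordinate planes. -/
def kretschmann (τ : ℝ) : ℝ :=
  4 * ((S.hat (S.hat S.lapse) τ / S.lapse τ) ^ 2
    + 2 * (S.hat S.lapse τ * S.hat S.radius τ / (S.lapse τ * S.radius τ)) ^ 2
    + 2 * (S.hat (S.hat S.radius) τ / S.radius τ) ^ 2
    + ((1 - S.hat S.radius τ ^ 2) / S.radius τ ^ 2) ^ 2)

/-- The exterior Schwarzschild solution of some positive mass `m`, up to a constant rescaling of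
the static time, with a constant scalar field. -/
def IsSchwarzschild : Prop :=
  ∃ m > 0, ∃ c > 0,
    (∀ τ, S.metricB τ = 1 - 2 * m / S.radius τ ∧
      S.lapse τ ^ 2 = c ^ 2 * (1 - 2 * m / S.radius τ)) ∧
    Set.range S.radius = Set.Ioi (2 * m) ∧ ∃ ψ0, ∀ τ, S.scalar τ = ψ0

/-- A naked singularity at the end `l` (`atBot` or `atTop`) of the static region: the radius tends
to zero, `B` and the curvature blow up, and the end is at a finite proper distance and at a finite
light-travel time (in the static time) from the interior, so that no horizon hides it. -/
def NakedSingularity (l : Filter ℝ) : Prop :=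
  Tendsto S.radius l (𝓝 0) ∧ Tendsto S.metricB l atTop ∧ Tendsto S.kretschmann l atTop ∧
  MeasureTheory.IntegrableAtFilter S.density l MeasureTheory.volume ∧
  MeasureTheory.IntegrableAtFilter (fun τ => S.density τ / S.lapse τ) l MeasureTheory.volume

/-- The flare-out condition `d²r/dz² > 0` at a point with `B = 0`, where `dz = √(1 - B) dℓ` is the
height of the embedding in flat space and `dℓ` the proper length. -/
def FlareOut (τ : ℝ) : Prop :=
  S.metricB τ = 0 ∧
    0 < S.hat (fun t => S.hat S.radius t / √(1 - S.hat S.radius t ^ 2)) τ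
      / √(1 - S.hat S.radius τ ^ 2)

/-- Asymptotically anti-de Sitter at the end `l`: as `r → ∞`, `B ~ r² / L²` for some `L > 0` and
`d ln A / d ln r → 2`. -/
def AsymptoticallyAdS (l : Filter ℝ) : Prop :=
  Tendsto S.radius l atTop ∧
  (∃ L > 0, Tendsto (fun τ => S.metricB τ / S.radius τ ^ 2) l (𝓝 (1 / L ^ 2))) ∧
  Tendsto (fun τ => 2 * S.accel τ / (S.hat S.radius τ / S.radius τ)) l (𝓝 2)

end Config

end ExpPotential

end

open ExpPotential

/-!
The change `γ ↦ -γ(-τ)` reverses the radial direction, so it suffices to study orbits in the past.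
The polynomial `surf` satisfies a homogeneous linear equation along the flow, hence keeps its sign.
A spacetime is recovered from its orbit by quadratures for `r`, `N` and `ψ`.

Along a finite orbit with `surf ≤ 0` the sum `x₂ + x₃` is antitone, at a rate comparable to
`X₃² + Y₁² - surf`. If it stays bounded in the past, its rate tends to zero there, which leaves only
the Minkowski points. If it tends to infinity, then in the coordinates `(X₃, Y₁) / (X₂ + X₃)` near
the boundary at infinity the flow is a radial flow about `P_λ` up to an integrable perturbation, so
the orbit converges, and its limit is a zero of the vector field at infinity: a point of `𝒞`, or
`P_λ` with `λ² > 6`. At each of these points other than `P_H` the radius tends to zero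
exponentially in `τ`, and the curvature blows up.

On `M` the potential vanishes and `Y₁ / X₃` is constant, so that an orbit is governed by its angle
alone. Of these orbits only the one with `Y₁ = 0` and `X₃ > 0` comes from `P_H`, and its quadratures
are those of the Schwarzschild metric.

Regularity at both ends is excluded by the scaling symmetry `r ↦ c r`, `ψ ↦ ψ + (2 / λ) log c` of
the exponential potential, under which `(y₁ - (λ / √2) x₃) r N` is conserved. At `P_M` it vanishes,
while at `P_H` and `P̄_H` it has opposite signs. Between `P_M` and `P̄_M` one uses that `X₃` times a
positive factor is strictly antitone. The same conserved quantity excludes anti-de Sitter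
asymptotics: it would force `y₁ / x₂ → λ / √2`, and then `x₂` would grow like `r ^ (1 - λ² / 2)`
instead of `r`.
-/

noncomputable section

namespace ExpPotential

section Calculus

open MeasureTheory Set

theorem exists_integratingFactor {g : ℝ → ℝ} (hg : Continuous g) :
    ∃ E : ℝ → ℝ, (∀ t, 0 < E t) ∧ ∀ t, HasDerivAt E (g t * E t) t := by
  refine ⟨fun t => Real.exp (∫ s in (0 : ℝ)..t, g s), fun t => Real.exp_pos _, fun t => ?_⟩
  have h := (intervalIntegral.integral_hasDerivAt_right (hg.intervalIntegrable 0 t)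
    (hg.stronglyMeasurableAtFilter _ _) hg.continuousAt).exp
  simpa only [mul_comm] using h

theorem exists_pos_eq_mul_of_hasDerivWithinAt_mul_self {J : Set ℝ} (hJ : J.OrdConnected)
    {f g : ℝ → ℝ} (hg : ContinuousOn g J) (hf : ∀ t ∈ J, HasDerivWithinAt f (g t * f t) J t)
    {s t : ℝ} (hs : s ∈ J) (ht : t ∈ J) : ∃ c > 0, f t = c * f s := by
  have hsub : uIcc s t ⊆ J := hJ.uIcc_subset hs ht
  let e : ℝ → ℝ := IccExtend (min_le_max : min s t ≤ max s t) fun x => g x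
  have he : Continuous e := (continuousOn_iff_continuous_domRestrict.1 (hg.mono hsub)).Icc_extend'
  obtain ⟨E, hE, hE'⟩ := exists_integratingFactor he.neg
  have hconst : ∀ x ∈ uIcc s t, HasDerivWithinAt (fun x => f x * E x) 0 (uIcc s t) x := by
    intro x hx
    have hex : e x = g x := IccExtend_of_mem _ _ hx
    refine (((hf x (hsub hx)).mono hsub).mul (hE' x).hasDerivWithinAt).congr_deriv ?_
    rw [Pi.neg_apply, hex]
    ring
  have heq : f t * E t = f s * E s := by
    have h := (convex_uIcc s t).norm_image_sub_le_of_norm_hasDerivWithin_le (C := 0) hconst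
      (by simp) left_mem_uIcc right_mem_uIcc
    rwa [zero_mul, norm_le_zero_iff, sub_eq_zero] at h
  refine ⟨E s / E t, div_pos (hE s) (hE t), ?_⟩
  rw [div_mul_eq_mul_div, eq_div_iff (hE t).ne', heq, mul_comm]

theorem pos_of_hasDerivAt_mul_self {f g : ℝ → ℝ} (hg : Continuous g)
    (hf : ∀ t, HasDerivAt f (g t * f t) t) {s : ℝ} (hs : 0 < f s) (t : ℝ) : 0 < f t := by
  obtain ⟨c, hc, h⟩ := exists_pos_eq_mul_of_hasDerivWithinAt_mul_self ordConnected_univ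
    hg.continuousOn (fun t _ => (hf t).hasDerivWithinAt) (mem_univ s) (mem_univ t)
  rw [h]
  positivity

theorem eq_zero_of_hasDerivAt_mul_self {f g : ℝ → ℝ} (hg : Continuous g)
    (hf : ∀ t, HasDerivAt f (g t * f t) t) {s : ℝ} (hs : f s = 0) (t : ℝ) : f t = 0 := by
  obtain ⟨c, -, h⟩ := exists_pos_eq_mul_of_hasDerivWithinAt_mul_self ordConnected_univ
    hg.continuousOn (fun t _ => (hf t).hasDerivWithinAt) (mem_univ s) (mem_univ t)
  rw [h, hs, mul_zero]

theorem exists_eq_const_mul_of_hasDerivAt_mul_self {f h g : ℝ → ℝ}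
    (hf : ∀ t, HasDerivAt f (g t * f t) t) (hh : ∀ t, HasDerivAt h (g t * h t) t)
    (hne : ∀ t, h t ≠ 0) : ∃ c, ∀ t, f t = c * h t := by
  have hd (t : ℝ) : HasDerivAt (fun t => f t / h t) 0 t :=
    ((hf t).div (hh t) (hne t)).congr_deriv (by ring)
  refine ⟨f 0 / h 0, fun t => ?_⟩
  rw [← div_eq_iff (hne t)]
  exact is_const_of_deriv_eq_zero (fun t => (hd t).differentiableAt) (fun t => (hd t).deriv) t 0

theorem exists_pos_hasDerivAt_mul {f g k : ℝ → ℝ} (hg : Continuous g)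
    (hf : ∀ t, HasDerivAt f (k t - g t * f t) t) :
    ∃ E : ℝ → ℝ, (∀ t, 0 < E t) ∧ ∀ t, HasDerivAt (fun t => f t * E t) (k t * E t) t := by
  obtain ⟨E, hE, hE'⟩ := exists_integratingFactor hg
  exact ⟨E, hE, fun t => ((hf t).mul (hE' t)).congr_deriv (by ring)⟩

theorem monotoneOn_Iic_of_hasDerivAt_nonneg {f f' : ℝ → ℝ} {T : ℝ}
    (hf : ∀ t ≤ T, HasDerivAt f (f' t) t) (h : ∀ t ≤ T, 0 ≤ f' t) : MonotoneOn f (Iic T) :=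
  monotoneOn_of_hasDerivWithinAt_nonneg (convex_Iic T)
    (fun t ht => (hf t ht).continuousAt.continuousWithinAt)
    (fun t ht => (hf t (interior_subset (s := Iic T) ht)).hasDerivWithinAt)
    (fun t ht => h t (interior_subset (s := Iic T) ht))

theorem antitoneOn_Ici_of_hasDerivAt_nonpos {f f' : ℝ → ℝ} {T : ℝ}
    (hf : ∀ t ≥ T, HasDerivAt f (f' t) t) (h : ∀ t ≥ T, f' t ≤ 0) : AntitoneOn f (Ici T) :=
  antitoneOn_of_hasDerivWithinAt_nonpos (convex_Ici T)
    (fun t ht => (hf t ht).continuousAt.continuousWithinAt)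
    (fun t ht => (hf t (interior_subset ht)).hasDerivWithinAt)
    (fun t ht => h t (interior_subset ht))

theorem strictAnti_of_hasDerivAt_nonpos {f f' : ℝ → ℝ} (hf : ∀ t, HasDerivAt f (f' t) t)
    (h : ∀ t, f' t ≤ 0) (hne : ∀ s t, s < t → ∃ x ∈ Ioo s t, f' x ≠ 0) : StrictAnti f := by
  have hanti : Antitone f := antitone_of_hasDerivAt_nonpos hf h
  refine fun s t hst => (hanti hst.le).lt_of_ne fun heq => ?_
  obtain ⟨x, hx, hx'⟩ := hne s t hst
  have hconst : f =ᶠ[𝓝 x] fun _ => f s := by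
    filter_upwards [Ioo_mem_nhds hx.1 hx.2] with y hy
    exact le_antisymm (hanti hy.1.le) (heq ▸ hanti hy.2.le)
  exact hx' ((hf x).unique ((hasDerivAt_const x _).congr_of_eventuallyEq hconst))

theorem nonpos_of_tendsto_zero_atBot {f f' : ℝ → ℝ} {T : ℝ}
    (hf : ∀ t ≤ T, HasDerivAt f (f' t) t) (h : ∀ t ≤ T, 0 < f t → f' t < 0)
    (hlim : Tendsto f atBot (𝓝 0)) : f T ≤ 0 := by
  refine le_of_forall_pos_le_add fun ε hε => ?_
  obtain ⟨s, hs, hsT⟩ := ((hlim.eventually_le_const hε).and (eventually_le_atBot T)).exists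
  rw [zero_add]
  exact image_le_of_deriv_right_lt_deriv_boundary (B := fun _ => ε) (B' := fun _ => 0)
    (fun t ht => (hf t ht.2).continuousAt.continuousWithinAt)
    (fun t ht => (hf t ht.2.le).hasDerivWithinAt) hs (fun t => hasDerivAt_const t ε)
    (fun t ht heq => h t ht.2.le (heq ▸ hε)) (right_mem_Icc.2 hsT)

theorem exists_tendsto_atBot_of_hasDerivAt_nonneg {f f' : ℝ → ℝ} {T c : ℝ}
    (hf : ∀ t ≤ T, HasDerivAt f (f' t) t) (h : ∀ t ≤ T, 0 ≤ f' t) (hc : ∀ t ≤ T, c ≤ f t) :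
    ∃ L, Tendsto f atBot (𝓝 L) := by
  have hmono : Monotone fun t => f (min t T) := fun s t hst =>
    monotoneOn_Iic_of_hasDerivAt_nonneg hf h (min_le_right s T) (min_le_right t T)
      (min_le_min_right T hst)
  have hbdd : BddBelow (range fun t => f (min t T)) :=
    ⟨c, forall_mem_range.2 fun _ => hc _ (min_le_right _ _)⟩
  refine ⟨_, (tendsto_atBot_ciInf hmono hbdd).congr' ?_⟩
  filter_upwards [eventually_le_atBot T] with t ht
  rw [min_eq_left ht]

theorem exists_tendsto_atBot_of_norm_deriv_le {E : Type*} [NormedAddCommGroup E] [NormedSpace ℝ E]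
    [CompleteSpace E] {f f' : ℝ → E} {g g' : ℝ → ℝ} {T L : ℝ}
    (hf : ∀ t ≤ T, HasDerivAt f (f' t) t) (hg : ∀ t ≤ T, HasDerivAt g (g' t) t)
    (hle : ∀ t ≤ T, ‖f' t‖ ≤ g' t) (hlim : Tendsto g atBot (𝓝 L)) :
    ∃ x, Tendsto f atBot (𝓝 x) := by
  have hdist : ∀ s ≤ T, ∀ t ≤ T, dist (f s) (f t) ≤ dist (g s) (g t) := by
    have hlt (s t : ℝ) (hst : s ≤ t) (ht : t ≤ T) : dist (f t) (f s) ≤ dist (g t) (g s) := by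
      have h := image_norm_le_of_norm_deriv_right_le_deriv_boundary' (a := s) (b := t)
        (f := fun x => f x - f s) (f' := f') (B := fun x => g x - g s) (B' := g')
        (fun x hx => ((hf x (hx.2.trans ht)).sub_const _).continuousAt.continuousWithinAt)
        (fun x hx => ((hf x (hx.2.le.trans ht)).sub_const _).hasDerivWithinAt) (by simp)
        (fun x hx => ((hg x (hx.2.trans ht)).sub_const _).continuousAt.continuousWithinAt)
        (fun x hx => ((hg x (hx.2.le.trans ht)).sub_const _).hasDerivWithinAt)
        (fun x hx => hle x (hx.2.le.trans ht)) ⟨hst, le_rfl⟩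
      rw [dist_eq_norm, Real.dist_eq]
      exact h.trans (le_abs_self _)
    intro s hs t ht
    rcases le_total s t with hst | hst
    · rw [dist_comm (f s), dist_comm (g s)]
      exact hlt s t hst ht
    · exact hlt t s hst hs
  refine cauchy_map_iff_exists_tendsto.1 (Metric.cauchy_iff.2 ⟨inferInstance, fun ε hε => ?_⟩)
  obtain ⟨u, hu, hgu⟩ := (Metric.cauchy_iff.1 hlim.cauchy_map).2 ε hε
  refine ⟨f '' (g ⁻¹' u ∩ Iic T), image_mem_map (inter_mem hu (Iic_mem_atBot T)), ?_⟩
  rintro _ ⟨s, ⟨hsu, hs⟩, rfl⟩ _ ⟨t, ⟨htu, ht⟩, rfl⟩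
  exact (hdist s hs t ht).trans_lt (hgu _ hsu _ htu)

theorem tendsto_atTop_of_tendsto_comp_neg {α : Type*} {f : ℝ → α} {l : Filter α}
    (h : Tendsto (fun t => f (-t)) atBot l) : Tendsto f atTop l := by
  simpa only [Function.comp_def, neg_neg] using h.comp tendsto_neg_atTop_atBot

theorem integrableAtFilter_atTop_of_comp_neg {E : Type*} [NormedAddCommGroup E] {f : ℝ → E}
    (h : IntegrableAtFilter (fun t => f (-t)) atBot volume) :
    IntegrableAtFilter f atTop volume := by
  obtain ⟨s, hs, hint⟩ := h
  obtain ⟨T, hT⟩ := mem_atBot_sets.1 hs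
  have hneg : IntegrableOn (fun t => f (-t)) (Iic (- -T)) := by
    rw [neg_neg]
    exact hint.mono_set hT
  exact ⟨Ici (-T), Ici_mem_atTop _, by simpa using hneg.comp_neg_Ici⟩

section NormedSpace

variable {E : Type*} [NormedAddCommGroup E] [NormedSpace ℝ E]

theorem hasDerivAt_comp_neg {f : ℝ → E} {f' : E} {t : ℝ} (hf : HasDerivAt f f' (-t)) :
    HasDerivAt (fun t => f (-t)) (-f') t := by
  simpa only [Function.comp_def, neg_smul, one_smul] using hf.scomp t (hasDerivAt_neg t)

theorem eq_zero_of_tendsto_of_tendsto_deriv_atTop {f f' : ℝ → E} {x m : E}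
    (hf : ∀ᶠ t in atTop, HasDerivAt f (f' t) t) (h : Tendsto f atTop (𝓝 x))
    (h' : Tendsto f' atTop (𝓝 m)) : m = 0 := by
  have hdiff : Tendsto (fun t => f (t + 1) - f t) atTop (𝓝 0) := by
    simpa using (h.comp (tendsto_atTop_add_const_right _ 1 tendsto_id)).sub h
  refine tendsto_nhds_unique (Metric.tendsto_nhds.2 fun ε hε => ?_) hdiff
  obtain ⟨T, hT⟩ :=
    eventually_atTop.1 (hf.and (h'.eventually (Metric.ball_mem_nhds m (half_pos hε))))
  filter_upwards [eventually_ge_atTop T] with t ht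
  have hbound : ‖f (t + 1) - (t + 1) • m - (f t - t • m)‖ ≤ ε / 2 * (t + 1 - t) := by
    refine norm_image_sub_le_of_norm_deriv_le_segment' (f := fun s => f s - s • m)
      (f' := fun s => f' s - (1 : ℝ) • m)
      (fun s hs => ?_) (fun s hs => ?_) (t + 1) ⟨by linarith, le_rfl⟩
    · exact ((hT s (ht.trans hs.1)).1.sub ((hasDerivAt_id s).smul_const m)).hasDerivWithinAt
    · rw [one_smul, ← dist_eq_norm]
      exact (hT s (ht.trans hs.1)).2.le
  have heq : f (t + 1) - f t - m = f (t + 1) - (t + 1) • m - (f t - t • m) := by module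
  rw [dist_eq_norm, heq]
  linarith

theorem eq_zero_of_tendsto_of_tendsto_deriv_atBot {f f' : ℝ → E} {x m : E}
    (hf : ∀ᶠ t in atBot, HasDerivAt f (f' t) t) (h : Tendsto f atBot (𝓝 x))
    (h' : Tendsto f' atBot (𝓝 m)) : m = 0 :=
  neg_eq_zero.1 <| eq_zero_of_tendsto_of_tendsto_deriv_atTop
    ((tendsto_neg_atTop_atBot.eventually hf).mono fun _ => hasDerivAt_comp_neg)
    (h.comp tendsto_neg_atTop_atBot) (h'.comp tendsto_neg_atTop_atBot).neg

end NormedSpace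

section ExponentialDecay

variable {f g : ℝ → ℝ} {k : ℝ}

theorem exists_eventually_le_exp_of_hasDerivAt_mul_self (hk : 0 < k) (hpos : ∀ t, 0 < f t)
    (hf : ∀ t, HasDerivAt f (g t * f t) t) (hg : Tendsto g atBot (𝓝 k)) :
    ∃ C, ∀ᶠ t in atBot, f t ≤ C * Real.exp (k / 2 * t) := by
  obtain ⟨T, hT⟩ := eventually_atBot.1 (hg.eventually (lt_mem_nhds (half_lt_self hk)))
  have hmono : MonotoneOn (fun t => f t * Real.exp (-(k / 2 * t))) (Iic T) := by
    refine monotoneOn_Iic_of_hasDerivAt_nonneg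
      (f' := fun t => (g t - k / 2) * (f t * Real.exp (-(k / 2 * t)))) (fun t _ => ?_)
      fun t ht => mul_nonneg (sub_nonneg.2 (hT t ht).le) (mul_pos (hpos t) (Real.exp_pos _)).le
    refine ((hf t).mul ((hasDerivAt_const_mul (k / 2)).neg.exp)).congr_deriv ?_
    simp only [Pi.neg_apply]
    ring
  refine ⟨f T * Real.exp (-(k / 2 * T)), ?_⟩
  filter_upwards [eventually_le_atBot T] with t ht
  rw [← div_le_iff₀ (Real.exp_pos _), div_eq_mul_inv, ← Real.exp_neg]
  exact hmono ht self_mem_Iic ht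

theorem tendsto_zero_of_hasDerivAt_mul_self (hk : 0 < k) (hpos : ∀ t, 0 < f t)
    (hf : ∀ t, HasDerivAt f (g t * f t) t) (hg : Tendsto g atBot (𝓝 k)) :
    Tendsto f atBot (𝓝 0) := by
  obtain ⟨C, hC⟩ := exists_eventually_le_exp_of_hasDerivAt_mul_self hk hpos hf hg
  have hexp : Tendsto (fun t => C * Real.exp (k / 2 * t)) atBot (𝓝 0) := by
    simpa only [mul_zero, Function.comp_def, id] using
      (Real.tendsto_exp_atBot.comp (tendsto_id.const_mul_atBot (half_pos hk))).const_mul C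
  exact squeeze_zero' (.of_forall fun t => (hpos t).le) hC hexp

theorem integrableAtFilter_of_hasDerivAt_mul_self (hk : 0 < k) (hpos : ∀ t, 0 < f t)
    (hf : ∀ t, HasDerivAt f (g t * f t) t) (hg : Tendsto g atBot (𝓝 k)) :
    IntegrableAtFilter f atBot volume := by
  obtain ⟨C, hC⟩ := exists_eventually_le_exp_of_hasDerivAt_mul_self hk hpos hf hg
  obtain ⟨T, hT⟩ := eventually_atBot.1 hC
  have hcont : Continuous f := continuous_iff_continuousAt.2 fun t => (hf t).continuousAt
  refine ⟨Iic T, Iic_mem_atBot T, ((integrableOn_exp_mul_Iic (half_pos hk) T).const_mul C).mono'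
    hcont.aestronglyMeasurable ?_⟩
  filter_upwards [self_mem_ae_restrict measurableSet_Iic] with t ht
  rw [Real.norm_of_nonneg (hpos t).le]
  exact hT t ht

end ExponentialDecay

theorem tendsto_zero_of_hasDerivAt_le_neg {f f' φ : ℝ → ℝ} {K : NNReal} {C : ℝ}
    (hf : ∀ t, HasDerivAt f (f' t) t) (hφ : LipschitzWith K φ) (hφ_nonneg : ∀ t, 0 ≤ φ t)
    (hle : ∀ t, f' t ≤ -φ t) (hC : ∀ t, f t ≤ C) : Tendsto φ atBot (𝓝 0) := by
  obtain ⟨ℓ, hℓ⟩ := exists_tendsto_atBot_of_hasDerivAt_nonneg (T := 0) (c := -C)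
    (fun t _ => (hf t).neg) (fun t _ => by linarith [hle t, hφ_nonneg t])
    (fun t _ => neg_le_neg (hC t))
  refine Metric.tendsto_nhds.2 fun ε hε => ?_
  -- Barbalat's argument: on a window of length `h` on which `φ` varies by at most `ε / 2`, `f`
  -- drops by at least `h (φ - ε / 2)`, whereas its drop tends to zero.
  obtain ⟨h, hh, hKh⟩ : ∃ h > 0, K * h ≤ ε / 2 :=
    ⟨ε / (2 * (K + 1)), by positivity, by
      rw [mul_div_assoc', div_le_div_iff₀ (by positivity) two_pos]
      nlinarith [K.coe_nonneg]⟩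
  have hdrop : Tendsto (fun t => f t - f (t + h)) atBot (𝓝 0) := by
    simpa [Function.comp_def, sub_eq_neg_add, add_comm] using
      (hℓ.comp (tendsto_atBot_add_const_right _ h tendsto_id)).sub hℓ
  filter_upwards [hdrop.eventually_lt_const (mul_pos hh (half_pos hε))] with t ht
  obtain ⟨x, ⟨htx, hxt⟩, hslope⟩ := exists_hasDerivAt_eq_slope f f' (lt_add_of_pos_right t hh)
    (fun x _ => (hf x).continuousAt.continuousWithinAt) (fun x _ => hf x)
  have hφx : φ x < ε / 2 := by
    rw [add_sub_cancel_left, eq_div_iff hh.ne'] at hslope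
    nlinarith [hle x]
  have hvar : |φ t - φ x| ≤ ε / 2 := by
    refine (hφ.dist_le_mul t x).trans (le_trans ?_ hKh)
    rw [dist_comm, Real.dist_eq, abs_of_pos (sub_pos.2 htx)]
    exact mul_le_mul_of_nonneg_left (by linarith) K.coe_nonneg
  rw [Real.dist_0_eq_abs, abs_of_nonneg (hφ_nonneg t)]
  linarith [(abs_le.1 hvar).2]

theorem exists_forall_hasDerivAt_of_lipschitzWith {E : Type*} [NormedAddCommGroup E]
    [NormedSpace ℝ E] [CompleteSpace E] {v : E → E} {K L : NNReal} (hv : LipschitzWith K v)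
    (hL : ∀ x, ‖v x‖ ≤ L) (x₀ : E) : ∃ α : ℝ → E, α 0 = x₀ ∧ ∀ t, HasDerivAt α (v (α t)) t := by
  have hloc : ∀ T : ℝ, 0 < T → ∃ α : ℝ → E, α 0 = x₀ ∧
      ∀ t ∈ Ioo (-T) T, HasDerivAt α (v (α t)) t := by
    intro T hT
    have hpl : IsPicardLindelof (fun _ => v) (tmin := -T) (tmax := T)
        ⟨0, by constructor <;> linarith⟩ x₀ (L * ⟨T, hT.le⟩) 0 L K :=
      .of_time_independent (fun x _ => hL x) hv.lipschitzOnWith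
        (by change (L : ℝ) * max (T - 0) (0 - -T) ≤ L * T - 0; simp)
    obtain ⟨α, h0, hα⟩ := hpl.exists_eq_forall_mem_Icc_hasDerivWithinAt₀
    exact ⟨α, h0, fun t ht => (hα t ⟨ht.1.le, ht.2.le⟩).hasDerivAt (Icc_mem_nhds ht.1 ht.2)⟩
  choose! α h0 hα using hloc
  have heq : ∀ S T : ℝ, 0 < S → S ≤ T → EqOn (α S) (α T) (Ioo (-S) S) := by
    intro S T hS hST
    refine ODE_solution_unique_of_mem_Ioo (v := fun _ => v) (s := fun _ => univ) (t₀ := 0)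
      (K := K) (fun t _ => hv.lipschitzOnWith) ⟨by linarith, hS⟩
      (fun t ht => ⟨hα S hS t ht, trivial⟩)
      (fun t ht => ⟨hα T (hS.trans_le hST) t ⟨by linarith [ht.1], by linarith [ht.2]⟩, trivial⟩) ?_
    rw [h0 S hS, h0 T (hS.trans_le hST)]
  refine ⟨fun t => α (|t| + 1) t, h0 _ (by positivity), fun t => ?_⟩
  have hglue : (fun t => α (|t| + 1) t) =ᶠ[𝓝 t] α (|t| + 2) := by
    have hmem : t ∈ Ioo (-(|t| + 1)) (|t| + 1) := abs_lt.1 (lt_add_one _)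
    filter_upwards [Ioo_mem_nhds hmem.1 hmem.2] with s hs
    have hs' : |s| < |t| + 1 := abs_lt.2 hs
    exact heq _ _ (by positivity) (by linarith) (abs_lt.1 (lt_add_one _))
  have hderiv := hα (|t| + 2) (by positivity) t (abs_lt.1 (by linarith))
  rw [← hglue.self_of_nhds] at hderiv
  exact hderiv.congr_of_eventuallyEq hglue

end Calculus

section PerturbedScaling

open scoped InnerProductSpace

variable {E : Type*} [NormedAddCommGroup E] [InnerProductSpace ℝ E] {w : ℝ → E} {v : E}
  {a b κ κ' : ℝ → ℝ} {T c : ℝ}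

theorem le_two_mul_inner_smul_sub_smul {u v : E} {α β : ℝ} (hβ : 0 ≤ β) :
    (2 * α - β) * ‖u‖ ^ 2 - β * ‖v‖ ^ 2 ≤ 2 * ⟪u, α • u - β • v⟫_ℝ := by
  have huv : 2 * ⟪u, v⟫_ℝ ≤ ‖u‖ ^ 2 + ‖v‖ ^ 2 := by
    nlinarith [real_inner_le_norm u v, sq_nonneg (‖u‖ - ‖v‖)]
  rw [inner_sub_right, real_inner_smul_right, real_inner_smul_right, real_inner_self_eq_norm_sq]
  nlinarith [mul_le_mul_of_nonneg_left huv hβ]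

theorem exists_tendsto_norm_sq_atBot (hw : ∀ t ≤ T, HasDerivAt w (a t • w t - b t • v) t)
    (hκ : ∀ t ≤ T, HasDerivAt κ (κ' t) t) (hc : ∀ t ≤ T, c ≤ κ t) (hb : ∀ t ≤ T, 0 ≤ b t)
    (hbκ : ∀ t ≤ T, b t ≤ κ' t) (hab : ∀ t ≤ T, -b t ≤ a t) :
    ∃ m, Tendsto (fun t => ‖w t‖ ^ 2) atBot (𝓝 m) := by
  obtain ⟨k, hk⟩ := exists_tendsto_atBot_of_hasDerivAt_nonneg hκ
    (fun t ht => (hb t ht).trans (hbκ t ht)) hc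
  -- `(‖w‖ ^ 2)' ≥ -b (3 ‖w‖ ^ 2 + ‖v‖ ^ 2)`, so `log (‖w‖ ^ 2 + 1)` decreases no faster than a
  -- multiple of `κ` increases.
  obtain ⟨l, hl⟩ : ∃ l, Tendsto (fun t => Real.log (‖w t‖ ^ 2 + 1) + (3 + ‖v‖ ^ 2) * κ t) atBot
      (𝓝 l) := by
    refine exists_tendsto_atBot_of_hasDerivAt_nonneg (c := (3 + ‖v‖ ^ 2) * c) (fun t ht =>
      (((hw t ht).norm_sq.add_const 1).log (by positivity)).add ((hκ t ht).const_mul _))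
      (fun t ht => ?_) (fun t ht => ?_)
    · have hinner := le_two_mul_inner_smul_sub_smul (u := w t) (v := v) (α := a t) (hb t ht)
      have hdiv : -((3 + ‖v‖ ^ 2) * b t) ≤
          2 * ⟪w t, a t • w t - b t • v⟫_ℝ / (‖w t‖ ^ 2 + 1) := by
        rw [le_div_iff₀ (by positivity)]
        nlinarith [mul_nonneg (neg_le_iff_add_nonneg.1 (hab t ht)) (sq_nonneg ‖w t‖), hb t ht,
          mul_nonneg (hb t ht) (mul_nonneg (sq_nonneg ‖w t‖) (sq_nonneg ‖v‖))]
      nlinarith [mul_le_mul_of_nonneg_left (hbκ t ht) (by positivity : 0 ≤ 3 + ‖v‖ ^ 2)]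
    · have hlog : 0 ≤ Real.log (‖w t‖ ^ 2 + 1) := Real.log_nonneg (by nlinarith [sq_nonneg ‖w t‖])
      nlinarith [mul_le_mul_of_nonneg_left (hc t ht) (by positivity : 0 ≤ 3 + ‖v‖ ^ 2)]
  refine ⟨_, ((Real.continuous_exp.tendsto _).comp
    (hl.sub (hk.const_mul (3 + ‖v‖ ^ 2)))).sub_const 1 |>.congr fun t => ?_⟩
  simp only [Function.comp_apply, add_sub_cancel_right]
  rw [Real.exp_log (by positivity), add_sub_cancel_right]

theorem norm_smul_sub_smul_le {u v : E} {m α β β' : ℝ} (hm : 0 < m) (hlow : m / 2 < ‖u‖ ^ 2)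
    (hupp : ‖u‖ ^ 2 < m + 1) (hβ : 0 ≤ β) (hββ' : β ≤ β') (hαβ : -β ≤ α) :
    ‖α • u - β • v‖ ≤
      (m + 2 + ‖v‖) * (2 * ⟪u, α • u - β • v⟫_ℝ / ‖u‖ ^ 2 + (4 + 2 * ‖v‖ ^ 2 / m) * β') := by
  have hgrowth : α + 2 * β ≤
      2 * ⟪u, α • u - β • v⟫_ℝ / ‖u‖ ^ 2 + (4 + 2 * ‖v‖ ^ 2 / m) * β' := by
    have hvm : ‖v‖ ^ 2 ≤ 2 * ‖v‖ ^ 2 / m * ‖u‖ ^ 2 := by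
      rw [div_mul_eq_mul_div, le_div_iff₀ hm]
      nlinarith [sq_nonneg ‖v‖]
    have hdiv : 2 * α - β - β * (2 * ‖v‖ ^ 2 / m) ≤ 2 * ⟪u, α • u - β • v⟫_ℝ / ‖u‖ ^ 2 := by
      rw [le_div_iff₀ ((half_pos hm).trans hlow)]
      nlinarith [mul_le_mul_of_nonneg_left hvm hβ, le_two_mul_inner_smul_sub_smul (u := u) (v := v)
        (α := α) hβ]
    have hC : 0 ≤ 4 + 2 * ‖v‖ ^ 2 / m := by positivity
    nlinarith [mul_le_mul_of_nonneg_left hββ' hC]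
  have hu : ‖u‖ ≤ m + 2 := (abs_le_of_sq_le_sq' (by nlinarith) (by linarith)).2
  have hα : |α| ≤ α + 2 * β := abs_le.2 ⟨by linarith, by linarith⟩
  calc ‖α • u - β • v‖ ≤ |α| * ‖u‖ + β * ‖v‖ := by
        simpa only [norm_smul, Real.norm_eq_abs, abs_of_nonneg hβ] using norm_sub_le (α • u) (β • v)
    _ ≤ (α + 2 * β) * (m + 2) + (α + 2 * β) * ‖v‖ := by
        gcongr <;> linarith
    _ = (m + 2 + ‖v‖) * (α + 2 * β) := by ring
    _ ≤ _ := mul_le_mul_of_nonneg_left hgrowth (by positivity)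

theorem exists_tendsto_atBot_of_hasDerivAt_smul_sub_smul [CompleteSpace E]
    (hw : ∀ t ≤ T, HasDerivAt w (a t • w t - b t • v) t)
    (hκ : ∀ t ≤ T, HasDerivAt κ (κ' t) t) (hc : ∀ t ≤ T, c ≤ κ t) (hb : ∀ t ≤ T, 0 ≤ b t)
    (hbκ : ∀ t ≤ T, b t ≤ κ' t) (hab : ∀ t ≤ T, -b t ≤ a t) :
    ∃ x, Tendsto w atBot (𝓝 x) := by
  obtain ⟨m, hm⟩ := exists_tendsto_norm_sq_atBot hw hκ hc hb hbκ hab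
  obtain ⟨k, hk⟩ := exists_tendsto_atBot_of_hasDerivAt_nonneg hκ
    (fun t ht => (hb t ht).trans (hbκ t ht)) hc
  rcases (ge_of_tendsto' hm fun t => sq_nonneg ‖w t‖).eq_or_lt with rfl | hm0
  · refine ⟨0, tendsto_zero_iff_norm_tendsto_zero.2 ?_⟩
    simpa only [Real.sqrt_sq (norm_nonneg _), Real.sqrt_zero] using hm.sqrt
  -- As `‖w‖` stays away from `0` and `∞`, the speed of `w` is at most a multiple of the growth of
  -- `log (‖w‖ ^ 2) + C κ`, which converges.
  obtain ⟨T', hT'⟩ := eventually_atBot.1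
    ((hm.eventually_const_lt (half_lt_self hm0)).and (hm.eventually_lt_const (lt_add_one m)))
  have hlog := (hm.log hm0.ne').add (hk.const_mul (4 + 2 * ‖v‖ ^ 2 / m))
  refine exists_tendsto_atBot_of_norm_deriv_le (T := min T T')
    (g' := fun t => (m + 2 + ‖v‖) * (2 * ⟪w t, a t • w t - b t • v⟫_ℝ / ‖w t‖ ^ 2 +
      (4 + 2 * ‖v‖ ^ 2 / m) * κ' t))
    (fun t ht => hw t (le_min_iff.1 ht).1) (fun t ht => ?_) (fun t ht => ?_)
    (hlog.const_mul (m + 2 + ‖v‖))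
  · obtain ⟨htT, htT'⟩ := le_min_iff.1 ht
    exact (((hw t htT).norm_sq.log ((half_pos hm0).trans (hT' t htT').1).ne').add
      ((hκ t htT).const_mul _)).const_mul _
  · obtain ⟨htT, htT'⟩ := le_min_iff.1 ht
    exact norm_smul_sub_smul_le hm0 (hT' t htT').1 (hT' t htT').2 (hb t htT) (hbκ t htT) (hab t htT)

end PerturbedScaling

/-! ### The flow and its invariant surface -/

/-- Half of the rate at which `log (1 - normSq)` decreases along the flow. -/
def growth (lam : ℝ) (p : Pt) : ℝ :=
  3 * p.1 ^ 2 * p.2.1 + p.1 * p.2.1 ^ 2 - p.2.1 - (2 * p.1 + p.2.1) * p.2.2 ^ 2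
    + lam / √2 * p.2.2 * surf p

theorem field_fst (lam : ℝ) (p : Pt) :
    (field lam p).1 = p.1 * p.2.1 - p.2.2 ^ 2 - growth lam p * p.1 := by
  simp only [field, growth, surf]; ring

theorem field_snd_fst (lam : ℝ) (p : Pt) :
    (field lam p).2.1 = -((p.1 + p.2.1) * p.2.1) + surf p - growth lam p * p.2.1 := by
  simp only [field, growth, surf]; ring

theorem field_snd_snd (lam : ℝ) (p : Pt) :
    (field lam p).2.2 =
      -((p.1 + p.2.1) * p.2.2) + lam / √2 * surf p - growth lam p * p.2.2 := by
  simp only [field, growth, surf]; ring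

theorem field_neg (lam : ℝ) (p : Pt) : field lam (-p) = field lam p := by
  simp only [field, Prod.fst_neg, Prod.snd_neg, Prod.mk.injEq]
  refine ⟨?_, ?_, ?_⟩ <;> ring

theorem surf_neg (p : Pt) : surf (-p) = surf p := by
  simp only [surf, Prod.fst_neg, Prod.snd_neg]; ring

theorem normSq_neg (p : Pt) : normSq (-p) = normSq p := by
  simp only [normSq, Prod.fst_neg, Prod.snd_neg]; ring

theorem growth_neg (lam : ℝ) (p : Pt) : growth lam (-p) = -growth lam p := by
  simp only [growth, surf_neg, Prod.fst_neg, Prod.snd_neg]; ring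

theorem continuous_surf : Continuous surf := by unfold surf; fun_prop

theorem continuous_normSq : Continuous normSq := by unfold normSq; fun_prop

theorem continuous_growth (lam : ℝ) : Continuous (growth lam) := by
  unfold growth surf; fun_prop

theorem continuous_field (lam : ℝ) : Continuous (field lam) := by unfold field; fun_prop

theorem isCompact_normSq_le_one : IsCompact {p : Pt | normSq p ≤ 1} := by
  refine (isCompact_Icc (a := ((-1, -1, -1) : Pt)) (b := (1, 1, 1))).of_isClosed_subset
    (isClosed_le continuous_normSq continuous_const) fun p hp => ?_
  simp only [normSq, Set.mem_ofPred_eq] at hp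
  refine ⟨⟨?_, ?_, ?_⟩, ?_, ?_, ?_⟩ <;> simp only <;>
    nlinarith [sq_nonneg p.1, sq_nonneg p.2.1, sq_nonneg p.2.2]

theorem hasDerivWithinAt_fst {E F : Type*} [NormedAddCommGroup E] [NormedSpace ℝ E]
    [NormedAddCommGroup F] [NormedSpace ℝ F] {γ : ℝ → E × F} {v : E × F} {J : Set ℝ} {τ : ℝ}
    (h : HasDerivWithinAt γ v J τ) : HasDerivWithinAt (fun t => (γ t).1) v.1 J τ :=
  h.hasFDerivWithinAt.fst.hasDerivWithinAt.congr_deriv (by simp)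

theorem hasDerivWithinAt_snd {E F : Type*} [NormedAddCommGroup E] [NormedSpace ℝ E]
    [NormedAddCommGroup F] [NormedSpace ℝ F] {γ : ℝ → E × F} {v : E × F} {J : Set ℝ} {τ : ℝ}
    (h : HasDerivWithinAt γ v J τ) : HasDerivWithinAt (fun t => (γ t).2) v.2 J τ :=
  h.hasFDerivWithinAt.snd.hasDerivWithinAt.congr_deriv (by simp)

section WithinAt

variable {lam : ℝ} {γ : ℝ → Pt} {J : Set ℝ} {τ : ℝ}

theorem hasDerivWithinAt_X₂ (h : HasDerivWithinAt γ (field lam (γ τ)) J τ) :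
    HasDerivWithinAt (fun t => (γ t).1)
      ((γ τ).1 * (γ τ).2.1 - (γ τ).2.2 ^ 2 - growth lam (γ τ) * (γ τ).1) J τ := by
  rw [← field_fst]
  exact hasDerivWithinAt_fst h

theorem hasDerivWithinAt_X₃ (h : HasDerivWithinAt γ (field lam (γ τ)) J τ) :
    HasDerivWithinAt (fun t => (γ t).2.1)
      (-(((γ τ).1 + (γ τ).2.1) * (γ τ).2.1) + surf (γ τ) - growth lam (γ τ) * (γ τ).2.1) J τ := by
  rw [← field_snd_fst]
  exact hasDerivWithinAt_fst (hasDerivWithinAt_snd h)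

theorem hasDerivWithinAt_Y₁ (h : HasDerivWithinAt γ (field lam (γ τ)) J τ) :
    HasDerivWithinAt (fun t => (γ t).2.2)
      (-(((γ τ).1 + (γ τ).2.1) * (γ τ).2.2) + lam / √2 * surf (γ τ)
        - growth lam (γ τ) * (γ τ).2.2) J τ := by
  rw [← field_snd_snd]
  exact hasDerivWithinAt_snd (hasDerivWithinAt_snd h)

theorem hasDerivWithinAt_surf (h : HasDerivWithinAt γ (field lam (γ τ)) J τ) :
    HasDerivWithinAt (fun t => surf (γ t))
      (2 * ((γ τ).1 - lam / √2 * (γ τ).2.2 - growth lam (γ τ)) * surf (γ τ)) J τ := by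
  have hX₂ := hasDerivWithinAt_X₂ h
  have hX₃ := hasDerivWithinAt_X₃ h
  refine ((((hX₂.pow 2).const_mul 2).add ((hX₂.const_mul 2).mul hX₃)).add
    (hX₃.pow 2)).sub_const 1 |>.congr_deriv ?_
  simp only [growth, surf]
  push_cast
  ring

theorem hasDerivWithinAt_one_sub_normSq (h : HasDerivWithinAt γ (field lam (γ τ)) J τ) :
    HasDerivWithinAt (fun t => 1 - normSq (γ t))
      (-2 * growth lam (γ τ) * (1 - normSq (γ τ))) J τ := by
  refine ((((hasDerivWithinAt_X₂ h).pow 2).add ((hasDerivWithinAt_X₃ h).pow 2)).add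
    ((hasDerivWithinAt_Y₁ h).pow 2)).const_sub 1 |>.congr_deriv ?_
  simp only [growth, surf, normSq]
  push_cast
  ring

end WithinAt

namespace IsFlowLine

variable {lam : ℝ} {γ : ℝ → Pt} (h : IsFlowLine lam γ)

include h

theorem continuous : Continuous γ := continuous_iff_continuousAt.2 fun τ => (h τ).continuousAt

theorem hasDerivAt_X₂ (τ : ℝ) : HasDerivAt (fun t => (γ t).1)
    ((γ τ).1 * (γ τ).2.1 - (γ τ).2.2 ^ 2 - growth lam (γ τ) * (γ τ).1) τ :=
  hasDerivWithinAt_univ.1 (hasDerivWithinAt_X₂ (h τ).hasDerivWithinAt)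

theorem hasDerivAt_X₃ (τ : ℝ) : HasDerivAt (fun t => (γ t).2.1)
    (-(((γ τ).1 + (γ τ).2.1) * (γ τ).2.1) + surf (γ τ) - growth lam (γ τ) * (γ τ).2.1) τ :=
  hasDerivWithinAt_univ.1 (hasDerivWithinAt_X₃ (h τ).hasDerivWithinAt)

theorem hasDerivAt_Y₁ (τ : ℝ) : HasDerivAt (fun t => (γ t).2.2)
    (-(((γ τ).1 + (γ τ).2.1) * (γ τ).2.2) + lam / √2 * surf (γ τ)
      - growth lam (γ τ) * (γ τ).2.2) τ :=
  hasDerivWithinAt_univ.1 (hasDerivWithinAt_Y₁ (h τ).hasDerivWithinAt)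

theorem hasDerivAt_surf (τ : ℝ) : HasDerivAt (fun t => surf (γ t))
    (2 * ((γ τ).1 - lam / √2 * (γ τ).2.2 - growth lam (γ τ)) * surf (γ τ)) τ :=
  hasDerivWithinAt_univ.1 (hasDerivWithinAt_surf (h τ).hasDerivWithinAt)

theorem hasDerivAt_one_sub_normSq (τ : ℝ) : HasDerivAt (fun t => 1 - normSq (γ t))
    (-2 * growth lam (γ τ) * (1 - normSq (γ τ))) τ :=
  hasDerivWithinAt_univ.1 (hasDerivWithinAt_one_sub_normSq (h τ).hasDerivWithinAt)

theorem neg : IsFlowLine lam fun τ => -γ (-τ) := fun τ => by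
  refine (hasDerivAt_comp_neg (h (-τ))).neg.congr_deriv ?_
  rw [field_neg, neg_neg]

end IsFlowLine

theorem IsOrbit.neg {lam : ℝ} {γ : ℝ → Pt} (h : IsOrbit lam γ) : IsOrbit lam fun τ => -γ (-τ) :=
  ⟨h.1.neg, fun τ => by
    simpa only [phaseSpace, Set.mem_ofPred_eq, surf_neg, normSq_neg] using h.2 (-τ)⟩

theorem IsFinite.neg {γ : ℝ → Pt} (h : IsFinite γ) : IsFinite fun τ => -γ (-τ) :=
  fun τ => (normSq_neg (γ (-τ))).trans_lt (h (-τ))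

theorem surf_eq_zero_iff (p : Pt) : surf p = 0 ↔ (p.1 + p.2.1) ^ 2 = 1 - p.1 ^ 2 := by
  rw [surf, ← sub_eq_zero (a := (p.1 + p.2.1) ^ 2)]
  ring_nf

theorem add_ne_zero_of_surf_eq_zero {p : Pt} (h : surf p = 0) (hn : normSq p ≤ 1) :
    p.1 + p.2.1 ≠ 0 := fun h0 => by
  rw [surf_eq_zero_iff, h0] at h
  simp only [normSq, eq_neg_of_add_eq_zero_right h0] at hn
  nlinarith [sq_nonneg p.2.2]

theorem mem_surfM_iff (p : Pt) :
    p ∈ surfM ↔ surf p = 0 ∧ normSq p ≤ 1 ∧ 0 < p.1 + p.2.1 := by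
  simp only [surfM, Set.mem_ofPred_eq]
  constructor
  · rintro ⟨hsum, hX₂, hn⟩
    have hsurf : surf p = 0 := by
      rw [surf_eq_zero_iff, hsum, Real.sq_sqrt (sub_nonneg.2 hX₂)]
    exact ⟨hsurf, hn, (add_ne_zero_of_surf_eq_zero hsurf hn).symm.lt_of_le
      (hsum ▸ Real.sqrt_nonneg _)⟩
  · rintro ⟨hsurf, hn, hpos⟩
    rw [surf_eq_zero_iff] at hsurf
    exact ⟨by rw [← hsurf, Real.sqrt_sq hpos.le],
      by nlinarith [sq_nonneg (p.1 + p.2.1)], hn⟩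

theorem neg_mem_surfMbar_iff (p : Pt) : -p ∈ surfMbar ↔ p ∈ surfM := by
  simp only [surfM, surfMbar, Set.mem_ofPred_eq, normSq_neg, Prod.fst_neg, Prod.snd_neg, neg_sq,
    ← neg_add, neg_inj]

theorem neg_mem_surfM_iff (p : Pt) : -p ∈ surfM ↔ p ∈ surfMbar := by
  rw [← neg_mem_surfMbar_iff, neg_neg]

theorem mem_surfMbar_iff (p : Pt) :
    p ∈ surfMbar ↔ surf p = 0 ∧ normSq p ≤ 1 ∧ p.1 + p.2.1 < 0 := by
  rw [← neg_mem_surfM_iff, mem_surfM_iff, surf_neg, normSq_neg, Prod.fst_neg, Prod.snd_neg,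
    Prod.fst_neg, ← neg_add, neg_pos]

theorem surf_eq_zero_inter_ball_eq :
    {p : Pt | surf p = 0 ∧ normSq p ≤ 1} = surfM ∪ surfMbar := by
  ext p
  simp only [Set.mem_ofPred_eq, Set.mem_union, mem_surfM_iff, mem_surfMbar_iff]
  have h := @add_ne_zero_of_surf_eq_zero p
  grind

theorem disjoint_surfM_surfMbar : Disjoint surfM surfMbar :=
  Set.disjoint_left.2 fun p h h' =>
    ((mem_surfM_iff p).1 h).2.2.not_gt ((mem_surfMbar_iff p).1 h').2.2

section Invariance

variable {lam : ℝ} {γ : ℝ → Pt} {J : Set ℝ} {s t : ℝ}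

theorem surf_eq_zero_of_surf_eq_zero (hJ : J.OrdConnected)
    (hγ : ∀ τ ∈ J, HasDerivWithinAt γ (field lam (γ τ)) J τ) (hs : s ∈ J) (ht : t ∈ J)
    (h : surf (γ s) = 0) : surf (γ t) = 0 := by
  have hcont : ContinuousOn γ J := fun τ hτ => (hγ τ hτ).continuousWithinAt
  have hgrowth : ContinuousOn (fun τ => growth lam (γ τ)) J :=
    (continuous_growth lam).comp_continuousOn hcont
  obtain ⟨c, -, hc⟩ := exists_pos_eq_mul_of_hasDerivWithinAt_mul_self hJ (by fun_prop)
    (fun τ hτ => hasDerivWithinAt_surf (hγ τ hτ)) hs ht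
  rw [hc, h, mul_zero]

theorem normSq_le_one_of_normSq_le_one (hJ : J.OrdConnected)
    (hγ : ∀ τ ∈ J, HasDerivWithinAt γ (field lam (γ τ)) J τ) (hs : s ∈ J) (ht : t ∈ J)
    (h : normSq (γ s) ≤ 1) : normSq (γ t) ≤ 1 := by
  have hcont : ContinuousOn γ J := fun τ hτ => (hγ τ hτ).continuousWithinAt
  have hgrowth : ContinuousOn (fun τ => growth lam (γ τ)) J :=
    (continuous_growth lam).comp_continuousOn hcont
  obtain ⟨c, hc0, hc⟩ := exists_pos_eq_mul_of_hasDerivWithinAt_mul_self hJ (by fun_prop)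
    (fun τ hτ => hasDerivWithinAt_one_sub_normSq (hγ τ hτ)) hs ht
  exact sub_nonneg.1 (hc ▸ mul_nonneg hc0.le (sub_nonneg.2 h))

theorem mem_surfM_of_mem_surfM (hJ : J.OrdConnected)
    (hγ : ∀ τ ∈ J, HasDerivWithinAt γ (field lam (γ τ)) J τ) (hs : s ∈ J) (ht : t ∈ J)
    (h : γ s ∈ surfM) : γ t ∈ surfM := by
  rw [mem_surfM_iff] at h ⊢
  obtain ⟨hsurf, hn, hpos⟩ := h
  have hsub := hJ.uIcc_subset hs ht
  have hsurf' {τ : ℝ} (hτ : τ ∈ J) := surf_eq_zero_of_surf_eq_zero hJ hγ hs hτ hsurf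
  have hn' {τ : ℝ} (hτ : τ ∈ J) := normSq_le_one_of_normSq_le_one hJ hγ hs hτ hn
  refine ⟨hsurf' ht, hn' ht, lt_of_not_ge fun hneg => ?_⟩
  have hcont : ContinuousOn γ (Set.uIcc s t) := fun τ hτ =>
    (hγ τ (hsub hτ)).continuousWithinAt.mono hsub
  obtain ⟨τ, hτ, hτ0⟩ := intermediate_value_uIcc
    (show ContinuousOn (fun τ => (γ τ).1 + (γ τ).2.1) (Set.uIcc s t) by fun_prop)
    (Set.mem_uIcc.2 (Or.inr ⟨hneg, hpos.le⟩))
  exact add_ne_zero_of_surf_eq_zero (hsurf' (hsub hτ)) (hn' (hsub hτ)) hτ0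

theorem mem_surfMbar_of_mem_surfMbar (hJ : J.OrdConnected)
    (hγ : ∀ τ ∈ J, HasDerivWithinAt γ (field lam (γ τ)) J τ) (hs : s ∈ J) (ht : t ∈ J)
    (h : γ s ∈ surfMbar) : γ t ∈ surfMbar := by
  have hrev (τ : ℝ) (hτ : τ ∈ -J) : HasDerivWithinAt (fun τ => -γ (-τ))
      (field lam (-γ (-τ))) (-J) τ :=
    ((hγ (-τ) hτ).scomp τ (hasDerivAt_neg τ).hasDerivWithinAt fun τ hτ => hτ).neg.congr_deriv
      (by simp only [field_neg, neg_smul, one_smul, neg_neg])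
  have hJ' : (-J).OrdConnected := hJ.preimage_anti fun _ _ h => neg_le_neg h
  rw [← neg_mem_surfM_iff] at h ⊢
  simpa only [neg_neg] using mem_surfM_of_mem_surfM hJ' hrev (s := -s) (t := -t)
    (by simpa only [Set.neg_mem_neg] using hs) (by simpa only [Set.neg_mem_neg] using ht)
    (by simpa only [neg_neg] using h)

end Invariance

/-! ### The sum `x₂ + x₃` along a finite orbit -/

/-- The quantity `x₂ + x₃`, which decreases along finite orbits. -/
def slope (p : Pt) : ℝ := (p.1 + p.2.1) / √(1 - normSq p)

/-- The rate at which `slope` decreases, in units of `√(1 - normSq)`. -/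
def slopeRate (p : Pt) : ℝ := p.2.2 ^ 2 + p.2.1 ^ 2 - surf p

theorem normSq_nonneg (p : Pt) : 0 ≤ normSq p := by
  unfold normSq
  positivity

theorem contDiff_slopeRate : ContDiff ℝ 1 slopeRate := by
  unfold slopeRate surf
  fun_prop

theorem slopeRate_nonneg {p : Pt} (hp : surf p ≤ 0) : 0 ≤ slopeRate p :=
  sub_nonneg.2 (hp.trans (by positivity))

theorem inv_sqrt_two_sq : (1 / √2 : ℝ) ^ 2 = 1 / 2 := by
  rw [div_pow, Real.sq_sqrt zero_le_two, one_pow]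

theorem mem_critCurve_iff (p : Pt) :
    p ∈ critCurve ↔ surf p = 0 ∧ normSq p = 1 ∧ 0 < p.1 + p.2.1 := by
  simp only [critCurve, Set.mem_ofPred_eq, mem_surfM_iff]
  exact ⟨fun ⟨⟨hsurf, _, hpos⟩, hn⟩ => ⟨hsurf, hn, hpos⟩,
    fun ⟨hsurf, hn, hpos⟩ => ⟨⟨hsurf, hn.le, hpos⟩, hn⟩⟩

theorem tendsto_zero_of_sq {α : Type*} {f : α → ℝ} {l : Filter α}
    (h : Tendsto (fun t => f t ^ 2) l (𝓝 0)) : Tendsto f l (𝓝 0) := by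
  rw [tendsto_zero_iff_abs_tendsto_zero]
  simpa only [Real.sqrt_sq_eq_abs, Real.sqrt_zero, Function.comp_def] using h.sqrt

namespace IsFlowLine

variable {lam : ℝ} {γ : ℝ → Pt} (h : IsFlowLine lam γ)

include h

theorem hasDerivAt_X₂_add_X₃ (τ : ℝ) : HasDerivAt (fun t => (γ t).1 + (γ t).2.1)
    (-slopeRate (γ τ) - growth lam (γ τ) * ((γ τ).1 + (γ τ).2.1)) τ :=
  ((h.hasDerivAt_X₂ τ).add (h.hasDerivAt_X₃ τ)).congr_deriv (by rw [slopeRate]; ring)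

theorem hasDerivAt_sqrt_one_sub_normSq {τ : ℝ} (hτ : normSq (γ τ) < 1) :
    HasDerivAt (fun t => √(1 - normSq (γ t))) (-growth lam (γ τ) * √(1 - normSq (γ τ))) τ := by
  have hpos : 0 < 1 - normSq (γ τ) := sub_pos.2 hτ
  refine ((h.hasDerivAt_one_sub_normSq τ).sqrt hpos.ne').congr_deriv ?_
  rw [div_eq_iff (by positivity), ← Real.sq_sqrt hpos.le, Real.sqrt_sq (Real.sqrt_nonneg _)]
  ring

theorem hasDerivAt_slope {τ : ℝ} (hτ : normSq (γ τ) < 1) :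
    HasDerivAt (fun t => slope (γ t)) (-slopeRate (γ τ) / √(1 - normSq (γ τ))) τ := by
  have hpos := (Real.sqrt_pos.2 (sub_pos.2 hτ)).ne'
  refine ((h.hasDerivAt_X₂_add_X₃ τ).div (h.hasDerivAt_sqrt_one_sub_normSq hτ) hpos).congr_deriv ?_
  field_simp
  ring

theorem antitone_slope (hf : IsFinite γ) (hs : ∀ τ, surf (γ τ) ≤ 0) :
    Antitone fun t => slope (γ t) :=
  antitone_of_hasDerivAt_nonpos (fun τ => h.hasDerivAt_slope (hf τ)) fun τ =>
    div_nonpos_of_nonpos_of_nonneg (neg_nonpos.2 (slopeRate_nonneg (hs τ))) (Real.sqrt_nonneg _)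

theorem exists_lipschitzWith_comp (hb : ∀ τ, normSq (γ τ) ≤ 1) {F : Pt → ℝ}
    (hF : ContDiff ℝ 1 F) : ∃ K, LipschitzWith K fun t => F (γ t) := by
  have hderiv (τ : ℝ) : HasDerivAt (fun t => F (γ t)) (fderiv ℝ F (γ τ) (field lam (γ τ))) τ :=
    (hF.differentiable one_ne_zero (γ τ)).hasFDerivAt.comp_hasDerivAt τ (h τ)
  have hcont : Continuous fun p => fderiv ℝ F p (field lam p) :=
    (hF.continuous_fderiv one_ne_zero).clm_apply (continuous_field lam)
  obtain ⟨K, hK⟩ := isCompact_normSq_le_one.exists_bound_of_continuousOn hcont.continuousOn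
  refine ⟨K.toNNReal, lipschitzWith_of_nnnorm_deriv_le
    (fun τ => (hderiv τ).differentiableAt) fun τ => ?_⟩
  rw [← NNReal.coe_le_coe, coe_nnnorm, (hderiv τ).deriv]
  exact (hK (γ τ) (hb τ)).trans (Real.le_coe_toNNReal K)

theorem tendsto_slopeRate_atBot_of_slope_le (hf : IsFinite γ) (hs : ∀ τ, surf (γ τ) ≤ 0) {C : ℝ}
    (hC : ∀ τ, slope (γ τ) ≤ C) : Tendsto (fun t => slopeRate (γ t)) atBot (𝓝 0) := by
  obtain ⟨K, hK⟩ := h.exists_lipschitzWith_comp (fun τ => (hf τ).le) contDiff_slopeRate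
  refine tendsto_zero_of_hasDerivAt_le_neg (fun τ => h.hasDerivAt_slope (hf τ)) hK
    (fun τ => slopeRate_nonneg (hs τ)) (fun τ => ?_) hC
  rw [neg_div]
  exact neg_le_neg (le_div_self (slopeRate_nonneg (hs τ)) (Real.sqrt_pos.2 (sub_pos.2 (hf τ)))
    (Real.sqrt_le_one.2 (sub_le_self 1 (normSq_nonneg _))))

theorem exists_tendsto_slope_atBot_of_slope_le (hf : IsFinite γ) (hs : ∀ τ, surf (γ τ) ≤ 0) {C : ℝ}
    (hC : ∀ τ, slope (γ τ) ≤ C) : ∃ ℓ, Tendsto (fun t => slope (γ t)) atBot (𝓝 ℓ) :=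
  ⟨_, tendsto_atBot_ciSup (h.antitone_slope hf hs) ⟨C, Set.forall_mem_range.2 hC⟩⟩

theorem tendsto_PM_or_PMbar_of_slope_le (hf : IsFinite γ) (hs : ∀ τ, surf (γ τ) ≤ 0) {C : ℝ}
    (hC : ∀ τ, slope (γ τ) ≤ C) : Tendsto γ atBot (𝓝 PM) ∨ Tendsto γ atBot (𝓝 PMbar) := by
  -- Where `slopeRate` vanishes, so do `X₃`, `Y₁` and `surf`, and hence `X₂ ^ 2 = 1 / 2`.
  have hrate := h.tendsto_slopeRate_atBot_of_slope_le hf hs hC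
  have hX₃ : Tendsto (fun t => (γ t).2.1) atBot (𝓝 0) :=
    tendsto_zero_of_sq <| squeeze_zero (fun t => sq_nonneg _)
      (fun t => by rw [slopeRate]; linarith [hs t, sq_nonneg (γ t).2.2]) hrate
  have hY₁ : Tendsto (fun t => (γ t).2.2) atBot (𝓝 0) :=
    tendsto_zero_of_sq <| squeeze_zero (fun t => sq_nonneg _)
      (fun t => by rw [slopeRate]; linarith [hs t, sq_nonneg (γ t).2.1]) hrate
  have hX₂X₃ : Tendsto (fun t => (γ t).1 * (γ t).2.1) atBot (𝓝 0) := by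
    refine squeeze_zero_norm (fun t => ?_) (tendsto_zero_iff_norm_tendsto_zero.1 hX₃)
    rw [norm_mul]
    refine mul_le_of_le_one_left (norm_nonneg _) ((sq_le_one_iff_abs_le_one _).1 ?_)
    have hlt := hf t
    rw [normSq] at hlt
    linarith [sq_nonneg (γ t).2.1, sq_nonneg (γ t).2.2]
  have hX₂_sq : Tendsto (fun t => (γ t).1 ^ 2) atBot (𝓝 (1 / 2)) := by
    have hlim := ((hY₁.pow 2).sub (hrate.add (hX₂X₃.const_mul 2)) |>.add_const 1).div_const 2
    refine (hlim.congr fun t => ?_).trans_eq (by norm_num)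
    rw [slopeRate, surf]
    ring
  have hsqrt : Tendsto (fun t => √(1 - normSq (γ t))) atBot (𝓝 √(1 / 2)) :=
    (((hX₂_sq.add (hX₃.pow 2)).add (hY₁.pow 2)).const_sub 1).sqrt.trans_eq (by norm_num)
  obtain ⟨ℓ, hℓ⟩ := h.exists_tendsto_slope_atBot_of_slope_le hf hs hC
  have hX₂ : Tendsto (fun t => (γ t).1) atBot (𝓝 (ℓ * √(1 / 2))) := by
    refine ((hℓ.mul hsqrt).sub hX₃).congr (fun t => ?_) |>.trans_eq (by rw [sub_zero])
    rw [slope, div_mul_cancel₀ _ (Real.sqrt_pos.2 (sub_pos.2 (hf t))).ne', add_sub_cancel_right]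
  have hsq := (tendsto_nhds_unique (hX₂.pow 2) hX₂_sq).trans inv_sqrt_two_sq.symm
  rcases sq_eq_sq_iff_eq_or_eq_neg.1 hsq with hval | hval
  · exact Or.inl ((hval ▸ hX₂).prodMk_nhds (hX₃.prodMk_nhds hY₁))
  · exact Or.inr ((hval ▸ hX₂).prodMk_nhds (hX₃.prodMk_nhds hY₁))

theorem field_eq_zero_of_tendsto_atBot {p : Pt} (hp : Tendsto γ atBot (𝓝 p)) : field lam p = 0 :=
  eq_zero_of_tendsto_of_tendsto_deriv_atBot (Eventually.of_forall h) hp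
    (((continuous_field lam).tendsto p).comp hp)

theorem field_eq_zero_of_tendsto_atTop {p : Pt} (hp : Tendsto γ atTop (𝓝 p)) : field lam p = 0 :=
  eq_zero_of_tendsto_of_tendsto_deriv_atTop (Eventually.of_forall h) hp
    (((continuous_field lam).tendsto p).comp hp)

end IsFlowLine

/-! ### Orbits coming from infinity -/

/-- The direction `(X₃, Y₁) / (X₂ + X₃)`, encoded as a complex number. -/
def direction (p : Pt) : ℂ := ⟨p.2.1 / (p.1 + p.2.1), p.2.2 / (p.1 + p.2.1)⟩

/-- The quantity `(x₂ + x₃)⁻²`, which measures the distance from the boundary at infinity. -/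
def depth (p : Pt) : ℝ := (1 - normSq p) / (p.1 + p.2.1) ^ 2

/-- The potential `V r²` in units of `(x₂ + x₃)²`. -/
def potentialRatio (p : Pt) : ℝ := -surf p / (p.1 + p.2.1) ^ 2

/-- The point at infinity in the direction `z`, a right inverse of `direction`. -/
def atInfinity (z : ℂ) : Pt :=
  ((1 - z.re) / √((1 - z.re) ^ 2 + z.re ^ 2 + z.im ^ 2),
    z.re / √((1 - z.re) ^ 2 + z.re ^ 2 + z.im ^ 2),
    z.im / √((1 - z.re) ^ 2 + z.re ^ 2 + z.im ^ 2))

/-- The direction of `P_lam`. -/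
def Plam.direction (lam : ℝ) : ℂ := ⟨1 / 2, lam / √2 / 2⟩

theorem depth_eq_inv_slope_sq {p : Pt} (hp : normSq p ≤ 1) : depth p = (slope p ^ 2)⁻¹ := by
  rw [depth, slope, div_pow, inv_div, Real.sq_sqrt (sub_nonneg.2 hp)]

theorem add_pos_of_slope_pos {p : Pt} (hp : 0 < slope p) : 0 < p.1 + p.2.1 :=
  lt_of_not_ge fun hneg =>
    hp.not_ge (div_nonpos_of_nonpos_of_nonneg hneg (Real.sqrt_nonneg _))

theorem one_sub_re_sq_add_pos (z : ℂ) : 0 < (1 - z.re) ^ 2 + z.re ^ 2 + z.im ^ 2 := by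
  nlinarith [sq_nonneg (2 * z.re - 1), sq_nonneg z.im]

theorem normSq_atInfinity (z : ℂ) : normSq (atInfinity z) = 1 := by
  have hpos := one_sub_re_sq_add_pos z
  simp only [normSq, atInfinity, div_pow, Real.sq_sqrt hpos.le]
  field_simp

theorem add_atInfinity_pos (z : ℂ) : 0 < (atInfinity z).1 + (atInfinity z).2.1 := by
  rw [atInfinity, ← add_div, sub_add_cancel]
  exact one_div_pos.2 (Real.sqrt_pos.2 (one_sub_re_sq_add_pos z))

theorem surf_Plam (lam : ℝ) : surf (Plam lam) = (6 - lam ^ 2) / (lam ^ 2 + 4) := by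
  have hne : lam ^ 2 + 4 ≠ 0 := by positivity
  simp only [surf, Plam, div_pow, Real.sq_sqrt (by positivity : 0 ≤ lam ^ 2 + 4),
    Real.sq_sqrt zero_le_two, ← sq, mul_assoc]
  field_simp
  ring

theorem surf_Plam_neg_iff (lam : ℝ) : surf (Plam lam) < 0 ↔ 6 < lam ^ 2 := by
  rw [surf_Plam, div_lt_iff₀ (by positivity), zero_mul, sub_neg]

theorem surf_eq_zero_or_eq_Plam_of_field_eq_zero {lam : ℝ} {p : Pt} (h : field lam p = 0)
    (hn : normSq p = 1) (hpos : 0 < p.1 + p.2.1) : surf p = 0 ∨ p = Plam lam := by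
  have hX₂ : 0 = p.1 * p.2.1 - p.2.2 ^ 2 - growth lam p * p.1 := by rw [← field_fst, h]; rfl
  have hX₃ : 0 = -((p.1 + p.2.1) * p.2.1) + surf p - growth lam p * p.2.1 := by
    rw [← field_snd_fst, h]; rfl
  have hY₁ : 0 = -((p.1 + p.2.1) * p.2.2) + lam / √2 * surf p - growth lam p * p.2.2 := by
    rw [← field_snd_snd, h]; rfl
  have hgrowth : growth lam p * (p.1 + p.2.1) = 2 * surf p - (p.1 + p.2.1) ^ 2 := by
    simp only [surf, normSq] at hX₃ hn ⊢
    linarith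
  have hX₃' : surf p * (p.1 - p.2.1) = 0 := by
    linear_combination (-(p.1 + p.2.1)) * hX₃ + p.2.1 * hgrowth
  have hY₁' : surf p * (lam / √2 * (p.1 + p.2.1) - 2 * p.2.2) = 0 := by
    linear_combination (-(p.1 + p.2.1)) * hY₁ + p.2.2 * hgrowth
  refine or_iff_not_imp_left.2 fun hsurf => ?_
  have hfst : p.1 = p.2.1 := sub_eq_zero.1 ((mul_eq_zero.1 hX₃').resolve_left hsurf)
  have hthd : p.2.2 = lam / √2 * p.2.1 := by
    have hzero := (mul_eq_zero.1 hY₁').resolve_left hsurf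
    rw [hfst] at hzero
    linarith
  have hsq : p.2.1 ^ 2 * (lam ^ 2 + 4) = 2 := by
    simp only [normSq, hfst, hthd, mul_pow, div_pow, Real.sq_sqrt zero_le_two] at hn
    linarith
  have hsnd : p.2.1 = √2 / √(lam ^ 2 + 4) := by
    rw [eq_div_iff (by positivity), ← hsq, Real.sqrt_mul (sq_nonneg _), Real.sqrt_sq (by linarith)]
  have hthd' : p.2.2 = lam / √(lam ^ 2 + 4) := by
    rw [hthd, hsnd, div_mul_div_cancel₀ (by positivity)]
  exact Prod.ext (hfst.trans hsnd) (Prod.ext hsnd hthd')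

theorem tendsto_atInfinity {α : Type*} {l : Filter α} {γ : α → Pt} {z : ℂ}
    (hpos : ∀ᶠ t in l, 0 < (γ t).1 + (γ t).2.1) (hdepth : Tendsto (fun t => depth (γ t)) l (𝓝 0))
    (hz : Tendsto (fun t => direction (γ t)) l (𝓝 z)) : Tendsto γ l (𝓝 (atInfinity z)) := by
  have hre : Tendsto (fun t => (direction (γ t)).re) l (𝓝 z.re) :=
    (Complex.continuous_re.tendsto z).comp hz
  have him : Tendsto (fun t => (direction (γ t)).im) l (𝓝 z.im) :=
    (Complex.continuous_im.tendsto z).comp hz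
  have hrad : Tendsto (fun t => (γ t).1 + (γ t).2.1) l
      (𝓝 (√((1 - z.re) ^ 2 + z.re ^ 2 + z.im ^ 2))⁻¹) := by
    have hlim := (hdepth.add (((hre.const_sub 1).pow 2).add (hre.pow 2) |>.add (him.pow 2))).sqrt
    rw [zero_add] at hlim
    refine (hlim.inv₀ (Real.sqrt_pos.2 (one_sub_re_sq_add_pos z)).ne').congr' ?_
    filter_upwards [hpos] with t ht
    rw [inv_eq_iff_eq_inv, Real.sqrt_eq_iff_mul_self_eq_of_pos (inv_pos.2 ht)]
    simp only [direction, depth]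
    field_simp
    rw [normSq]
    ring
  refine Tendsto.prodMk_nhds ?_ (Tendsto.prodMk_nhds ?_ ?_)
  · refine ((hre.const_sub 1).mul hrad).congr' ?_
    filter_upwards [hpos] with t ht
    rw [direction, one_sub_mul, div_mul_cancel₀ _ ht.ne', add_sub_cancel_right]
  · refine (hre.mul hrad).congr' ?_
    filter_upwards [hpos] with t ht using div_mul_cancel₀ _ ht.ne'
  · refine (him.mul hrad).congr' ?_
    filter_upwards [hpos] with t ht using div_mul_cancel₀ _ ht.ne'

namespace IsFlowLine

variable {lam : ℝ} {γ : ℝ → Pt} {τ : ℝ} (h : IsFlowLine lam γ)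

include h

theorem hasDerivAt_depth (hτ : (γ τ).1 + (γ τ).2.1 ≠ 0) :
    HasDerivAt (fun t => depth (γ t))
      (2 * ((γ τ).1 + (γ τ).2.1) * depth (γ τ)
        * (2 * potentialRatio (γ τ) + 1 - depth (γ τ))) τ := by
  refine ((h.hasDerivAt_one_sub_normSq τ).div ((h.hasDerivAt_X₂_add_X₃ τ).pow 2)
    (pow_ne_zero 2 hτ)).congr_deriv ?_
  simp only [slopeRate, depth, potentialRatio, Pi.pow_apply]
  push_cast
  field_simp
  simp only [surf, normSq]
  ring

theorem hasDerivAt_direction (hτ : (γ τ).1 + (γ τ).2.1 ≠ 0) :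
    HasDerivAt (fun t => direction (γ t))
      ((((γ τ).1 + (γ τ).2.1) * (2 * potentialRatio (γ τ) - depth (γ τ)))
          • (direction (γ τ) - Plam.direction lam)
        - (((γ τ).1 + (γ τ).2.1) * depth (γ τ)) • Plam.direction lam) τ := by
  have hS := h.hasDerivAt_X₂_add_X₃ τ
  refine (Complex.equivRealProdCLM.symm.hasFDerivAt.comp_hasDerivAt τ
    (((h.hasDerivAt_X₃ τ).div hS hτ).prodMk ((h.hasDerivAt_Y₁ τ).div hS hτ))).congr_deriv ?_
  generalize hμ : lam / √2 = μ
  rw [ContinuousLinearEquiv.coe_coe, Complex.equivRealProdCLM_symm_apply]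
  apply Complex.ext <;>
    simp only [Complex.add_re, Complex.add_im, Complex.sub_re, Complex.sub_im, Complex.smul_re,
      Complex.smul_im, Complex.ofReal_re, Complex.ofReal_im, Complex.re_ofReal_mul,
      Complex.im_ofReal_mul, Complex.I_re, Complex.I_im, smul_eq_mul, slopeRate, depth,
      potentialRatio, direction, Plam.direction, hμ] <;>
    field_simp <;>
    simp only [surf, normSq] <;>
    ring

theorem exists_tendsto_direction_atBot (hf : IsFinite γ) (hs : ∀ τ, surf (γ τ) ≤ 0) {T : ℝ}
    (hT : ∀ t ≤ T, 2 ≤ slope (γ t)) : ∃ z, Tendsto (fun t => direction (γ t)) atBot (𝓝 z) := by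
  have hsum (t : ℝ) (ht : t ≤ T) : 0 < (γ t).1 + (γ t).2.1 :=
    add_pos_of_slope_pos (zero_lt_two.trans_le (hT t ht))
  have hdepth (t : ℝ) : 0 ≤ depth (γ t) := div_nonneg (sub_nonneg.2 (hf t).le) (sq_nonneg _)
  have hratio (t : ℝ) : 0 ≤ potentialRatio (γ t) :=
    div_nonneg (neg_nonneg.2 (hs t)) (sq_nonneg _)
  have hdepth_le (t : ℝ) (ht : t ≤ T) : depth (γ t) ≤ 1 / 2 := by
    rw [depth_eq_inv_slope_sq (hf t).le, inv_le_comm₀ (by nlinarith [hT t ht]) one_half_pos]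
    nlinarith [hT t ht]
  obtain ⟨z, hz⟩ := exists_tendsto_atBot_of_hasDerivAt_smul_sub_smul
    (w := fun t => direction (γ t) - Plam.direction lam)
    (fun t ht => (h.hasDerivAt_direction (hsum t ht).ne').sub_const _)
    (fun t ht => h.hasDerivAt_depth (hsum t ht).ne') (fun t _ => hdepth t)
    (fun t ht => mul_nonneg (hsum t ht).le (hdepth t))
    (fun t ht => by
      have hle : 1 ≤ 2 * (2 * potentialRatio (γ t) + 1 - depth (γ t)) := by
        linarith [hratio t, hdepth_le t ht]
      nlinarith [mul_le_mul_of_nonneg_left hle (mul_nonneg (hsum t ht).le (hdepth t))])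
    (fun t ht => by nlinarith [mul_nonneg (hsum t ht).le (hratio t)])
  exact ⟨z + Plam.direction lam,
    by simpa only [sub_add_cancel] using hz.add_const (Plam.direction lam)⟩

theorem exists_tendsto_of_tendsto_slope_atTop (hf : IsFinite γ) (hs : ∀ τ, surf (γ τ) ≤ 0)
    (hslope : Tendsto (fun t => slope (γ t)) atBot atTop) :
    ∃ p, Tendsto γ atBot (𝓝 p) ∧ (p ∈ critCurve ∨ (6 < lam ^ 2 ∧ p = Plam lam)) := by
  obtain ⟨T, hT⟩ := eventually_atBot.1 (hslope.eventually (eventually_ge_atTop 2))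
  obtain ⟨z, hz⟩ := h.exists_tendsto_direction_atBot hf hs hT
  have hdepth : Tendsto (fun t => depth (γ t)) atBot (𝓝 0) :=
    ((tendsto_pow_atTop two_ne_zero).comp hslope).inv_tendsto_atTop.congr fun t =>
      (depth_eq_inv_slope_sq (hf t).le).symm
  have hlim := tendsto_atInfinity (eventually_atBot.2 ⟨T, fun t ht =>
    add_pos_of_slope_pos (zero_lt_two.trans_le (hT t ht))⟩) hdepth hz
  have hsurf : surf (atInfinity z) ≤ 0 :=
    le_of_tendsto' ((continuous_surf.tendsto _).comp hlim) hs
  have hcrit := surf_eq_zero_or_eq_Plam_of_field_eq_zero (h.field_eq_zero_of_tendsto_atBot hlim)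
    (normSq_atInfinity z) (add_atInfinity_pos z)
  refine ⟨_, hlim, ?_⟩
  rw [mem_critCurve_iff]
  rcases hsurf.eq_or_lt with hzero | hneg
  · exact Or.inl ⟨hzero, normSq_atInfinity z, add_atInfinity_pos z⟩
  · have hPlam := hcrit.resolve_left hneg.ne
    exact Or.inr ⟨(surf_Plam_neg_iff lam).1 (hPlam ▸ hneg), hPlam⟩

theorem exists_tendsto_atBot (hf : IsFinite γ) (hs : ∀ τ, surf (γ τ) ≤ 0) :
    Tendsto γ atBot (𝓝 PM) ∨ Tendsto γ atBot (𝓝 PMbar) ∨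
      ∃ p, Tendsto γ atBot (𝓝 p) ∧ (p ∈ critCurve ∨ (6 < lam ^ 2 ∧ p = Plam lam)) := by
  rcases tendsto_atBot_of_antitone (h.antitone_slope hf hs) with hslope | ⟨ℓ, hℓ⟩
  · exact Or.inr (Or.inr (h.exists_tendsto_of_tendsto_slope_atTop hf hs hslope))
  · exact or_assoc.1 (Or.inl (h.tendsto_PM_or_PMbar_of_slope_le hf hs fun τ =>
      (h.antitone_slope hf hs).ge_of_tendsto hℓ τ))

end IsFlowLine

/-! ### The distinguished points -/

theorem growth_PM (lam : ℝ) : growth lam PM = 0 := by simp [growth, PM]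

theorem surf_PM : surf PM = 0 := by
  simp only [surf, PM]
  linarith [inv_sqrt_two_sq]

theorem normSq_PM : normSq PM = 1 / 2 := by
  simp only [normSq, PM]
  linarith [inv_sqrt_two_sq]

theorem growth_PH (lam : ℝ) : growth lam PH = -1 := by simp [growth, PH, surf]

theorem neg_PM : -PM = PMbar := by simp [PM, PMbar]

theorem neg_PMbar : -PMbar = PM := by rw [← neg_PM, neg_neg]

theorem neg_PH : -PH = PHbar := by simp [PH, PHbar]

theorem neg_PHbar : -PHbar = PH := by rw [← neg_PH, neg_neg]

theorem neg_Plam (lam : ℝ) : -Plam lam = PlamBar lam := by simp [Plam, PlamBar]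

theorem neg_mem_critCurve_iff (p : Pt) : -p ∈ critCurve ↔ p ∈ critCurveBar := by
  simp only [critCurve, critCurveBar, Set.mem_ofPred_eq, neg_mem_surfM_iff, normSq_neg]

theorem growth_of_surf_eq_zero (lam : ℝ) {p : Pt} (h : surf p = 0) :
    growth lam p = -(p.1 + p.2.1) + (2 * p.1 + p.2.1) * (1 - normSq p) := by
  have hdiff : growth lam p - (-(p.1 + p.2.1) + (2 * p.1 + p.2.1) * (1 - normSq p)) =
      (lam / √2 * p.2.2 + p.1 + p.2.1) * surf p := by
    simp only [growth, surf, normSq]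
    ring
  rwa [h, mul_zero, sub_eq_zero] at hdiff

theorem fst_nonneg_of_mem_surfM {p : Pt} (h : p ∈ surfM) : 0 ≤ p.1 := by
  obtain ⟨hsurf, hn, hpos⟩ := (mem_surfM_iff p).1 h
  by_contra! hneg
  simp only [surf] at hsurf
  simp only [normSq] at hn
  nlinarith [sq_nonneg p.2.2, mul_pos_of_neg_of_neg hneg hneg]

theorem eq_PH_of_mem_critCurve {p : Pt} (h : p ∈ critCurve) (hp : p.1 = 0) : p = PH := by
  obtain ⟨hsurf, hn, hpos⟩ := (mem_critCurve_iff p).1 h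
  simp only [surf, normSq, hp] at hsurf hn hpos
  have hX₃ : p.2.1 = 1 := by nlinarith
  have hY₁ : p.2.2 = 0 := by
    rw [hX₃] at hn
    exact pow_eq_zero_iff two_ne_zero |>.1 (by linarith)
  exact Prod.ext hp (Prod.ext hX₃ hY₁)

theorem tendsto_neg_comp_neg_atTop {E : Type*} [AddGroup E] [TopologicalSpace E] [ContinuousNeg E]
    {γ : ℝ → E} {p : E} (h : Tendsto γ atBot (𝓝 p)) : Tendsto (fun τ => -γ (-τ)) atTop (𝓝 (-p)) :=
  (h.comp tendsto_neg_atTop_atBot).neg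

theorem tendsto_neg_comp_neg_atBot {E : Type*} [AddGroup E] [TopologicalSpace E] [ContinuousNeg E]
    {γ : ℝ → E} {p : E} (h : Tendsto γ atTop (𝓝 p)) : Tendsto (fun τ => -γ (-τ)) atBot (𝓝 (-p)) :=
  (h.comp tendsto_neg_atBot_atTop).neg

theorem IsFlowLine.not_tendsto_PM_atTop {lam : ℝ} {γ : ℝ → Pt} (h : IsFlowLine lam γ)
    (hs : ∀ τ, surf (γ τ) < 0) : ¬ Tendsto γ atTop (𝓝 PM) := fun hlim => by
  -- Near `PM` the rate of `surf` is positive, so a negative `surf` moves away from `surf PM = 0`.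
  have hcont : Continuous fun p : Pt => 2 * (p.1 - lam / √2 * p.2.2 - growth lam p) := by
    have := continuous_growth lam
    fun_prop
  have hpos : 0 < 2 * (PM.1 - lam / √2 * PM.2.2 - growth lam PM) := by
    rw [growth_PM]
    simp [PM]
  obtain ⟨T, hT⟩ := eventually_atTop.1
    (((hcont.tendsto PM).comp hlim).eventually_const_lt hpos)
  have hanti : AntitoneOn (fun t => surf (γ t)) (Set.Ici T) :=
    antitoneOn_Ici_of_hasDerivAt_nonpos (fun t _ => h.hasDerivAt_surf t)
      fun t ht => mul_nonpos_of_nonneg_of_nonpos (hT t ht).le (hs t).le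
  have hsurf : surf PM ≤ surf (γ T) := le_of_tendsto ((continuous_surf.tendsto _).comp hlim)
    ((eventually_ge_atTop T).mono fun t ht => hanti Set.self_mem_Ici ht ht)
  exact (hs T).not_ge (surf_PM ▸ hsurf)

theorem IsFlowLine.not_tendsto_PMbar_atBot {lam : ℝ} {γ : ℝ → Pt} (h : IsFlowLine lam γ)
    (hs : ∀ τ, surf (γ τ) < 0) : ¬ Tendsto γ atBot (𝓝 PMbar) := fun hlim =>
  h.neg.not_tendsto_PM_atTop (fun τ => surf_neg (γ (-τ)) ▸ hs (-τ))
    (neg_PMbar ▸ tendsto_neg_comp_neg_atTop hlim)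

/-! ### Solutions and their phase curves -/

theorem contDiff_succ_of_hasDerivAt {E : Type*} [NormedAddCommGroup E] [NormedSpace ℝ E]
    {f f' : ℝ → E} (n : ℕ) (hf : ∀ t, HasDerivAt f (f' t) t) (hf' : ContDiff ℝ n f') :
    ContDiff ℝ (n + 1) f := by
  rw [contDiff_succ_iff_deriv, show deriv f = f' from funext fun t => (hf t).deriv]
  exact ⟨fun t => (hf t).differentiableAt, fun h => by simp at h, hf'⟩

theorem contDiff_one_of_hasDerivAt_mul_self {f g : ℝ → ℝ} (hg : Continuous g)
    (hf : ∀ t, HasDerivAt f (g t * f t) t) : ContDiff ℝ 1 f := by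
  have hcont : Continuous f := continuous_iff_continuousAt.2 fun t => (hf t).continuousAt
  simpa using contDiff_succ_of_hasDerivAt 0 hf (contDiff_zero.2 (hg.mul hcont))

theorem contDiff_two_of_hasDerivAt_mul_self {f g : ℝ → ℝ} (hg : ContDiff ℝ 1 g)
    (hf : ∀ t, HasDerivAt f (g t * f t) t) : ContDiff ℝ 2 f := by
  simpa only [Nat.cast_one, one_add_one_eq_two] using
    contDiff_succ_of_hasDerivAt 1 hf (hg.mul (contDiff_one_of_hasDerivAt_mul_self hg.continuous hf))

theorem IsFlowLine.contDiff {lam : ℝ} {γ : ℝ → Pt} (h : IsFlowLine lam γ) : ContDiff ℝ 1 γ := by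
  simpa using contDiff_succ_of_hasDerivAt 0 h
    (contDiff_zero.2 ((continuous_field lam).comp h.continuous))

theorem deriv_expPotential (V0 lam ψ : ℝ) :
    deriv (expPotential V0 lam) ψ = -lam * expPotential V0 lam ψ := by
  have hderiv : HasDerivAt (expPotential V0 lam) (V0 * (Real.exp (-lam * ψ) * (-lam * 1))) ψ :=
    (((hasDerivAt_id ψ).const_mul (-lam)).exp).const_mul V0
  rw [hderiv.deriv, expPotential]
  ring

namespace Config

variable {S : Config}

theorem hat_eq_of_hasDerivAt {f : ℝ → ℝ} {f' τ : ℝ} (h : HasDerivAt f f' τ) :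
    S.hat f τ = f' / S.density τ := by rw [hat, h.deriv]

theorem hasDerivAt_hat {f : ℝ → ℝ} {τ : ℝ} (hd : S.density τ ≠ 0) (hf : DifferentiableAt ℝ f τ) :
    HasDerivAt f (S.density τ * S.hat f τ) τ := by
  rw [hat, mul_div_cancel₀ _ hd]; exact hf.hasDerivAt

theorem sqrt_gaussK {τ : ℝ} (hr : 0 < S.radius τ) : √(S.gaussK τ) = 1 / S.radius τ := by
  rw [gaussK, Real.sqrt_div zero_le_one, Real.sqrt_sq hr.le, Real.sqrt_one]

theorem x2_eq_radius_mul_sheetExp {τ : ℝ} (hr : 0 < S.radius τ) :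
    S.x2 τ = S.radius τ * S.sheetExp τ / 2 := by
  rw [x2, sqrt_gaussK hr]; field_simp

theorem x2_eq_hat_radius {τ : ℝ} (hr : 0 < S.radius τ) : S.x2 τ = S.hat S.radius τ := by
  rw [x2_eq_radius_mul_sheetExp hr, sheetExp]; field_simp

theorem x3_eq_radius_mul_accel {τ : ℝ} (hr : 0 < S.radius τ) :
    S.x3 τ = S.radius τ * S.accel τ := by
  rw [x3, sqrt_gaussK hr]; field_simp

theorem y1_eq_radius_mul_scalarHat {τ : ℝ} (hr : 0 < S.radius τ) :
    S.y1 τ = S.radius τ * S.scalarHat τ / √2 := by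
  rw [y1, Real.sqrt_mul zero_le_two, sqrt_gaussK hr]; field_simp

namespace IsSolution

variable {V : ℝ → ℝ} (h : S.IsSolution V)

include h

theorem differentiableAt_hat {f : ℝ → ℝ} (hf : ContDiff ℝ 2 f) (τ : ℝ) :
    DifferentiableAt ℝ (S.hat f) τ := by
  have hderiv : ContDiff ℝ 1 (deriv f) :=
    (contDiff_succ_iff_deriv.1 (show ContDiff ℝ (1 + 1) f by rwa [one_add_one_eq_two])).2.2
  exact (hderiv.differentiable one_ne_zero τ).div (h.density_smooth.differentiable one_ne_zero τ)
    (h.density_pos τ).ne'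

theorem hasDerivAt_mul_density {f : ℝ → ℝ} (hf : Differentiable ℝ f) (τ : ℝ) :
    HasDerivAt f (S.density τ * S.hat f τ) τ :=
  hasDerivAt_hat (h.density_pos τ).ne' (hf τ)

theorem hasDerivAt_radius (τ : ℝ) :
    HasDerivAt S.radius (S.density τ / S.radius τ * S.x2 τ * S.radius τ) τ := by
  have hr := h.radius_pos τ
  refine (h.hasDerivAt_mul_density (h.radius_smooth.differentiable two_ne_zero) τ).congr_deriv ?_
  rw [x2_eq_hat_radius hr]; field_simp

theorem hasDerivAt_lapse (τ : ℝ) :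
    HasDerivAt S.lapse (S.density τ / S.radius τ * S.x3 τ * S.lapse τ) τ := by
  have hr := h.radius_pos τ
  have hN := h.lapse_pos τ
  refine (h.hasDerivAt_mul_density (h.lapse_smooth.differentiable two_ne_zero) τ).congr_deriv ?_
  rw [x3_eq_radius_mul_accel hr, accel]; field_simp

theorem hasDerivAt_scalar (τ : ℝ) :
    HasDerivAt S.scalar (S.density τ / S.radius τ * (√2 * S.y1 τ)) τ := by
  have hr := h.radius_pos τ
  refine (h.hasDerivAt_mul_density (h.scalar_smooth.differentiable two_ne_zero) τ).congr_deriv ?_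
  rw [y1_eq_radius_mul_scalarHat hr, scalarHat]; field_simp

theorem radius_sq_mul_potential (τ : ℝ) : S.radius τ ^ 2 * V (S.scalar τ)
    = 1 + S.y1 τ ^ 2 - S.x2 τ ^ 2 - 2 * S.x2 τ * S.x3 τ := by
  have hr := h.radius_pos τ
  have hgauss := h.gauss_eq τ
  rw [x2_eq_radius_mul_sheetExp hr, x3_eq_radius_mul_accel hr, y1_eq_radius_mul_scalarHat hr,
    div_pow, Real.sq_sqrt zero_le_two]
  rw [gaussK] at hgauss
  field_simp at hgauss ⊢
  linarith

theorem hasDerivAt_x2 (τ : ℝ) : HasDerivAt S.x2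
    (S.density τ / S.radius τ * (S.x2 τ * S.x3 τ - S.y1 τ ^ 2)) τ := by
  have hr := h.radius_pos τ
  have hrad := h.radius_smooth.differentiable two_ne_zero
  have hsheet : Differentiable ℝ S.sheetExp := fun t =>
    ((h.differentiableAt_hat h.radius_smooth t).const_mul 2).div (hrad t) (h.radius_pos t).ne'
  rw [show S.x2 = fun t => S.radius t * S.sheetExp t / 2 from
    funext fun t => x2_eq_radius_mul_sheetExp (h.radius_pos t)]
  refine (((h.hasDerivAt_mul_density hrad τ).mul
    (h.hasDerivAt_mul_density hsheet τ)).div_const 2).congr_deriv ?_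
  rw [h.sheetExp_eq, weyl, x3_eq_radius_mul_accel hr, y1_eq_radius_mul_scalarHat hr, div_pow,
    mul_pow, Real.sq_sqrt zero_le_two]
  simp only [sheetExp]
  field_simp
  ring

theorem hasDerivAt_x3 (τ : ℝ) : HasDerivAt S.x3
    (S.density τ / S.radius τ * (-((S.x2 τ + S.x3 τ) * S.x3 τ)
      - S.radius τ ^ 2 * V (S.scalar τ))) τ := by
  have hr := h.radius_pos τ
  have hlapse := h.lapse_smooth.differentiable two_ne_zero
  have haccel : Differentiable ℝ S.accel := fun t =>
    (h.differentiableAt_hat h.lapse_smooth t).div (hlapse t) (h.lapse_pos t).ne'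
  rw [show S.x3 = fun t => S.radius t * S.accel t from
    funext fun t => x3_eq_radius_mul_accel (h.radius_pos t)]
  refine ((h.hasDerivAt_mul_density (h.radius_smooth.differentiable two_ne_zero) τ).mul
    (h.hasDerivAt_mul_density haccel τ)).congr_deriv ?_
  rw [h.accel_eq, x2_eq_hat_radius hr, sheetExp]
  field_simp
  ring

theorem hasDerivAt_y1 (τ : ℝ) : HasDerivAt S.y1
    (S.density τ / S.radius τ * (-((S.x2 τ + S.x3 τ) * S.y1 τ)
      + S.radius τ ^ 2 * deriv V (S.scalar τ) / √2)) τ := by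
  have hr := h.radius_pos τ
  have hscalar : Differentiable ℝ S.scalarHat := h.differentiableAt_hat h.scalar_smooth
  rw [show S.y1 = fun t => S.radius t * S.scalarHat t / √2 from
    funext fun t => y1_eq_radius_mul_scalarHat (h.radius_pos t)]
  refine (((h.hasDerivAt_mul_density (h.radius_smooth.differentiable two_ne_zero) τ).mul
    (h.hasDerivAt_mul_density hscalar τ)).div_const √2).congr_deriv ?_
  rw [h.scalar_eq, x2_eq_hat_radius hr, x3_eq_radius_mul_accel hr, sheetExp]
  field_simp
  ring

end IsSolution

/-- The factor by which the compactification divides `(x₂, x₃, y₁)`. -/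
def scale (S : Config) (τ : ℝ) : ℝ := √(1 + S.x2 τ ^ 2 + S.x3 τ ^ 2 + S.y1 τ ^ 2)

theorem scale_sq (S : Config) (τ : ℝ) :
    S.scale τ ^ 2 = 1 + S.x2 τ ^ 2 + S.x3 τ ^ 2 + S.y1 τ ^ 2 := Real.sq_sqrt (by positivity)

theorem scale_pos (S : Config) (τ : ℝ) : 0 < S.scale τ := Real.sqrt_pos.2 (by positivity)

theorem poincare_eq_div_scale (S : Config) (τ : ℝ) :
    S.poincare τ = (S.x2 τ / S.scale τ, S.x3 τ / S.scale τ, S.y1 τ / S.scale τ) := rfl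

theorem one_sub_normSq_poincare (S : Config) (τ : ℝ) :
    1 - normSq (S.poincare τ) = (1 / S.scale τ) ^ 2 := by
  have hscale := (S.scale_pos τ).ne'
  simp only [poincare_eq_div_scale, normSq]
  field_simp
  rw [scale_sq]; ring

/-- The metric and the scalar field are the quadratures of the orbit `γ` of the compactified
system, and `γ` satisfies the constraint for the potential `V₀ exp (-lam ψ)`. -/
structure Traces (S : Config) (V0 lam : ℝ) (γ : ℝ → Pt) : Prop where
  radius_pos : ∀ τ, 0 < S.radius τ
  lapse_pos : ∀ τ, 0 < S.lapse τ
  radius_deriv : ∀ τ, HasDerivAt S.radius ((γ τ).1 * S.radius τ) τ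
  lapse_deriv : ∀ τ, HasDerivAt S.lapse ((γ τ).2.1 * S.lapse τ) τ
  scalar_deriv : ∀ τ, HasDerivAt S.scalar (√2 * (γ τ).2.2) τ
  density_eq : ∀ τ, S.density τ = S.radius τ * √(1 - normSq (γ τ))
  potential : ∀ τ, expPotential V0 lam (S.scalar τ) * S.radius τ ^ 2 * (1 - normSq (γ τ))
    = -surf (γ τ)

namespace Realizes

variable {V0 lam : ℝ} {γ : ℝ → Pt} (h : S.Realizes V0 lam γ)

include h

theorem eq_div_scale (τ : ℝ) :
    γ τ = (S.x2 τ / S.scale τ, S.x3 τ / S.scale τ, S.y1 τ / S.scale τ) := (h.2.2 τ).symm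

theorem x2_eq (τ : ℝ) : S.x2 τ = (γ τ).1 * S.scale τ := by
  rw [h.eq_div_scale, div_mul_cancel₀ _ (S.scale_pos τ).ne']

theorem x3_eq (τ : ℝ) : S.x3 τ = (γ τ).2.1 * S.scale τ := by
  rw [h.eq_div_scale, div_mul_cancel₀ _ (S.scale_pos τ).ne']

theorem y1_eq (τ : ℝ) : S.y1 τ = (γ τ).2.2 * S.scale τ := by
  rw [h.eq_div_scale, div_mul_cancel₀ _ (S.scale_pos τ).ne']

theorem one_sub_normSq_eq (τ : ℝ) : 1 - normSq (γ τ) = (1 / S.scale τ) ^ 2 := by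
  rw [← h.2.2, one_sub_normSq_poincare]

theorem isFinite : IsFinite γ := fun τ => by
  have hpos : 0 < (1 / S.scale τ) ^ 2 := pow_pos (one_div_pos.2 (S.scale_pos τ)) 2
  linarith [h.one_sub_normSq_eq τ]

theorem density_eq (τ : ℝ) : S.density τ = S.radius τ * √(1 - normSq (γ τ)) := by
  rw [h.2.1, h.2.2, sqrt_gaussK (h.1.radius_pos τ), div_div_eq_mul_div, div_one, mul_comm]

theorem density_div_radius (τ : ℝ) : S.density τ / S.radius τ = 1 / S.scale τ := by
  rw [h.density_eq, mul_div_cancel_left₀ _ (h.1.radius_pos τ).ne', h.one_sub_normSq_eq,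
    Real.sqrt_sq (one_div_pos.2 (S.scale_pos τ)).le]

theorem radius_sq_mul_potential (τ : ℝ) :
    S.radius τ ^ 2 * expPotential V0 lam (S.scalar τ) = -surf (γ τ) * S.scale τ ^ 2 := by
  have hscale := S.scale_sq τ
  rw [h.x2_eq, h.x3_eq, h.y1_eq] at hscale
  rw [h.1.radius_sq_mul_potential, h.x2_eq, h.x3_eq, h.y1_eq, surf]
  linear_combination -hscale

theorem hasDerivAt_x2 (τ : ℝ) :
    HasDerivAt S.x2 (((γ τ).1 * (γ τ).2.1 - (γ τ).2.2 ^ 2) * S.scale τ) τ := by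
  have hscale := (S.scale_pos τ).ne'
  refine (h.1.hasDerivAt_x2 τ).congr_deriv ?_
  rw [h.density_div_radius, h.x2_eq, h.x3_eq, h.y1_eq]
  field_simp

theorem hasDerivAt_x3 (τ : ℝ) : HasDerivAt S.x3
    ((-(((γ τ).1 + (γ τ).2.1) * (γ τ).2.1) + surf (γ τ)) * S.scale τ) τ := by
  have hscale := (S.scale_pos τ).ne'
  refine (h.1.hasDerivAt_x3 τ).congr_deriv ?_
  rw [h.density_div_radius, h.radius_sq_mul_potential, h.x2_eq, h.x3_eq]
  field_simp
  ring

theorem hasDerivAt_y1 (τ : ℝ) : HasDerivAt S.y1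
    ((-(((γ τ).1 + (γ τ).2.1) * (γ τ).2.2) + lam / √2 * surf (γ τ)) * S.scale τ) τ := by
  have hscale := (S.scale_pos τ).ne'
  refine (h.1.hasDerivAt_y1 τ).congr_deriv ?_
  rw [deriv_expPotential, mul_left_comm, h.density_div_radius, h.radius_sq_mul_potential, h.x2_eq,
    h.x3_eq, h.y1_eq]
  field_simp

theorem hasDerivAt_scale (τ : ℝ) : HasDerivAt S.scale (growth lam (γ τ) * S.scale τ) τ := by
  have hscale := (S.scale_pos τ).ne'
  have hsq := ((((h.hasDerivAt_x2 τ).fun_pow 2).const_add 1).fun_add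
    ((h.hasDerivAt_x3 τ).fun_pow 2)).fun_add ((h.hasDerivAt_y1 τ).fun_pow 2)
  refine (hsq.sqrt (by positivity)).congr_deriv ?_
  rw [← scale, h.x2_eq, h.x3_eq, h.y1_eq, growth, surf]
  push_cast
  field_simp
  ring

theorem isFlowLine : IsFlowLine lam γ := fun τ => by
  have hscale := (S.scale_pos τ).ne'
  have hderiv {f : ℝ → ℝ} {a X : ℝ} (hf : HasDerivAt f (a * S.scale τ) τ)
      (hX : f τ = X * S.scale τ) :
      HasDerivAt (fun t => f t / S.scale t) (a - growth lam (γ τ) * X) τ :=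
    (hf.fun_div (h.hasDerivAt_scale τ) hscale).congr_deriv (by rw [hX]; field_simp)
  rw [show γ = fun t => (S.x2 t / S.scale t, S.x3 t / S.scale t, S.y1 t / S.scale t) from
    funext h.eq_div_scale]
  refine ((hderiv (h.hasDerivAt_x2 τ) (h.x2_eq τ)).prodMk ((hderiv (h.hasDerivAt_x3 τ)
    (h.x3_eq τ)).prodMk (hderiv (h.hasDerivAt_y1 τ) (h.y1_eq τ)))).congr_deriv ?_
  exact (Prod.ext (field_fst ..) (Prod.ext (field_snd_fst ..) (field_snd_snd ..))).symm.trans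
    (congrArg (field lam) (h.eq_div_scale τ))

theorem traces : S.Traces V0 lam γ where
  radius_pos := h.1.radius_pos
  lapse_pos := h.1.lapse_pos
  radius_deriv τ := (h.1.hasDerivAt_radius τ).congr_deriv <| by
    rw [h.density_div_radius, h.x2_eq, one_div_mul_eq_div,
      mul_div_cancel_right₀ _ (S.scale_pos τ).ne']
  lapse_deriv τ := (h.1.hasDerivAt_lapse τ).congr_deriv <| by
    rw [h.density_div_radius, h.x3_eq, one_div_mul_eq_div,
      mul_div_cancel_right₀ _ (S.scale_pos τ).ne']
  scalar_deriv τ := (h.1.hasDerivAt_scalar τ).congr_deriv <| by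
    rw [h.density_div_radius, h.y1_eq, one_div_mul_eq_div, ← mul_assoc,
      mul_div_cancel_right₀ _ (S.scale_pos τ).ne']
  density_eq := h.density_eq
  potential τ := by
    have hscale := (S.scale_pos τ).ne'
    rw [mul_comm (expPotential _ _ _), h.radius_sq_mul_potential, h.one_sub_normSq_eq]
    field_simp

end Realizes

namespace Traces

variable {V0 lam : ℝ} {γ : ℝ → Pt} (h : S.Traces V0 lam γ)

include h

theorem density_pos (hf : IsFinite γ) (τ : ℝ) : 0 < S.density τ := by
  rw [h.density_eq]
  exact mul_pos (h.radius_pos τ) (Real.sqrt_pos.2 (sub_pos.2 (hf τ)))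

theorem density_sq (hf : IsFinite γ) (τ : ℝ) :
    S.density τ ^ 2 = S.radius τ ^ 2 * (1 - normSq (γ τ)) := by
  rw [h.density_eq, mul_pow, Real.sq_sqrt (sub_nonneg.2 (hf τ).le)]

theorem hasDerivAt_density (hγ : IsFlowLine lam γ) (hf : IsFinite γ) (τ : ℝ) :
    HasDerivAt S.density (((γ τ).1 - growth lam (γ τ)) * S.density τ) τ := by
  rw [show S.density = fun t => S.radius t * √(1 - normSq (γ t)) from funext h.density_eq]
  exact ((h.radius_deriv τ).mul (hγ.hasDerivAt_sqrt_one_sub_normSq (hf τ))).congr_deriv (by ring)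

theorem hat_radius (τ : ℝ) : S.hat S.radius τ = (γ τ).1 / √(1 - normSq (γ τ)) := by
  rw [hat_eq_of_hasDerivAt (h.radius_deriv τ), h.density_eq, mul_comm,
    mul_div_mul_left _ _ (h.radius_pos τ).ne']

theorem sheetExp_eq (τ : ℝ) : S.sheetExp τ = 2 * ((γ τ).1 / S.density τ) := by
  rw [sheetExp, h.hat_radius, h.density_eq, mul_div_assoc, div_div, mul_comm (S.radius τ)]

theorem accel_eq (τ : ℝ) : S.accel τ = (γ τ).2.1 / S.density τ := by
  rw [accel, hat_eq_of_hasDerivAt (h.lapse_deriv τ), div_right_comm,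
    mul_div_cancel_right₀ _ (h.lapse_pos τ).ne']

theorem scalarHat_eq (τ : ℝ) : S.scalarHat τ = √2 * ((γ τ).2.2 / S.density τ) := by
  rw [scalarHat, hat_eq_of_hasDerivAt (h.scalar_deriv τ), mul_div_assoc]

theorem potential_eq (hf : IsFinite γ) (τ : ℝ) :
    expPotential V0 lam (S.scalar τ) = -surf (γ τ) / S.density τ ^ 2 := by
  rw [eq_div_iff (pow_pos (h.density_pos hf τ) 2).ne', ← h.potential τ, h.density_sq hf, mul_assoc]

theorem hat_div_density (hγ : IsFlowLine lam γ) (hf : IsFinite γ) {f : ℝ → ℝ} {f' τ : ℝ}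
    (hderiv : HasDerivAt f f' τ) : S.hat (fun t => f t / S.density t) τ =
      (f' - ((γ τ).1 - growth lam (γ τ)) * f τ) / S.density τ ^ 2 := by
  have hd := (h.density_pos hf τ).ne'
  rw [hat_eq_of_hasDerivAt (hderiv.fun_div (h.hasDerivAt_density hγ hf τ) hd)]
  field_simp

theorem hat_sheetExp (hγ : IsFlowLine lam γ) (hf : IsFinite γ) (τ : ℝ) :
    S.hat S.sheetExp τ = 2 * (((γ τ).1 * (γ τ).2.1 - (γ τ).2.2 ^ 2 - (γ τ).1 ^ 2)
      / S.density τ ^ 2) := by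
  have hfun : S.sheetExp = fun t => 2 * (γ t).1 / S.density t :=
    funext fun t => by rw [h.sheetExp_eq, mul_div_assoc]
  rw [hfun, h.hat_div_density hγ hf ((hγ.hasDerivAt_X₂ τ).const_mul 2)]
  ring

theorem hat_accel (hγ : IsFlowLine lam γ) (hf : IsFinite γ) (τ : ℝ) :
    S.hat S.accel τ = (-((2 * (γ τ).1 + (γ τ).2.1) * (γ τ).2.1) + surf (γ τ))
      / S.density τ ^ 2 := by
  rw [show S.accel = fun t => (γ t).2.1 / S.density t from funext h.accel_eq,
    h.hat_div_density hγ hf (hγ.hasDerivAt_X₃ τ)]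
  ring

theorem hat_scalarHat (hγ : IsFlowLine lam γ) (hf : IsFinite γ) (τ : ℝ) :
    S.hat S.scalarHat τ = √2 * ((-((2 * (γ τ).1 + (γ τ).2.1) * (γ τ).2.2)
      + lam / √2 * surf (γ τ)) / S.density τ ^ 2) := by
  have hfun : S.scalarHat = fun t => √2 * (γ t).2.2 / S.density t :=
    funext fun t => by rw [h.scalarHat_eq, mul_div_assoc]
  rw [hfun, h.hat_div_density hγ hf ((hγ.hasDerivAt_Y₁ τ).const_mul √2)]
  ring

theorem contDiff_radius (hγ : ContDiff ℝ 1 γ) : ContDiff ℝ 2 S.radius :=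
  contDiff_two_of_hasDerivAt_mul_self hγ.fst h.radius_deriv

theorem contDiff_lapse (hγ : ContDiff ℝ 1 γ) : ContDiff ℝ 2 S.lapse :=
  contDiff_two_of_hasDerivAt_mul_self hγ.snd.fst h.lapse_deriv

theorem contDiff_scalar (hγ : ContDiff ℝ 1 γ) : ContDiff ℝ 2 S.scalar := by
  simpa only [Nat.cast_one, one_add_one_eq_two] using
    contDiff_succ_of_hasDerivAt 1 h.scalar_deriv (contDiff_const.mul hγ.snd.snd)

theorem contDiff_density (hγ : IsFlowLine lam γ) (hf : IsFinite γ) : ContDiff ℝ 1 S.density := by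
  have hgrowth := continuous_growth lam
  have hcont := hγ.continuous
  exact contDiff_one_of_hasDerivAt_mul_self (by fun_prop) (h.hasDerivAt_density hγ hf)

theorem isSolution (hγ : IsFlowLine lam γ) (hf : IsFinite γ) :
    S.IsSolution (expPotential V0 lam) where
  radius_smooth := h.contDiff_radius hγ.contDiff
  lapse_smooth := h.contDiff_lapse hγ.contDiff
  scalar_smooth := h.contDiff_scalar hγ.contDiff
  density_smooth := h.contDiff_density hγ hf
  radius_pos := h.radius_pos
  lapse_pos := h.lapse_pos
  density_pos := h.density_pos hf
  sheetExp_eq τ := by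
    rw [h.hat_sheetExp hγ hf, weyl, h.sheetExp_eq, h.accel_eq, h.scalarHat_eq, h.potential_eq hf,
      mul_pow √2, Real.sq_sqrt zero_le_two]
    field_simp; ring
  accel_eq τ := by
    rw [h.hat_accel hγ hf, h.sheetExp_eq, h.accel_eq, h.potential_eq hf]
    field_simp; ring
  scalar_eq τ := by
    rw [h.hat_scalarHat hγ hf, h.sheetExp_eq, h.accel_eq, h.scalarHat_eq, deriv_expPotential,
      h.potential_eq hf]
    field_simp [(h.density_pos hf τ).ne']; ring
  gauss_eq τ := by
    have hr := (h.radius_pos τ).ne'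
    have hd := (h.density_pos hf τ).ne'
    rw [h.sheetExp_eq, h.accel_eq, h.scalarHat_eq, h.potential_eq hf, mul_pow,
      Real.sq_sqrt zero_le_two, gaussK]
    field_simp
    rw [h.density_sq hf]; simp only [surf, normSq]; ring

theorem x2_eq (τ : ℝ) : S.x2 τ = (γ τ).1 / √(1 - normSq (γ τ)) := by
  rw [x2_eq_hat_radius (h.radius_pos τ), h.hat_radius]

theorem x3_eq (τ : ℝ) : S.x3 τ = (γ τ).2.1 / √(1 - normSq (γ τ)) := by
  rw [x3_eq_radius_mul_accel (h.radius_pos τ), h.accel_eq, h.density_eq, ← mul_div_assoc,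
    mul_div_mul_left _ _ (h.radius_pos τ).ne']

theorem y1_eq (τ : ℝ) : S.y1 τ = (γ τ).2.2 / √(1 - normSq (γ τ)) := by
  have hr := (h.radius_pos τ).ne'
  rw [y1_eq_radius_mul_scalarHat (h.radius_pos τ), h.scalarHat_eq, h.density_eq]
  field_simp

theorem scale_eq (hf : IsFinite γ) (τ : ℝ) : S.scale τ = 1 / √(1 - normSq (γ τ)) := by
  have hw : 0 < 1 - normSq (γ τ) := sub_pos.2 (hf τ)
  rw [scale, Real.sqrt_eq_iff_eq_sq (by positivity) (by positivity), h.x2_eq, h.x3_eq, h.y1_eq]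
  simp only [div_pow, Real.sq_sqrt hw.le]
  field_simp
  rw [normSq]
  ring

theorem poincare_eq (hf : IsFinite γ) (τ : ℝ) : S.poincare τ = γ τ := by
  have hw := (Real.sqrt_pos.2 (sub_pos.2 (hf τ))).ne'
  rw [poincare_eq_div_scale, h.scale_eq hf, h.x2_eq, h.x3_eq, h.y1_eq]
  ext <;> field_simp

theorem realizes (hγ : IsFlowLine lam γ) (hf : IsFinite γ) : S.Realizes V0 lam γ := by
  refine ⟨h.isSolution hγ hf, fun τ => ?_, h.poincare_eq hf⟩
  rw [h.poincare_eq hf, h.density_eq, sqrt_gaussK (h.radius_pos τ), div_div_eq_mul_div, div_one,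
    mul_comm]

theorem metricB_eq (hf : IsFinite γ) (τ : ℝ) :
    S.metricB τ = (γ τ).1 ^ 2 / (1 - normSq (γ τ)) := by
  rw [metricB, h.hat_radius, div_pow, Real.sq_sqrt (sub_nonneg.2 (hf τ).le)]

end Traces

theorem hasDerivAt_constraint {lam : ℝ} {γ : ℝ → Pt} (hγ : IsFlowLine lam γ) {R ψ : ℝ → ℝ}
    {V0 τ : ℝ} (hR : HasDerivAt R ((γ τ).1 * R τ) τ) (hψ : HasDerivAt ψ (√2 * (γ τ).2.2) τ) :
    HasDerivAt (fun t => expPotential V0 lam (ψ t) * R t ^ 2 * (1 - normSq (γ t)))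
      (2 * ((γ τ).1 - lam / √2 * (γ τ).2.2 - growth lam (γ τ)) *
        (expPotential V0 lam (ψ τ) * R τ ^ 2 * (1 - normSq (γ τ)))) τ := by
  refine (((((hψ.const_mul (-lam)).exp).const_mul V0).fun_mul (hR.fun_pow 2)).fun_mul
    (hγ.hasDerivAt_one_sub_normSq τ)).congr_deriv ?_
  have hsqrt : lam * √2 = 2 * (lam / √2) := by
    rw [← mul_div_assoc, mul_comm 2 lam, mul_div_assoc, Real.div_sqrt]
  simp only [expPotential]
  push_cast
  linear_combination (-V0 * Real.exp (-lam * ψ τ) * (γ τ).2.2 * R τ ^ 2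
    * (1 - normSq (γ τ))) * hsqrt

theorem exists_constraint {lam V0 : ℝ} {γ : ℝ → Pt} (hγ : IsFlowLine lam γ) (hf : IsFinite γ)
    (hV : (V0 = 0 ∧ ∀ τ, surf (γ τ) = 0) ∨ (0 < V0 ∧ ∀ τ, surf (γ τ) < 0)) {R ψ : ℝ → ℝ}
    (hR : ∀ τ, 0 < R τ) (hRd : ∀ τ, HasDerivAt R ((γ τ).1 * R τ) τ)
    (hψd : ∀ τ, HasDerivAt ψ (√2 * (γ τ).2.2) τ) : ∃ c > 0, ∀ τ,
      expPotential V0 lam (ψ τ) * (c * R τ) ^ 2 * (1 - normSq (γ τ)) = -surf (γ τ) := by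
  rcases hV with ⟨rfl, hs⟩ | ⟨hV0, hs⟩
  · exact ⟨1, one_pos, fun τ => by simp [hs τ, expPotential]⟩
  -- Both sides satisfy the same linear equation along the flow, so they are proportional.
  have hpos (τ : ℝ) : 0 < expPotential V0 lam (ψ τ) * R τ ^ 2 * (1 - normSq (γ τ)) :=
    mul_pos (mul_pos (mul_pos hV0 (Real.exp_pos _)) (pow_pos (hR τ) 2)) (sub_pos.2 (hf τ))
  obtain ⟨k, hk⟩ := exists_eq_const_mul_of_hasDerivAt_mul_self hγ.hasDerivAt_surf
    (fun τ => hasDerivAt_constraint hγ (hRd τ) (hψd τ)) fun τ => (hpos τ).ne'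
  have hkneg : k < 0 := neg_of_mul_neg_left (hk 0 ▸ hs 0) (hpos 0).le
  refine ⟨√(-k), Real.sqrt_pos.2 (neg_pos.2 hkneg), fun τ => ?_⟩
  rw [hk τ, mul_pow, Real.sq_sqrt (neg_pos.2 hkneg).le]
  ring

theorem exists_traces {lam V0 : ℝ} {γ : ℝ → Pt} (hγ : IsFlowLine lam γ) (hf : IsFinite γ)
    (hV : (V0 = 0 ∧ ∀ τ, surf (γ τ) = 0) ∨ (0 < V0 ∧ ∀ τ, surf (γ τ) < 0)) :
    ∃ S : Config, S.Traces V0 lam γ := by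
  have hcont := hγ.continuous
  obtain ⟨R, hR, hRd⟩ := exists_integratingFactor (g := fun τ => (γ τ).1) (by fun_prop)
  obtain ⟨N, hN, hNd⟩ := exists_integratingFactor (g := fun τ => (γ τ).2.1) (by fun_prop)
  have hY : Continuous fun s => √2 * (γ s).2.2 := by fun_prop
  have hψd (τ : ℝ) : HasDerivAt (fun t => ∫ s in (0 : ℝ)..t, √2 * (γ s).2.2) (√2 * (γ τ).2.2) τ :=
    hY.integral_hasStrictDerivAt 0 τ |>.hasDerivAt
  obtain ⟨c, hc, hconstraint⟩ := exists_constraint hγ hf hV hR hRd hψd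
  exact ⟨⟨fun τ => c * R τ, N, fun τ => c * R τ * √(1 - normSq (γ τ)), _⟩,
    fun τ => mul_pos hc (hR τ), hN,
    fun τ => ((hRd τ).const_mul c).congr_deriv (mul_left_comm ..), hNd, hψd, fun _ => rfl,
    hconstraint⟩

/-- The same spacetime with the opposite radial parameter. -/
def rev (S : Config) : Config :=
  ⟨fun τ => S.radius (-τ), fun τ => S.lapse (-τ), fun τ => S.density (-τ), fun τ => S.scalar (-τ)⟩

theorem hat_rev (f : ℝ → ℝ) (τ : ℝ) : S.rev.hat (fun t => f (-t)) τ = -S.hat f (-τ) := by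
  simp only [hat, rev]
  rw [deriv_comp_neg, neg_div]

theorem hat_rev_neg (f : ℝ → ℝ) (τ : ℝ) : S.rev.hat (fun t => -f (-t)) τ = S.hat f (-τ) := by
  simp only [hat, rev]
  rw [deriv.fun_neg, deriv_comp_neg, neg_neg]

theorem radius_rev : S.rev.radius = fun τ => S.radius (-τ) := rfl

theorem lapse_rev : S.rev.lapse = fun τ => S.lapse (-τ) := rfl

theorem scalar_rev : S.rev.scalar = fun τ => S.scalar (-τ) := rfl

theorem gaussK_rev : S.rev.gaussK = fun τ => S.gaussK (-τ) := rfl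

theorem sheetExp_rev : S.rev.sheetExp = fun τ => -S.sheetExp (-τ) := funext fun τ => by
  simp only [sheetExp, radius_rev, hat_rev]
  ring

theorem accel_rev : S.rev.accel = fun τ => -S.accel (-τ) := funext fun τ => by
  simp only [accel, lapse_rev, hat_rev, neg_div]

theorem scalarHat_rev : S.rev.scalarHat = fun τ => -S.scalarHat (-τ) :=
  funext fun τ => hat_rev S.scalar τ

theorem IsSolution.rev {V : ℝ → ℝ} (h : S.IsSolution V) : S.rev.IsSolution V where
  radius_smooth := h.radius_smooth.comp contDiff_neg
  lapse_smooth := h.lapse_smooth.comp contDiff_neg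
  scalar_smooth := h.scalar_smooth.comp contDiff_neg
  density_smooth := h.density_smooth.comp contDiff_neg
  radius_pos τ := h.radius_pos (-τ)
  lapse_pos τ := h.lapse_pos (-τ)
  density_pos τ := h.density_pos (-τ)
  sheetExp_eq τ := by
    simp only [weyl, sheetExp_rev, hat_rev_neg, h.sheetExp_eq (-τ), accel_rev, scalarHat_rev,
      scalar_rev]
    ring
  accel_eq τ := by
    simp only [sheetExp_rev, accel_rev, hat_rev_neg, h.accel_eq (-τ), scalar_rev]
    ring
  scalar_eq τ := by
    simp only [sheetExp_rev, accel_rev, scalarHat_rev, hat_rev_neg, h.scalar_eq (-τ), scalar_rev]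
    ring
  gauss_eq τ := by
    simp only [sheetExp_rev, accel_rev, scalarHat_rev, gaussK_rev, h.gauss_eq (-τ), scalar_rev]
    ring

theorem poincare_rev (τ : ℝ) : S.rev.poincare τ = -S.poincare (-τ) := by
  simp only [poincare, x2, x3, y1, sheetExp_rev, accel_rev, scalarHat_rev, gaussK_rev, neg_div,
    neg_sq, Prod.neg_mk]

theorem Realizes.rev {V0 lam : ℝ} {γ : ℝ → Pt} (h : S.Realizes V0 lam γ) :
    S.rev.Realizes V0 lam fun τ => -γ (-τ) := by
  refine ⟨h.1.rev, fun τ => ?_, fun τ => by rw [poincare_rev, h.2.2]⟩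
  rw [poincare_rev, normSq_neg]
  exact h.2.1 (-τ)

theorem metricB_rev (τ : ℝ) : S.rev.metricB τ = S.metricB (-τ) := by
  simp only [metricB, radius_rev, hat_rev, neg_sq]

theorem kretschmann_rev (τ : ℝ) : S.rev.kretschmann τ = S.kretschmann (-τ) := by
  have hradius : S.rev.hat S.rev.radius = fun t => -S.hat S.radius (-t) := funext (hat_rev S.radius)
  have hlapse : S.rev.hat S.rev.lapse = fun t => -S.hat S.lapse (-t) := funext (hat_rev S.lapse)
  rw [kretschmann, hradius, hlapse]
  simp only [hat_rev_neg, radius_rev, lapse_rev, kretschmann]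
  ring

theorem NakedSingularity.of_rev (h : S.rev.NakedSingularity atBot) : S.NakedSingularity atTop := by
  obtain ⟨hradius, hmetric, hcurv, hlength, htime⟩ := h
  exact ⟨tendsto_atTop_of_tendsto_comp_neg hradius,
    tendsto_atTop_of_tendsto_comp_neg (hmetric.congr metricB_rev),
    tendsto_atTop_of_tendsto_comp_neg (hcurv.congr kretschmann_rev),
    integrableAtFilter_atTop_of_comp_neg hlength, integrableAtFilter_atTop_of_comp_neg htime⟩

theorem IsSchwarzschild.of_rev (h : S.rev.IsSchwarzschild) : S.IsSchwarzschild := by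
  obtain ⟨m, hm, c, hc, hmetric, hrange, ψ₀, hψ⟩ := h
  refine ⟨m, hm, c, hc, fun τ => ?_, ?_, ψ₀, fun τ => ?_⟩
  · simpa only [metricB_rev, radius_rev, lapse_rev, neg_neg] using hmetric (-τ)
  · rw [← hrange]
    exact (neg_surjective.range_comp S.radius).symm
  · simpa only [scalar_rev, neg_neg] using hψ (-τ)

end Config

/-! ### Naked singularities -/

theorem normSq_Plam (lam : ℝ) : normSq (Plam lam) = 1 := by
  simp only [normSq, Plam, div_pow, Real.sq_sqrt (by positivity : 0 ≤ lam ^ 2 + 4),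
    Real.sq_sqrt zero_le_two]
  field_simp
  ring

theorem fst_Plam_pos (lam : ℝ) : 0 < (Plam lam).1 := by
  simp only [Plam]
  positivity

theorem snd_fst_Plam (lam : ℝ) : (Plam lam).2.1 = (Plam lam).1 := rfl

theorem snd_snd_Plam (lam : ℝ) : (Plam lam).2.2 = lam / √2 * (Plam lam).1 := by
  simp only [Plam]
  field_simp

theorem growth_Plam (lam : ℝ) : growth lam (Plam lam) = (1 - lam ^ 2 / 2) * (Plam lam).1 := by
  have hnormSq := normSq_Plam lam
  simp only [normSq, snd_fst_Plam, snd_snd_Plam, mul_pow, div_pow, Real.sq_sqrt zero_le_two]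
    at hnormSq
  simp only [growth, surf, snd_fst_Plam, snd_snd_Plam]
  rw [← mul_assoc, ← sq, mul_pow, div_pow, Real.sq_sqrt zero_le_two]
  linear_combination 2 * (Plam lam).1 * hnormSq

namespace Config

variable {S : Config}

theorem metricB_sub_one_le_kretschmann {τ : ℝ} (hr : 0 < S.radius τ) (hr1 : S.radius τ ≤ 1)
    (hB : 2 ≤ S.metricB τ) : S.metricB τ - 1 ≤ S.kretschmann τ := by
  have hdiv : S.metricB τ - 1 ≤ (S.metricB τ - 1) / S.radius τ ^ 2 :=
    le_div_self (by linarith) (pow_pos hr 2) (pow_le_one₀ hr.le hr1)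
  have hsphere : S.metricB τ - 1 ≤ ((1 - S.hat S.radius τ ^ 2) / S.radius τ ^ 2) ^ 2 := by
    have hsymm : ((1 - S.hat S.radius τ ^ 2) / S.radius τ ^ 2) ^ 2
        = ((S.metricB τ - 1) / S.radius τ ^ 2) ^ 2 := by
      rw [metricB, ← neg_sub, neg_div, neg_sq]
    rw [hsymm]
    nlinarith
  have hrest : 0 ≤ (S.hat (S.hat S.lapse) τ / S.lapse τ) ^ 2
      + 2 * (S.hat S.lapse τ * S.hat S.radius τ / (S.lapse τ * S.radius τ)) ^ 2
      + 2 * (S.hat (S.hat S.radius) τ / S.radius τ) ^ 2 := by positivity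
  rw [kretschmann]
  linarith

theorem tendsto_kretschmann_atTop {l : Filter ℝ} (hr : ∀ τ, 0 < S.radius τ)
    (hr0 : Tendsto S.radius l (𝓝 0)) (hB : Tendsto S.metricB l atTop) :
    Tendsto S.kretschmann l atTop := by
  refine tendsto_atTop_mono' l ?_ (tendsto_atTop_add_const_right l (-1) hB)
  filter_upwards [hB.eventually_ge_atTop 2, hr0.eventually_le_const one_pos] with τ hB2 hr1
  exact metricB_sub_one_le_kretschmann (hr τ) hr1 hB2

namespace Traces

variable {V0 lam : ℝ} {γ : ℝ → Pt} {p : Pt} (h : S.Traces V0 lam γ)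

include h

theorem tendsto_radius_atBot (hp : Tendsto γ atBot (𝓝 p)) (hp1 : 0 < p.1) :
    Tendsto S.radius atBot (𝓝 0) :=
  tendsto_zero_of_hasDerivAt_mul_self hp1 h.radius_pos h.radius_deriv hp.fst_nhds

theorem tendsto_metricB_atTop (hf : IsFinite γ) {l : Filter ℝ} (hp : Tendsto γ l (𝓝 p))
    (hn : normSq p = 1) (hp1 : p.1 ≠ 0) : Tendsto S.metricB l atTop := by
  have hw : Tendsto (fun τ => 1 - normSq (γ τ)) l (𝓝[>] 0) := by
    refine tendsto_nhdsWithin_iff.2 ⟨?_, .of_forall fun τ => sub_pos.2 (hf τ)⟩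
    simpa only [hn, sub_self, Function.comp_def] using
      ((continuous_normSq.tendsto p).comp hp).const_sub 1
  simp only [funext (h.metricB_eq hf), div_eq_mul_inv]
  exact (hp.fst_nhds.pow 2).pos_mul_atTop (by positivity) hw.inv_tendsto_nhdsGT_zero

theorem integrableAtFilter_density_atBot (hγ : IsFlowLine lam γ) (hf : IsFinite γ)
    (hp : Tendsto γ atBot (𝓝 p)) (hrate : 0 < p.1 - growth lam p) :
    MeasureTheory.IntegrableAtFilter S.density atBot MeasureTheory.volume :=
  integrableAtFilter_of_hasDerivAt_mul_self hrate (h.density_pos hf) (h.hasDerivAt_density hγ hf)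
    (hp.fst_nhds.sub (((continuous_growth lam).tendsto p).comp hp))

theorem integrableAtFilter_density_div_lapse_atBot (hγ : IsFlowLine lam γ) (hf : IsFinite γ)
    (hp : Tendsto γ atBot (𝓝 p)) (hrate : 0 < p.1 - growth lam p - p.2.1) :
    MeasureTheory.IntegrableAtFilter (fun τ => S.density τ / S.lapse τ) atBot
      MeasureTheory.volume := by
  refine integrableAtFilter_of_hasDerivAt_mul_self
    (g := fun τ => (γ τ).1 - growth lam (γ τ) - (γ τ).2.1) hrate
    (fun τ => div_pos (h.density_pos hf τ) (h.lapse_pos τ)) (fun τ => ?_)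
    ((hp.fst_nhds.sub (((continuous_growth lam).tendsto p).comp hp)).sub hp.snd_nhds.fst_nhds)
  have hN := (h.lapse_pos τ).ne'
  refine ((h.hasDerivAt_density hγ hf τ).fun_div (h.lapse_deriv τ) hN).congr_deriv ?_
  field_simp

theorem nakedSingularity (hγ : IsFlowLine lam γ) (hf : IsFinite γ) (hp : Tendsto γ atBot (𝓝 p))
    (hn : normSq p = 1) (hp1 : 0 < p.1) (hproper : 0 < p.1 - growth lam p)
    (hlight : 0 < p.1 - growth lam p - p.2.1) : S.NakedSingularity atBot :=
  have hr0 := h.tendsto_radius_atBot hp hp1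
  have hB := h.tendsto_metricB_atTop hf hp hn hp1.ne'
  ⟨hr0, hB, tendsto_kretschmann_atTop h.radius_pos hr0 hB,
    h.integrableAtFilter_density_atBot hγ hf hp hproper,
    h.integrableAtFilter_density_div_lapse_atBot hγ hf hp hlight⟩

theorem nakedSingularity_of_mem_critCurve (hγ : IsFlowLine lam γ) (hf : IsFinite γ)
    (hlim : Tendsto γ atBot (𝓝 p)) (hp : p ∈ critCurve) (hne : p ≠ PH) :
    S.NakedSingularity atBot := by
  have hp1 : 0 < p.1 :=
    (fst_nonneg_of_mem_surfM hp.1).lt_of_ne' fun h0 => hne (eq_PH_of_mem_critCurve hp h0)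
  obtain ⟨hsurf, hn, hadd⟩ := (mem_critCurve_iff p).1 hp
  have hgrowth : growth lam p = -(p.1 + p.2.1) := by
    rw [growth_of_surf_eq_zero lam hsurf, hn, sub_self, mul_zero, add_zero]
  exact h.nakedSingularity hγ hf hlim hn hp1 (by linarith) (by linarith)

theorem nakedSingularity_of_tendsto_Plam (hγ : IsFlowLine lam γ) (hf : IsFinite γ)
    (hlim : Tendsto γ atBot (𝓝 (Plam lam))) (hlam : 6 < lam ^ 2) : S.NakedSingularity atBot := by
  have hp1 := fst_Plam_pos lam
  have hrate : 0 < (lam ^ 2 / 2 - 1) * (Plam lam).1 := mul_pos (by linarith) hp1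
  have hgrowth := growth_Plam lam
  refine h.nakedSingularity hγ hf hlim (normSq_Plam lam) hp1 (by linarith) ?_
  rw [snd_fst_Plam]
  linarith

end Traces

end Config

/-! ### Orbits on the invariant surface -/

/-- The angle `θ` of the parametrization `X₂ = cos θ`, `X₃ = sin θ - cos θ` of `M`. -/
def surfAngle (p : Pt) : ℝ := Real.arccos p.1

theorem isClosed_surfM : IsClosed surfM := by
  have hinter : surfM = {p : Pt | p.1 + p.2.1 = √(1 - p.1 ^ 2)} ∩
      ({p | p.1 ^ 2 ≤ 1} ∩ {p | normSq p ≤ 1}) := rfl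
  rw [hinter]
  exact (isClosed_eq (by fun_prop) (by fun_prop)).inter
    ((isClosed_le (by fun_prop) continuous_const).inter
      (isClosed_le continuous_normSq continuous_const))

theorem fst_eq_of_mem_surfM {p : Pt} (h : p ∈ surfM) (hX₃ : p.2.1 = 0) : p.1 = 1 / √2 := by
  have hsurf := ((mem_surfM_iff p).1 h).1
  have hsq : p.1 ^ 2 = (1 / √2) ^ 2 := by
    simp only [surf, hX₃] at hsurf
    rw [inv_sqrt_two_sq]
    linarith
  exact (pow_left_inj₀ (fst_nonneg_of_mem_surfM h) (by positivity) two_ne_zero).1 hsq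

theorem cos_surfAngle {p : Pt} (h : p ∈ surfM) : Real.cos (surfAngle p) = p.1 :=
  have hp1 := abs_le.1 ((sq_le_one_iff_abs_le_one _).1 h.2.1)
  Real.cos_arccos hp1.1 hp1.2

theorem sin_surfAngle {p : Pt} (h : p ∈ surfM) : Real.sin (surfAngle p) = p.1 + p.2.1 := by
  rw [surfAngle, Real.sin_arccos, h.1]

theorem snd_fst_eq_sin_sub_cos_surfAngle {p : Pt} (h : p ∈ surfM) :
    p.2.1 = Real.sin (surfAngle p) - Real.cos (surfAngle p) := by
  rw [sin_surfAngle h, cos_surfAngle h, add_sub_cancel_left]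

theorem one_sub_normSq_eq_surfAngle {p : Pt} (h : p ∈ surfM) :
    1 + 2 * p.2.2 ^ 2 + Real.cos (2 * surfAngle p) - 2 * Real.sin (2 * surfAngle p)
      = -2 * (1 - normSq p) := by
  have hsurf := ((mem_surfM_iff p).1 h).1
  rw [Real.cos_two_mul, Real.sin_two_mul, cos_surfAngle h, sin_surfAngle h, normSq]
  rw [surf] at hsurf
  linear_combination -2 * hsurf

theorem fst_le_two_div_sqrt_five_of_mem_surfM {p : Pt} (h : p ∈ surfM) : p.1 ≤ 2 / √5 := by
  obtain ⟨hsurf, hn, hpos⟩ := (mem_surfM_iff p).1 h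
  have hX₂ := fst_nonneg_of_mem_surfM h
  have hle : p.1 ≤ 2 * (p.1 + p.2.1) := by
    rcases hX₂.eq_or_lt with hzero | hX₂pos
    · rw [← hzero] at hpos ⊢
      linarith
    · simp only [surf, normSq] at hsurf hn
      have hprod : 0 ≤ p.1 * (p.1 + 2 * p.2.1) := by nlinarith [sq_nonneg p.2.2]
      linarith [nonneg_of_mul_nonneg_right hprod hX₂pos]
  have hsq : (p.1 * √5) ^ 2 ≤ 2 ^ 2 := by
    rw [mul_pow, Real.sq_sqrt (by norm_num)]
    have hsum := (surf_eq_zero_iff p).1 hsurf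
    nlinarith [pow_le_pow_left₀ hX₂ hle 2]
  exact (le_div_iff₀ (by positivity)).2 (le_of_sq_le_sq hsq zero_le_two)

theorem surfAngle_mem_Icc {p : Pt} (h : p ∈ surfM) :
    surfAngle p ∈ Set.Icc (Real.arccos (2 / √5)) (Real.pi / 2) :=
  ⟨Real.arccos_le_arccos (fst_le_two_div_sqrt_five_of_mem_surfM h),
    Real.arccos_le_pi_div_two.2 (fst_nonneg_of_mem_surfM h)⟩

theorem surfAngle_eq_pi_div_four {p : Pt} (h : p ∈ surfM) (hX₃ : p.2.1 = 0) :
    surfAngle p = Real.pi / 4 := by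
  rw [surfAngle, fst_eq_of_mem_surfM h hX₃, ← Real.sqrt_div_self', ← Real.cos_pi_div_four,
    Real.arccos_cos (by positivity) (by linarith [Real.pi_pos])]

namespace IsFlowLine

variable {lam : ℝ} {γ : ℝ → Pt} (h : IsFlowLine lam γ)

include h

theorem hasDerivAt_X₂_of_surf_eq_zero {τ : ℝ} (hs : surf (γ τ) = 0) :
    HasDerivAt (fun t => (γ t).1)
      (((γ τ).1 + (γ τ).2.1) * (γ τ).2.1 * (1 - normSq (γ τ))) τ := by
  refine (h.hasDerivAt_X₂ τ).congr_deriv ?_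
  rw [growth_of_surf_eq_zero lam hs]
  simp only [surf] at hs
  simp only [normSq]
  linear_combination ((γ τ).1 ^ 2 + (γ τ).2.1 ^ 2 + (γ τ).2.2 ^ 2) * hs

theorem hasDerivAt_X₃_of_surf_eq_zero {τ : ℝ} (hs : surf (γ τ) = 0) :
    HasDerivAt (fun t => (γ t).2.1)
      (-((2 * (γ τ).1 + (γ τ).2.1) * (1 - normSq (γ τ))) * (γ τ).2.1) τ := by
  refine (h.hasDerivAt_X₃ τ).congr_deriv ?_
  rw [growth_of_surf_eq_zero lam hs, hs]
  ring

theorem hasDerivAt_Y₁_of_surf_eq_zero {τ : ℝ} (hs : surf (γ τ) = 0) :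
    HasDerivAt (fun t => (γ t).2.2)
      (-((2 * (γ τ).1 + (γ τ).2.1) * (1 - normSq (γ τ))) * (γ τ).2.2) τ := by
  refine (h.hasDerivAt_Y₁ τ).congr_deriv ?_
  rw [growth_of_surf_eq_zero lam hs, hs]
  ring

theorem hasDerivAt_surfAngle {τ : ℝ} (hM : γ τ ∈ surfM) :
    HasDerivAt (fun t => surfAngle (γ t)) (-(γ τ).2.1 * (1 - normSq (γ τ))) τ := by
  obtain ⟨hsurf, -, hpos⟩ := (mem_surfM_iff _).1 hM
  have hsq := (surf_eq_zero_iff _).1 hsurf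
  have hlt : (γ τ).1 ^ 2 < 1 := by nlinarith
  have habs := abs_lt.1 ((sq_lt_one_iff_abs_lt_one _).1 hlt)
  refine ((Real.hasDerivAt_arccos habs.1.ne' habs.2.ne).comp τ
    (h.hasDerivAt_X₂_of_surf_eq_zero hsurf)).congr_deriv ?_
  rw [← hM.1]
  field_simp

theorem hasDerivAt_surfAngle_trig {τ : ℝ} (hM : γ τ ∈ surfM) :
    HasDerivAt (fun t => surfAngle (γ t))
      (-((Real.cos (surfAngle (γ τ)) - Real.sin (surfAngle (γ τ))) / 2) *
        (1 + 2 * (γ τ).2.2 ^ 2 + Real.cos (2 * surfAngle (γ τ))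
          - 2 * Real.sin (2 * surfAngle (γ τ)))) τ := by
  rw [one_sub_normSq_eq_surfAngle hM, cos_surfAngle hM, sin_surfAngle hM]
  exact (h.hasDerivAt_surfAngle hM).congr_deriv (by ring)

theorem hasDerivAt_Y₁_trig {τ : ℝ} (hM : γ τ ∈ surfM) :
    HasDerivAt (fun t => (γ t).2.2)
      ((γ τ).2.2 * ((Real.cos (surfAngle (γ τ)) + Real.sin (surfAngle (γ τ))) / 2) *
        (1 + 2 * (γ τ).2.2 ^ 2 + Real.cos (2 * surfAngle (γ τ))
          - 2 * Real.sin (2 * surfAngle (γ τ)))) τ := by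
  rw [one_sub_normSq_eq_surfAngle hM, cos_surfAngle hM, sin_surfAngle hM]
  exact (h.hasDerivAt_Y₁_of_surf_eq_zero ((mem_surfM_iff _).1 hM).1).congr_deriv (by ring)

-- `X₃` and `Y₁` satisfy the same linear equation, so one is a multiple of the other.
theorem X₃_eq_zero_or_Y₁_eq_const_mul_X₃ (hs : ∀ τ, surf (γ τ) = 0) :
    (∀ τ, (γ τ).2.1 = 0) ∨ ∃ c, ∀ τ, (γ τ).2.2 = c * (γ τ).2.1 := by
  have hrate : Continuous fun τ => -((2 * (γ τ).1 + (γ τ).2.1) * (1 - normSq (γ τ))) := by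
    have := h.continuous
    have := continuous_normSq
    fun_prop
  have hX₃ := fun t => h.hasDerivAt_X₃_of_surf_eq_zero (hs t)
  by_cases hzero : ∃ τ, (γ τ).2.1 = 0
  · obtain ⟨τ, hτ⟩ := hzero
    exact Or.inl (eq_zero_of_hasDerivAt_mul_self hrate hX₃ hτ)
  · push Not at hzero
    exact Or.inr (exists_eq_const_mul_of_hasDerivAt_mul_self
      (fun t => h.hasDerivAt_Y₁_of_surf_eq_zero (hs t)) hX₃ hzero)

theorem Y₁_eq_const_mul_or_surfAngle_eq (hM : ∀ τ, γ τ ∈ surfM) :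
    (∃ c₁ : ℝ, ∀ τ, (γ τ).2.2 =
      c₁ * (Real.cos (surfAngle (γ τ)) - Real.sin (surfAngle (γ τ)))) ∨
      ∀ τ, surfAngle (γ τ) = Real.pi / 4 := by
  rcases h.X₃_eq_zero_or_Y₁_eq_const_mul_X₃ fun τ => ((mem_surfM_iff _).1 (hM τ)).1 with
    hX₃ | ⟨c, hc⟩
  · exact Or.inr fun τ => surfAngle_eq_pi_div_four (hM τ) (hX₃ τ)
  · refine Or.inl ⟨-c, fun τ => ?_⟩
    rw [hc, snd_fst_eq_sin_sub_cos_surfAngle (hM τ)]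
    ring

theorem antitone_X₃_sq_add_Y₁_sq (hM : ∀ τ, γ τ ∈ surfM) :
    Antitone fun τ => (γ τ).2.1 ^ 2 + (γ τ).2.2 ^ 2 := by
  have hderiv : ∀ τ, HasDerivAt (fun t => (γ t).2.1 ^ 2 + (γ t).2.2 ^ 2)
      (-((2 * (γ τ).1 + (γ τ).2.1) * (1 - normSq (γ τ))
        * (2 * ((γ τ).2.1 ^ 2 + (γ τ).2.2 ^ 2)))) τ := fun τ => by
    have hsurf := ((mem_surfM_iff _).1 (hM τ)).1
    exact (((h.hasDerivAt_X₃_of_surf_eq_zero hsurf).fun_pow 2).fun_add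
      ((h.hasDerivAt_Y₁_of_surf_eq_zero hsurf).fun_pow 2)).congr_deriv (by push_cast; ring)
  refine antitone_of_hasDerivAt_nonpos hderiv fun τ => neg_nonpos.2 ?_
  obtain ⟨-, hn, hpos⟩ := (mem_surfM_iff _).1 (hM τ)
  have hX₂ := fst_nonneg_of_mem_surfM (hM τ)
  exact mul_nonneg (mul_nonneg (by linarith) (sub_nonneg.2 hn)) (by positivity)

theorem eq_PM_of_tendsto_PM_atBot (hM : ∀ τ, γ τ ∈ surfM) (hlim : Tendsto γ atBot (𝓝 PM))
    (τ : ℝ) : γ τ = PM := by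
  have hsq : Tendsto (fun t => (γ t).2.1 ^ 2 + (γ t).2.2 ^ 2) atBot (𝓝 0) :=
    ((hlim.snd_nhds.fst_nhds.pow 2).add (hlim.snd_nhds.snd_nhds.pow 2)).trans_eq (by simp [PM])
  have hle := (h.antitone_X₃_sq_add_Y₁_sq hM).ge_of_tendsto hsq τ
  have hX₃ : (γ τ).2.1 = 0 := by nlinarith [sq_nonneg (γ τ).2.1, sq_nonneg (γ τ).2.2]
  have hY₁ : (γ τ).2.2 = 0 := by nlinarith [sq_nonneg (γ τ).2.1, sq_nonneg (γ τ).2.2]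
  exact Prod.ext (fst_eq_of_mem_surfM (hM τ) hX₃) (Prod.ext hX₃ hY₁)

theorem tendsto_PM_atTop (hf : IsFinite γ) (hM : ∀ τ, γ τ ∈ surfM) : Tendsto γ atTop (𝓝 PM) := by
  have hsurf := fun τ => ((mem_surfM_iff _).1 (hM τ)).1
  have hback : ∀ {p : Pt}, Tendsto (fun τ => -γ (-τ)) atBot (𝓝 p) →
      Tendsto γ atTop (𝓝 (-p)) ∧ p ∈ surfMbar := fun {p} hp => by
    have hlim : Tendsto γ atTop (𝓝 (-p)) := by
      simpa only [neg_neg] using tendsto_neg_comp_neg_atTop hp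
    exact ⟨hlim, (neg_mem_surfM_iff p).1
      (isClosed_surfM.mem_of_tendsto hlim (.of_forall hM))⟩
  rcases h.neg.exists_tendsto_atBot hf.neg fun τ => (surf_neg _).trans_le (hsurf _).le with
    hp | hp | ⟨p, hp, hcrit | ⟨hlam, rfl⟩⟩
  · have hpos := ((mem_surfMbar_iff _).1 (hback hp).2).2.2
    simp only [PM, add_zero] at hpos
    exact absurd hpos (by positivity : (0 : ℝ) < 1 / √2).not_gt
  · exact neg_PMbar ▸ (hback hp).1
  · exact absurd (hback hp).2 (disjoint_surfM_surfMbar.notMem_of_mem_left hcrit.1)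
  · exact absurd ((mem_surfMbar_iff _).1 (hback hp).2).1 ((surf_Plam_neg_iff lam).2 hlam).ne

theorem exists_tendsto_critCurve_atBot (hf : IsFinite γ) (hM : ∀ τ, γ τ ∈ surfM)
    (hne : ∃ τ, γ τ ≠ PM) : ∃ p ∈ critCurve, Tendsto γ atBot (𝓝 p) := by
  have hsurf := fun τ => ((mem_surfM_iff _).1 (hM τ)).1
  have hmem : ∀ {p : Pt}, Tendsto γ atBot (𝓝 p) → p ∈ surfM := fun hp =>
    isClosed_surfM.mem_of_tendsto hp (.of_forall hM)
  rcases h.exists_tendsto_atBot hf fun τ => (hsurf τ).le with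
    hp | hp | ⟨p, hp, hcrit | ⟨hlam, rfl⟩⟩
  · obtain ⟨τ, hτ⟩ := hne
    exact absurd (h.eq_PM_of_tendsto_PM_atBot hM hp τ) hτ
  · have hX₂ := fst_nonneg_of_mem_surfM (hmem hp)
    simp only [PMbar] at hX₂
    exact absurd (neg_nonneg.1 hX₂) (by positivity : (0 : ℝ) < 1 / √2).not_ge
  · exact ⟨p, hcrit, hp⟩
  · exact absurd ((mem_surfM_iff _).1 (hmem hp)).1 ((surf_Plam_neg_iff lam).2 hlam).ne

theorem tendsto_PMbar_atBot (hf : IsFinite γ) (hM : ∀ τ, γ τ ∈ surfMbar) :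
    Tendsto γ atBot (𝓝 PMbar) := by
  have hlim := h.neg.tendsto_PM_atTop hf.neg fun τ => (neg_mem_surfM_iff _).2 (hM _)
  simpa only [neg_neg, neg_PM] using tendsto_neg_comp_neg_atBot hlim

theorem exists_tendsto_critCurveBar_atTop (hf : IsFinite γ) (hM : ∀ τ, γ τ ∈ surfMbar)
    (hne : ∃ τ, γ τ ≠ PMbar) : ∃ p ∈ critCurveBar, Tendsto γ atTop (𝓝 p) := by
  obtain ⟨τ, hτ⟩ := hne
  obtain ⟨p, hp, hlim⟩ := h.neg.exists_tendsto_critCurve_atBot hf.neg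
    (fun τ => (neg_mem_surfM_iff _).2 (hM _))
    ⟨-τ, fun heq => hτ (by rw [← neg_PM, ← heq, neg_neg, neg_neg])⟩
  refine ⟨-p, (neg_mem_critCurve_iff _).1 (by rwa [neg_neg]), ?_⟩
  simpa only [neg_neg] using tendsto_neg_comp_neg_atTop hlim

end IsFlowLine

/-! ### The exterior Schwarzschild solution -/

section PeriodicBounds

variable {f : ℝ → ℝ} {T : ℝ}

theorem exists_norm_le_of_periodic (hf : Continuous f) (hp : f.Periodic T) (hT : T ≠ 0) :
    ∃ L : NNReal, ∀ x, ‖f x‖ ≤ L := by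
  obtain ⟨C, hC⟩ := (hp.isBounded_of_continuous hT hf).exists_norm_le
  exact ⟨C.toNNReal, fun x => (hC _ ⟨x, rfl⟩).trans C.le_coe_toNNReal⟩

theorem exists_lipschitzWith_of_periodic (hf : ContDiff ℝ 1 f) (hp : f.Periodic T) (hT : T ≠ 0) :
    ∃ K, LipschitzWith K f := by
  have hperiodic : (deriv f).Periodic T := fun x => by
    rw [← deriv_comp_add_const]
    exact congrArg (deriv · x) (funext hp)
  obtain ⟨K, hK⟩ := exists_norm_le_of_periodic (hf.continuous_deriv le_rfl) hperiodic hT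
  exact ⟨K, lipschitzWith_of_nnnorm_deriv_le (hf.differentiable one_ne_zero) fun x =>
    NNReal.coe_le_coe.1 (hK x)⟩

end PeriodicBounds

/-- The rate of change of the angle `θ` along the orbits on `M` with `Y₁ = 0`. -/
def angleRate (θ : ℝ) : ℝ :=
  (Real.cos θ - Real.sin θ) * Real.cos θ * (2 * Real.sin θ - Real.cos θ)

/-- The points of `M` with `Y₁ = 0`, parametrized by the angle `θ`. -/
def surfArc (θ : ℝ) : Pt := (Real.cos θ, Real.sin θ - Real.cos θ, 0)

/-- An integral curve on the arc of `M` with `Y₁ = 0` strictly between `P_H` and `P_M`; these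
curves are the ones of the exterior Schwarzschild solution of positive mass. -/
structure IsSchwarzschildCurve (lam : ℝ) (γ : ℝ → Pt) : Prop where
  isFlowLine : IsFlowLine lam γ
  mem_surfM : ∀ τ, γ τ ∈ surfM
  X₂_pos : ∀ τ, 0 < (γ τ).1
  X₃_pos : ∀ τ, 0 < (γ τ).2.1
  Y₁_eq_zero : ∀ τ, (γ τ).2.2 = 0

theorem surf_surfArc (θ : ℝ) : surf (surfArc θ) = 0 := by
  simp only [surf, surfArc]
  linear_combination Real.sin_sq_add_cos_sq θ

theorem one_sub_normSq_surfArc (θ : ℝ) :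
    1 - normSq (surfArc θ) = Real.cos θ * (2 * Real.sin θ - Real.cos θ) := by
  simp only [normSq, surfArc]
  linear_combination -Real.sin_sq_add_cos_sq θ

theorem contDiff_angleRate : ContDiff ℝ 1 angleRate := by
  unfold angleRate
  fun_prop

theorem periodic_angleRate : angleRate.Periodic (2 * Real.pi) := fun θ => by
  simp only [angleRate, Real.cos_add_two_pi, Real.sin_add_two_pi]

theorem exists_lipschitzWith_angleRate : ∃ K, LipschitzWith K angleRate :=
  exists_lipschitzWith_of_periodic contDiff_angleRate periodic_angleRate Real.two_pi_pos.ne'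

theorem exists_angle_solution (θ₀ : ℝ) :
    ∃ θ : ℝ → ℝ, θ 0 = θ₀ ∧ ∀ t, HasDerivAt θ (angleRate (θ t)) t := by
  obtain ⟨K, hK⟩ := exists_lipschitzWith_angleRate
  obtain ⟨L, hL⟩ := exists_norm_le_of_periodic contDiff_angleRate.continuous periodic_angleRate
    Real.two_pi_pos.ne'
  exact exists_forall_hasDerivAt_of_lipschitzWith hK hL θ₀

section AngleSolution

variable {θ : ℝ → ℝ} (hθ : ∀ t, HasDerivAt θ (angleRate (θ t)) t)

include hθ

theorem cos_pos_of_hasDerivAt_angleRate {s : ℝ} (hs : 0 < Real.cos (θ s)) (t : ℝ) :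
    0 < Real.cos (θ t) := by
  have hcont : Continuous θ := continuous_iff_continuousAt.2 fun t => (hθ t).continuousAt
  refine pos_of_hasDerivAt_mul_self (g := fun t => -Real.sin (θ t) *
    ((Real.cos (θ t) - Real.sin (θ t)) * (2 * Real.sin (θ t) - Real.cos (θ t))))
    (by fun_prop) (fun t => (hθ t).cos.congr_deriv ?_) hs t
  simp only [angleRate]
  ring

theorem sin_sub_cos_pos_of_hasDerivAt_angleRate {s : ℝ}
    (hs : 0 < Real.sin (θ s) - Real.cos (θ s)) (t : ℝ) : 0 < Real.sin (θ t) - Real.cos (θ t) := by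
  have hcont : Continuous θ := continuous_iff_continuousAt.2 fun t => (hθ t).continuousAt
  refine pos_of_hasDerivAt_mul_self (f := fun t => Real.sin (θ t) - Real.cos (θ t))
    (g := fun t => -((Real.cos (θ t) + Real.sin (θ t)) * Real.cos (θ t) *
      (2 * Real.sin (θ t) - Real.cos (θ t))))
    (by fun_prop) (fun t => ((hθ t).sin.fun_sub (hθ t).cos).congr_deriv ?_) hs t
  simp only [angleRate]
  ring

theorem isFlowLine_surfArc (lam : ℝ) : IsFlowLine lam fun t => surfArc (θ t) := fun t => by
  refine ((hθ t).cos.prodMk (((hθ t).sin.fun_sub (hθ t).cos).prodMk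
    (hasDerivAt_const t (0 : ℝ)))).congr_deriv ?_
  have hgrowth := growth_of_surf_eq_zero lam (surf_surfArc (θ t))
  have htrig := Real.sin_sq_add_cos_sq (θ t)
  ext
  · rw [field_fst, hgrowth, one_sub_normSq_surfArc]
    simp only [surfArc, angleRate]
    linear_combination (2 * Real.sin (θ t) - Real.cos (θ t)) * Real.cos (θ t) * htrig
  · rw [field_snd_fst, hgrowth, surf_surfArc, one_sub_normSq_surfArc]
    simp only [surfArc, angleRate]
    ring
  · rw [field_snd_snd, surf_surfArc]
    simp [surfArc]

theorem isSchwarzschildCurve_surfArc (lam : ℝ) {s : ℝ} (hcos : 0 < Real.cos (θ s))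
    (hsub : 0 < Real.sin (θ s) - Real.cos (θ s)) :
    IsSchwarzschildCurve lam fun t => surfArc (θ t) where
  isFlowLine := isFlowLine_surfArc hθ lam
  mem_surfM t := by
    have hX₂ := cos_pos_of_hasDerivAt_angleRate hθ hcos t
    have hX₃ := sin_sub_cos_pos_of_hasDerivAt_angleRate hθ hsub t
    refine (mem_surfM_iff _).2 ⟨surf_surfArc _, sub_nonneg.1 ?_, add_pos hX₂ hX₃⟩
    rw [one_sub_normSq_surfArc]
    exact mul_nonneg hX₂.le (by linarith)
  X₂_pos := cos_pos_of_hasDerivAt_angleRate hθ hcos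
  X₃_pos := sin_sub_cos_pos_of_hasDerivAt_angleRate hθ hsub
  Y₁_eq_zero _ := rfl

end AngleSolution

theorem exists_isSchwarzschildCurve (lam : ℝ) : ∃ γ, IsSchwarzschildCurve lam γ := by
  obtain ⟨θ, hθ₀, hθ⟩ := exists_angle_solution (Real.pi / 3)
  refine ⟨_, isSchwarzschildCurve_surfArc hθ lam (s := 0) ?_ ?_⟩
  · rw [hθ₀, Real.cos_pi_div_three]
    norm_num
  · rw [hθ₀, Real.cos_pi_div_three, Real.sin_pi_div_three, sub_pos]
    gcongr
    exact Real.lt_sqrt zero_le_one |>.2 (by norm_num)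

namespace IsFlowLine

variable {lam : ℝ} {γ : ℝ → Pt} (h : IsFlowLine lam γ)

include h

theorem isFinite_of_tendsto {l : Filter ℝ} [l.NeBot] {p : Pt} (hlim : Tendsto γ l (𝓝 p))
    (hp : normSq p < 1) : IsFinite γ := fun τ => by
  have hγ := h.continuous
  have hgrowth := continuous_growth lam
  obtain ⟨T, hT⟩ :=
    ((continuous_normSq.tendsto p).comp hlim |>.eventually_lt_const hp).exists
  exact sub_pos.1 (pos_of_hasDerivAt_mul_self (by fun_prop) h.hasDerivAt_one_sub_normSq
    (sub_pos.2 hT) τ)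

theorem surf_eq_zero_or_surf_neg (hs : ∀ τ, surf (γ τ) ≤ 0) :
    (∀ τ, surf (γ τ) = 0) ∨ ∀ τ, surf (γ τ) < 0 := by
  by_cases hzero : ∃ τ, surf (γ τ) = 0
  · obtain ⟨s, hs⟩ := hzero
    exact Or.inl fun t => surf_eq_zero_of_surf_eq_zero Set.ordConnected_univ
      (fun τ _ => (h τ).hasDerivWithinAt) (Set.mem_univ s) (Set.mem_univ t) hs
  · push Not at hzero
    exact Or.inr fun τ => (hs τ).lt_of_ne (hzero τ)

theorem mem_surfM_or_mem_surfMbar (hn : ∀ τ, normSq (γ τ) ≤ 1) (hs : ∀ τ, surf (γ τ) = 0) :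
    (∀ τ, γ τ ∈ surfM) ∨ ∀ τ, γ τ ∈ surfMbar := by
  have hzero : γ 0 ∈ surfM ∪ surfMbar := surf_eq_zero_inter_ball_eq ▸ ⟨hs 0, hn 0⟩
  refine hzero.imp (fun hM t => ?_) fun hM t => ?_
  · exact mem_surfM_of_mem_surfM Set.ordConnected_univ
      (fun τ _ => (h τ).hasDerivWithinAt) (Set.mem_univ 0) (Set.mem_univ t) hM
  · exact mem_surfMbar_of_mem_surfMbar Set.ordConnected_univ
      (fun τ _ => (h τ).hasDerivWithinAt) (Set.mem_univ 0) (Set.mem_univ t) hM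

theorem mem_surfM_of_tendsto_PM_atTop (hγ : ∀ τ, γ τ ∈ phaseSpace)
    (hlim : Tendsto γ atTop (𝓝 PM)) (τ : ℝ) : γ τ ∈ surfM := by
  have hs := (h.surf_eq_zero_or_surf_neg fun τ => (hγ τ).1).resolve_right
    fun hneg => h.not_tendsto_PM_atTop hneg hlim
  refine (h.mem_surfM_or_mem_surfMbar (fun τ => (hγ τ).2) hs).resolve_right (fun hbar => ?_) τ
  have hle : PM.1 + PM.2.1 ≤ 0 := le_of_tendsto' (hlim.fst_nhds.add hlim.snd_nhds.fst_nhds)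
    fun τ => ((mem_surfMbar_iff _).1 (hbar τ)).2.2.le
  simp only [PM, add_zero] at hle
  exact hle.not_gt (by positivity)

end IsFlowLine

theorem fst_ne_zero_of_mem_surfM {p : Pt} (h : p ∈ surfM) (hn : normSq p < 1) : p.1 ≠ 0 :=
  fun hzero => by
    have hsurf := ((mem_surfM_iff p).1 h).1
    simp only [surf, hzero] at hsurf
    simp only [normSq, hzero] at hn
    nlinarith [sq_nonneg p.2.2]

theorem isSchwarzschildCurve_of_tendsto {lam : ℝ} {γ : ℝ → Pt} (h : IsOrbit lam γ)
    (hbot : Tendsto γ atBot (𝓝 PH)) (htop : Tendsto γ atTop (𝓝 PM)) :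
    IsSchwarzschildCurve lam γ := by
  have hf : IsFinite γ := h.1.isFinite_of_tendsto htop (by rw [normSq_PM]; norm_num)
  have hM := h.1.mem_surfM_of_tendsto_PM_atTop h.2 htop
  have hs := fun τ => ((mem_surfM_iff _).1 (hM τ)).1
  have hX₃lim : Tendsto (fun τ => (γ τ).2.1) atBot (𝓝 1) := hbot.snd_nhds.fst_nhds
  obtain ⟨T, hT⟩ := (hX₃lim.eventually_const_lt one_pos).exists
  have hrate : Continuous fun τ => -((2 * (γ τ).1 + (γ τ).2.1) * (1 - normSq (γ τ))) := by
    have := h.1.continuous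
    have := continuous_normSq
    fun_prop
  refine ⟨h.1, hM, fun τ => ?_, pos_of_hasDerivAt_mul_self hrate
    (fun t => h.1.hasDerivAt_X₃_of_surf_eq_zero (hs t)) hT, fun τ => ?_⟩
  · exact (fst_nonneg_of_mem_surfM (hM τ)).lt_of_ne' (fst_ne_zero_of_mem_surfM (hM τ) (hf τ))
  · obtain ⟨c, hc⟩ := (h.1.X₃_eq_zero_or_Y₁_eq_const_mul_X₃ hs).resolve_left
      fun hzero => hT.ne' (hzero T)
    have hc_zero : c * 1 = 0 := tendsto_nhds_unique (hX₃lim.const_mul c)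
      (hbot.snd_nhds.snd_nhds.congr hc)
    rw [hc, ← mul_one c, hc_zero, zero_mul]

namespace IsSchwarzschildCurve

variable {lam : ℝ} {γ δ : ℝ → Pt} (h : IsSchwarzschildCurve lam γ)

include h

theorem surf_eq_zero (τ : ℝ) : surf (γ τ) = 0 := ((mem_surfM_iff _).1 (h.mem_surfM τ)).1

theorem one_sub_normSq_eq (τ : ℝ) :
    1 - normSq (γ τ) = (γ τ).1 * ((γ τ).1 + 2 * (γ τ).2.1) := by
  have hsurf := h.surf_eq_zero τ
  simp only [surf] at hsurf
  simp only [normSq, h.Y₁_eq_zero τ]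
  linear_combination -hsurf

theorem X₂_add_two_mul_X₃_pos (τ : ℝ) : 0 < (γ τ).1 + 2 * (γ τ).2.1 :=
  add_pos (h.X₂_pos τ) (mul_pos two_pos (h.X₃_pos τ))

theorem isFinite : IsFinite γ := fun τ => sub_pos.1 <| by
  rw [h.one_sub_normSq_eq]
  exact mul_pos (h.X₂_pos τ) (h.X₂_add_two_mul_X₃_pos τ)

theorem isOrbit : IsOrbit lam γ :=
  ⟨h.isFlowLine, fun τ => ⟨(h.surf_eq_zero τ).le, (h.isFinite τ).le⟩⟩

theorem tendsto_PM : Tendsto γ atTop (𝓝 PM) := h.isFlowLine.tendsto_PM_atTop h.isFinite h.mem_surfM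

theorem tendsto_PH : Tendsto γ atBot (𝓝 PH) := by
  obtain ⟨p, hp, hlim⟩ := h.isFlowLine.exists_tendsto_critCurve_atBot h.isFinite h.mem_surfM
    ⟨0, fun heq => (h.X₃_pos 0).ne' (by rw [heq, PM])⟩
  have hY₁ : p.2.2 = 0 := tendsto_nhds_unique hlim.snd_nhds.snd_nhds (by simp [h.Y₁_eq_zero])
  have hX₃ : 0 ≤ p.2.1 := ge_of_tendsto' hlim.snd_nhds.fst_nhds fun τ => (h.X₃_pos τ).le
  have hX₂ := fst_nonneg_of_mem_surfM hp.1
  obtain ⟨hsurf, hn, -⟩ := (mem_critCurve_iff p).1 hp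
  simp only [surf] at hsurf
  simp only [normSq, hY₁] at hn
  rwa [eq_PH_of_mem_critCurve hp (by nlinarith [mul_nonneg hX₂ hX₃])] at hlim

theorem hasDerivAt_surfAngle (τ : ℝ) :
    HasDerivAt (fun t => surfAngle (γ t)) (angleRate (surfAngle (γ τ))) τ := by
  refine (h.isFlowLine.hasDerivAt_surfAngle (h.mem_surfM τ)).congr_deriv ?_
  rw [h.one_sub_normSq_eq, angleRate, cos_surfAngle (h.mem_surfM τ), sin_surfAngle (h.mem_surfM τ)]
  ring

theorem eq_surfArc (τ : ℝ) : γ τ = surfArc (surfAngle (γ τ)) := by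
  have hM := h.mem_surfM τ
  rw [surfArc, cos_surfAngle hM, sin_surfAngle hM, add_sub_cancel_left, ← h.Y₁_eq_zero τ]

theorem X₂_lt (τ : ℝ) : (γ τ).1 < 1 / √2 := by
  have hsurf := h.surf_eq_zero τ
  simp only [surf] at hsurf
  refine lt_of_pow_lt_pow_left₀ 2 (by positivity) ?_
  rw [inv_sqrt_two_sq]
  nlinarith [mul_pos (h.X₂_pos τ) (h.X₃_pos τ), pow_pos (h.X₃_pos τ) 2]

theorem mem_range_X₂ {x : ℝ} (hx : x ∈ Set.Ioo 0 (1 / √2)) : ∃ τ, (γ τ).1 = x :=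
  mem_range_of_exists_le_of_exists_ge h.isFlowLine.continuous.fst
    (h.tendsto_PH.fst_nhds.eventually_le_const hx.1).exists
    (h.tendsto_PM.fst_nhds.eventually_const_le hx.2).exists

theorem exists_eq_shift (hδ : IsSchwarzschildCurve lam δ) : ∃ c, ∀ τ, δ τ = γ (τ + c) := by
  obtain ⟨c, hc⟩ := h.mem_range_X₂ ⟨hδ.X₂_pos 0, hδ.X₂_lt 0⟩
  obtain ⟨K, hK⟩ := exists_lipschitzWith_angleRate
  have hangle : (fun τ => surfAngle (δ τ)) = fun τ => surfAngle (γ (τ + c)) :=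
    ODE_solution_unique_univ (v := fun _ => angleRate) (s := fun _ => Set.univ) (t₀ := 0)
      (fun _ => hK.lipschitzOnWith) (fun t => ⟨hδ.hasDerivAt_surfAngle t, trivial⟩)
      (fun t => ⟨(h.hasDerivAt_surfAngle (t + c)).comp_add_const t c, trivial⟩)
      (by rw [surfAngle, surfAngle, zero_add, hc])
  exact ⟨c, fun τ => by rw [hδ.eq_surfArc, h.eq_surfArc, congrFun hangle τ]⟩

end IsSchwarzschildCurve

namespace IsSchwarzschildCurve

variable {lam V0 : ℝ} {γ : ℝ → Pt} {S : Config} (h : IsSchwarzschildCurve lam γ)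
  (hS : S.Traces V0 lam γ)

include h hS

theorem metricB_eq (τ : ℝ) : S.metricB τ = (γ τ).1 / ((γ τ).1 + 2 * (γ τ).2.1) := by
  rw [hS.metricB_eq h.isFinite, h.one_sub_normSq_eq, sq,
    mul_div_mul_left _ _ (h.X₂_pos τ).ne']

theorem one_sub_metricB_eq (τ : ℝ) :
    1 - S.metricB τ = 2 * (γ τ).2.1 / ((γ τ).1 + 2 * (γ τ).2.1) := by
  rw [h.metricB_eq hS, one_sub_div (h.X₂_add_two_mul_X₃_pos τ).ne', add_sub_cancel_left]

theorem metricB_pos (τ : ℝ) : 0 < S.metricB τ := by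
  rw [h.metricB_eq hS]
  exact div_pos (h.X₂_pos τ) (h.X₂_add_two_mul_X₃_pos τ)

theorem one_sub_metricB_pos (τ : ℝ) : 0 < 1 - S.metricB τ := by
  rw [h.one_sub_metricB_eq hS]
  exact div_pos (mul_pos two_pos (h.X₃_pos τ)) (h.X₂_add_two_mul_X₃_pos τ)

theorem hasDerivAt_metricB (τ : ℝ) :
    HasDerivAt S.metricB (2 * (γ τ).2.1 * S.metricB τ) τ := by
  have hX₂ := h.isFlowLine.hasDerivAt_X₂_of_surf_eq_zero (h.surf_eq_zero τ)
  have hX₃ := h.isFlowLine.hasDerivAt_X₃_of_surf_eq_zero (h.surf_eq_zero τ)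
  have hne := (h.X₂_add_two_mul_X₃_pos τ).ne'
  have hsurf := h.surf_eq_zero τ
  simp only [surf] at hsurf
  rw [funext (h.metricB_eq hS)]
  refine (hX₂.fun_div (hX₂.fun_add (hX₃.const_mul 2)) hne).congr_deriv ?_
  rw [h.one_sub_normSq_eq, div_eq_iff (pow_ne_zero 2 hne), mul_div_assoc', div_mul_eq_mul_div,
    eq_div_iff hne]
  linear_combination
    2 * (γ τ).1 * (γ τ).2.1 * ((γ τ).1 + 2 * (γ τ).2.1) ^ 2 * hsurf

theorem hasDerivAt_one_sub_metricB (τ : ℝ) :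
    HasDerivAt (fun t => 1 - S.metricB t) (-(γ τ).1 * (1 - S.metricB τ)) τ := by
  refine ((h.hasDerivAt_metricB hS τ).const_sub 1).congr_deriv ?_
  rw [h.one_sub_metricB_eq hS, h.metricB_eq hS]
  ring

theorem exists_lapse_sq_eq : ∃ c > 0, ∀ τ, S.lapse τ ^ 2 = c ^ 2 * S.metricB τ := by
  obtain ⟨k, hk⟩ := exists_eq_const_mul_of_hasDerivAt_mul_self
    (fun τ => ((hS.lapse_deriv τ).fun_pow 2).congr_deriv
      (by push_cast; ring : _ = 2 * (γ τ).2.1 * S.lapse τ ^ 2))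
    (h.hasDerivAt_metricB hS) fun τ => (h.metricB_pos hS τ).ne'
  have hkpos : 0 < k := pos_of_mul_pos_left (hk 0 ▸ pow_pos (hS.lapse_pos 0) 2)
    (h.metricB_pos hS 0).le
  exact ⟨√k, Real.sqrt_pos.2 hkpos, fun τ => by rw [Real.sq_sqrt hkpos.le, hk]⟩

theorem exists_metricB_eq : ∃ m > 0, ∀ τ, S.metricB τ = 1 - 2 * m / S.radius τ := by
  obtain ⟨k, hk⟩ := exists_eq_const_mul_of_hasDerivAt_mul_self (h.hasDerivAt_one_sub_metricB hS)
    (fun τ => ((hS.radius_deriv τ).fun_inv (hS.radius_pos τ).ne').congr_deriv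
      (by have := (hS.radius_pos τ).ne'; field_simp : _ = -(γ τ).1 * (S.radius τ)⁻¹))
    fun τ => inv_ne_zero (hS.radius_pos τ).ne'
  have hkpos : 0 < k := pos_of_mul_pos_left (hk 0 ▸ h.one_sub_metricB_pos hS 0)
    (inv_pos.2 (hS.radius_pos 0)).le
  refine ⟨k / 2, half_pos hkpos, fun τ => ?_⟩
  rw [mul_div_cancel₀ k two_ne_zero, div_eq_mul_inv, ← hk, sub_sub_cancel]

theorem continuous_metricB : Continuous S.metricB :=
  continuous_iff_continuousAt.2 fun τ => (h.hasDerivAt_metricB hS τ).continuousAt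

theorem tendsto_metricB_atBot : Tendsto S.metricB atBot (𝓝 0) := by
  simp only [funext (h.metricB_eq hS)]
  have hlim := h.tendsto_PH
  exact (hlim.fst_nhds.div (hlim.fst_nhds.add (hlim.snd_nhds.fst_nhds.const_mul 2))
    (by simp [PH])).trans_eq (by simp [PH])

theorem tendsto_metricB_atTop : Tendsto S.metricB atTop (𝓝 1) := by
  simp only [funext (h.metricB_eq hS)]
  have hlim := h.tendsto_PM
  exact (hlim.fst_nhds.div (hlim.fst_nhds.add (hlim.snd_nhds.fst_nhds.const_mul 2))
    (by simp [PM])).trans_eq (by simp [PM])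

theorem exists_metricB_eq_of_mem_Ioo {b : ℝ} (hb : b ∈ Set.Ioo 0 1) : ∃ τ, S.metricB τ = b :=
  mem_range_of_exists_le_of_exists_ge (h.continuous_metricB hS)
    ((h.tendsto_metricB_atBot hS).eventually_le_const hb.1).exists
    ((h.tendsto_metricB_atTop hS).eventually_const_le hb.2).exists

theorem range_radius_eq {m : ℝ} (hm : 0 < m) (hB : ∀ τ, S.metricB τ = 1 - 2 * m / S.radius τ) :
    Set.range S.radius = Set.Ioi (2 * m) := by
  refine Set.Subset.antisymm ?_ fun r hr => ?_
  · rintro _ ⟨τ, rfl⟩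
    have hpos := h.metricB_pos hS τ
    rw [hB, sub_pos, div_lt_one (hS.radius_pos τ)] at hpos
    exact hpos
  · have hr_pos : 0 < r := (mul_pos two_pos hm).trans hr
    have hratio : 2 * m / r < 1 := (div_lt_one hr_pos).2 hr
    obtain ⟨τ, hτ⟩ := h.exists_metricB_eq_of_mem_Ioo hS (b := 1 - 2 * m / r)
      ⟨sub_pos.2 hratio, sub_lt_self _ (by positivity)⟩
    rw [hB, sub_right_inj, div_eq_mul_inv, div_eq_mul_inv,
      mul_right_inj' (mul_pos two_pos hm).ne', inv_inj] at hτ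
    exact ⟨τ, hτ⟩

theorem isSchwarzschild : S.IsSchwarzschild := by
  obtain ⟨m, hm, hB⟩ := h.exists_metricB_eq hS
  obtain ⟨c, hc, hlapse⟩ := h.exists_lapse_sq_eq hS
  refine ⟨m, hm, c, hc, fun τ => ⟨hB τ, hB τ ▸ hlapse τ⟩, h.range_radius_eq hS hm hB,
    S.scalar 0, fun τ => ?_⟩
  exact is_const_of_deriv_eq_zero (fun τ => (hS.scalar_deriv τ).differentiableAt)
    (fun τ => by rw [(hS.scalar_deriv τ).deriv, h.Y₁_eq_zero, mul_zero]) τ 0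

end IsSchwarzschildCurve

theorem Config.Traces.amplitude_eq_zero {V0 lam : ℝ} {γ : ℝ → Pt} {S : Config}
    (hS : S.Traces V0 lam γ) (hf : IsFinite γ) {τ : ℝ} (hs : surf (γ τ) = 0) : V0 = 0 := by
  have hpot := hS.potential τ
  have hw := sub_pos.2 (hf τ)
  have hr := hS.radius_pos τ
  simpa [hs, expPotential, hw.ne', hr.ne'] using hpot

/-! ### Orbits with a positive potential -/

/-- The points to which the finite orbits with `surf < 0` can tend in the past; their limits in the
future are the opposites of these points. -/
def IsPastLimit (lam : ℝ) (p : Pt) : Prop :=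
  p = PM ∨ p ∈ critCurve ∨ (6 < lam ^ 2 ∧ p = Plam lam)

/-- The component `Y₁ - lam / √2 * X₃` of the charge that is conserved thanks to the scaling
symmetry of the exponential potential. -/
def charge (lam : ℝ) (p : Pt) : ℝ := p.2.2 - lam / √2 * p.2.1

theorem neg_eq_PM_iff {p : Pt} : -p = PM ↔ p = PMbar := by rw [← neg_PM, neg_eq_iff_eq_neg]

theorem neg_eq_PH_iff {p : Pt} : -p = PH ↔ p = PHbar := by rw [← neg_PH, neg_eq_iff_eq_neg]

theorem neg_eq_Plam_iff {lam : ℝ} {p : Pt} : -p = Plam lam ↔ p = PlamBar lam := by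
  rw [← neg_Plam, neg_eq_iff_eq_neg]

theorem isPastLimit_neg_iff {lam : ℝ} {q : Pt} : IsPastLimit lam (-q) ↔
    q = PMbar ∨ q ∈ critCurveBar ∨ (6 < lam ^ 2 ∧ q = PlamBar lam) := by
  rw [IsPastLimit, neg_eq_PM_iff, neg_mem_critCurve_iff, neg_eq_Plam_iff]

theorem IsPastLimit.eq_PH {lam : ℝ} {p : Pt} (hp : IsPastLimit lam p) (hp1 : p.1 ≤ 0) :
    p = PH := by
  rcases hp with rfl | hp | ⟨-, rfl⟩
  · exact absurd hp1 (not_le.2 (by simp only [PM]; positivity))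
  · exact eq_PH_of_mem_critCurve hp (hp1.antisymm (fst_nonneg_of_mem_surfM hp.1))
  · exact absurd hp1 (fst_Plam_pos lam).not_ge

theorem continuous_charge (lam : ℝ) : Continuous (charge lam) := by
  unfold charge
  fun_prop

theorem charge_PM (lam : ℝ) : charge lam PM = 0 := by simp [charge, PM]

theorem charge_PH (lam : ℝ) : charge lam PH = -(lam / √2) := by simp [charge, PH]

theorem charge_PHbar (lam : ℝ) : charge lam PHbar = lam / √2 := by simp [charge, PHbar]

namespace IsFlowLine

variable {lam : ℝ} {γ : ℝ → Pt} (h : IsFlowLine lam γ)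

include h

theorem exists_isPastLimit (hf : IsFinite γ) (hs : ∀ τ, surf (γ τ) < 0) :
    ∃ p, Tendsto γ atBot (𝓝 p) ∧ IsPastLimit lam p := by
  rcases h.exists_tendsto_atBot hf fun τ => (hs τ).le with hlim | hlim | ⟨p, hlim, hp⟩
  · exact ⟨PM, hlim, Or.inl rfl⟩
  · exact absurd hlim (h.not_tendsto_PMbar_atBot hs)
  · exact ⟨p, hlim, Or.inr hp⟩

theorem exists_isPastLimit_neg (hf : IsFinite γ) (hs : ∀ τ, surf (γ τ) < 0) :
    ∃ q, Tendsto γ atTop (𝓝 q) ∧ IsPastLimit lam (-q) := by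
  obtain ⟨p, hlim, hp⟩ := h.neg.exists_isPastLimit hf.neg fun τ => surf_neg (γ (-τ)) ▸ hs (-τ)
  exact ⟨-p, by simpa only [neg_neg] using tendsto_neg_comp_neg_atTop hlim, by rwa [neg_neg]⟩

theorem exists_Y₁_ne_zero (hs : ∀ τ, surf (γ τ) < 0) (hlam : lam ≠ 0) {s t : ℝ} (hst : s < t) :
    ∃ x ∈ Set.Ioo s t, (γ x).2.2 ≠ 0 := by
  by_contra! hzero
  obtain ⟨x, hx⟩ := Set.nonempty_Ioo.2 hst
  have hconst : (fun τ => (γ τ).2.2) =ᶠ[𝓝 x] fun _ => 0 := by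
    filter_upwards [Ioo_mem_nhds hx.1 hx.2] with y hy using hzero y hy
  have hderiv := (h.hasDerivAt_Y₁ x).unique ((hasDerivAt_const x _).congr_of_eventuallyEq hconst)
  rw [hzero x hx, mul_zero, mul_zero, neg_zero, zero_add, sub_zero] at hderiv
  exact mul_ne_zero (div_ne_zero hlam (by positivity)) (hs x).ne hderiv

theorem exists_strictAnti_X₂_mul (hs : ∀ τ, surf (γ τ) < 0) (hlam : lam ≠ 0) :
    ∃ E : ℝ → ℝ, (∀ τ, 0 < E τ) ∧ StrictAnti fun τ => (γ τ).1 * E τ := by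
  have hrate : Continuous fun τ => growth lam (γ τ) - (γ τ).2.1 := by
    have := h.continuous
    have := continuous_growth lam
    fun_prop
  obtain ⟨E, hE, hderiv⟩ := exists_pos_hasDerivAt_mul (f := fun τ => (γ τ).1)
    (k := fun τ => -(γ τ).2.2 ^ 2) hrate fun τ => (h.hasDerivAt_X₂ τ).congr_deriv (by ring)
  refine ⟨E, hE, strictAnti_of_hasDerivAt_nonpos hderiv (fun τ => ?_) fun s t hst => ?_⟩
  · exact mul_nonpos_of_nonpos_of_nonneg (neg_nonpos.2 (sq_nonneg _)) (hE τ).le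
  · obtain ⟨x, hx, hY₁⟩ := h.exists_Y₁_ne_zero hs hlam hst
    exact ⟨x, hx, mul_ne_zero (neg_ne_zero.2 (pow_ne_zero 2 hY₁)) (hE x).ne'⟩

theorem X₂_trichotomy (hs : ∀ τ, surf (γ τ) < 0) (hlam : lam ≠ 0) :
    (∃ τ₀, (γ τ₀).1 = 0 ∧ (∀ τ < τ₀, 0 < (γ τ).1) ∧ ∀ τ > τ₀, (γ τ).1 < 0) ∨
      (∀ τ, 0 < (γ τ).1) ∨ ∀ τ, (γ τ).1 < 0 := by
  by_cases hzero : ∃ τ₀, (γ τ₀).1 = 0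
  · obtain ⟨τ₀, hτ₀⟩ := hzero
    obtain ⟨E, hE, hanti⟩ := h.exists_strictAnti_X₂_mul hs hlam
    refine Or.inl ⟨τ₀, hτ₀, fun τ hτ => (mul_pos_iff_of_pos_right (hE τ)).1 ?_,
      fun τ hτ => neg_of_mul_neg_left ?_ (hE τ).le⟩
    · simpa only [hτ₀, zero_mul] using hanti hτ
    · simpa only [hτ₀, zero_mul] using hanti hτ
  · right
    by_contra! hsign
    obtain ⟨⟨s, hs⟩, t, ht⟩ := hsign
    exact hzero (mem_range_of_exists_le_of_exists_ge h.continuous.fst ⟨s, hs⟩ ⟨t, ht⟩)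

theorem continuous_chargeRate :
    Continuous fun τ => (γ τ).1 + (γ τ).2.1 + growth lam (γ τ) := by
  have := h.continuous
  have := continuous_growth lam
  fun_prop

theorem hasDerivAt_charge (τ : ℝ) : HasDerivAt (fun t => charge lam (γ t))
    (-((γ τ).1 + (γ τ).2.1 + growth lam (γ τ)) * charge lam (γ τ)) τ :=
  ((h.hasDerivAt_Y₁ τ).sub ((h.hasDerivAt_X₃ τ).const_mul (lam / √2))).congr_deriv
    (by rw [charge]; ring)

omit h in
theorem exists_chargeRate_pos (hlim : Tendsto γ atBot (𝓝 PM)) :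
    ∃ T, ∀ t ≤ T, 0 < (γ t).1 + (γ t).2.1 + growth lam (γ t) := by
  have hrate := (hlim.fst_nhds.add hlim.snd_nhds.fst_nhds).add
    (((continuous_growth lam).tendsto PM).comp hlim)
  rw [growth_PM] at hrate
  exact eventually_atBot.1 (hrate.eventually_const_lt (by simp [PM]))

theorem charge_eq_zero_of_tendsto_PM (hlim : Tendsto γ atBot (𝓝 PM)) (τ : ℝ) :
    charge lam (γ τ) = 0 := by
  obtain ⟨T, hT⟩ := exists_chargeRate_pos hlim
  have hcharge : Tendsto (fun t => charge lam (γ t)) atBot (𝓝 0) :=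
    charge_PM lam ▸ ((continuous_charge lam).tendsto PM).comp hlim
  have hle := nonpos_of_tendsto_zero_atBot (T := T) (fun t _ => h.hasDerivAt_charge t)
    (fun t ht hpos => mul_neg_of_neg_of_pos (neg_lt_zero.2 (hT t ht)) hpos) hcharge
  have hge := nonpos_of_tendsto_zero_atBot (T := T) (fun t _ => (h.hasDerivAt_charge t).fun_neg)
    (fun t ht hpos => by
      rw [← mul_neg]
      exact mul_neg_of_neg_of_pos (neg_lt_zero.2 (hT t ht)) hpos)
    (hcharge.neg.trans_eq (by rw [neg_zero]))
  exact eq_zero_of_hasDerivAt_mul_self h.continuous_chargeRate.neg h.hasDerivAt_charge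
    (hle.antisymm (neg_nonpos.1 hge)) τ

theorem exists_strictAnti_X₃_mul (hs : ∀ τ, surf (γ τ) < 0) :
    ∃ E : ℝ → ℝ, (∀ τ, 0 < E τ) ∧ StrictAnti fun τ => (γ τ).2.1 * E τ := by
  obtain ⟨E, hE, hderiv⟩ := exists_pos_hasDerivAt_mul (f := fun τ => (γ τ).2.1)
    (k := fun τ => surf (γ τ)) h.continuous_chargeRate
    fun τ => (h.hasDerivAt_X₃ τ).congr_deriv (by ring)
  exact ⟨E, hE, strictAnti_of_hasDerivAt_neg hderiv fun τ => mul_neg_of_neg_of_pos (hs τ) (hE τ)⟩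

theorem X₃_nonpos_of_tendsto_PM (hs : ∀ τ, surf (γ τ) < 0) (hlim : Tendsto γ atBot (𝓝 PM))
    (τ : ℝ) : (γ τ).2.1 ≤ 0 := by
  obtain ⟨T, hT⟩ := exists_chargeRate_pos hlim
  obtain ⟨E, hE, hanti⟩ := h.exists_strictAnti_X₃_mul hs
  have hpast : (γ (min T τ)).2.1 ≤ 0 :=
    nonpos_of_tendsto_zero_atBot (fun t _ => h.hasDerivAt_X₃ t) (fun t ht hpos => by
      linarith [hs t, mul_pos (hT t (ht.trans (min_le_left T τ))) hpos]) hlim.snd_nhds.fst_nhds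
  refine nonpos_of_mul_nonpos_left ?_ (hE τ)
  exact (hanti.antitone (min_le_right T τ)).trans (mul_nonpos_of_nonpos_of_nonneg hpast (hE _).le)

theorem not_tendsto_PMbar_of_tendsto_PM (hs : ∀ τ, surf (γ τ) < 0)
    (hbot : Tendsto γ atBot (𝓝 PM)) : ¬ Tendsto γ atTop (𝓝 PMbar) := fun htop => by
  have hle := h.X₃_nonpos_of_tendsto_PM hs hbot
  have hge := h.neg.X₃_nonpos_of_tendsto_PM (fun τ => surf_neg (γ (-τ)) ▸ hs (-τ))
    (neg_PMbar ▸ tendsto_neg_comp_neg_atBot htop)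
  have hX₃ (τ : ℝ) : (γ τ).2.1 = 0 := (hle τ).antisymm (by simpa using hge (-τ))
  obtain ⟨E, -, hanti⟩ := h.exists_strictAnti_X₃_mul hs
  simpa only [hX₃, zero_mul, lt_self_iff_false] using hanti one_pos

theorem not_tendsto_PHbar_of_tendsto_PM (hlam : lam ≠ 0) (hbot : Tendsto γ atBot (𝓝 PM)) :
    ¬ Tendsto γ atTop (𝓝 PHbar) := fun htop => by
  have hcharge := ((continuous_charge lam).tendsto PHbar).comp htop
  simp only [Function.comp_def, h.charge_eq_zero_of_tendsto_PM hbot, charge_PHbar] at hcharge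
  exact div_ne_zero hlam (by positivity) (tendsto_nhds_unique hcharge tendsto_const_nhds)

theorem not_tendsto_PHbar_of_tendsto_PH (hlam : lam ≠ 0) (hbot : Tendsto γ atBot (𝓝 PH)) :
    ¬ Tendsto γ atTop (𝓝 PHbar) := fun htop => by
  -- The sign of the charge is constant, but its limits at the two ends have opposite signs.
  have hsq : 0 < lam / √2 * (lam / √2) :=
    mul_self_pos.2 (div_ne_zero hlam (by positivity))
  have hpast := (((continuous_charge lam).tendsto PH).comp hbot).const_mul (lam / √2)
  have hfuture := (((continuous_charge lam).tendsto PHbar).comp htop).const_mul (lam / √2)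
  rw [charge_PH] at hpast
  rw [charge_PHbar] at hfuture
  obtain ⟨s, hs⟩ := (hpast.eventually_lt_const (u := 0) (by linarith)).exists
  obtain ⟨t, ht⟩ := (hfuture.eventually_const_lt hsq).exists
  exact hs.not_gt (pos_of_hasDerivAt_mul_self h.continuous_chargeRate.neg
    (fun τ => ((h.hasDerivAt_charge τ).const_mul (lam / √2)).congr_deriv (mul_left_comm _ _ _))
    ht s)

theorem not_tendsto_regular (hs : ∀ τ, surf (γ τ) < 0) (hlam : lam ≠ 0) {p q : Pt}
    (hp : Tendsto γ atBot (𝓝 p)) (hq : Tendsto γ atTop (𝓝 q)) :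
    ¬ ((p = PM ∨ p = PH) ∧ (q = PMbar ∨ q = PHbar)) := by
  rintro ⟨rfl | rfl, rfl | rfl⟩
  · exact h.not_tendsto_PMbar_of_tendsto_PM hs hp hq
  · exact h.not_tendsto_PHbar_of_tendsto_PM hlam hp hq
  · exact h.neg.not_tendsto_PHbar_of_tendsto_PM hlam (neg_PMbar ▸ tendsto_neg_comp_neg_atBot hq)
      (neg_PH ▸ tendsto_neg_comp_neg_atTop hp)
  · exact h.not_tendsto_PHbar_of_tendsto_PH hlam hp hq

end IsFlowLine

theorem eq_PHbar_of_X₂_pos {lam : ℝ} {γ : ℝ → Pt} {q : Pt} (hX₂ : ∀ τ, 0 < (γ τ).1)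
    (hlim : Tendsto γ atTop (𝓝 q)) (hq : IsPastLimit lam (-q)) : q = PHbar :=
  neg_eq_PH_iff.1 <| hq.eq_PH <| neg_nonpos.2 <|
    ge_of_tendsto' hlim.fst_nhds fun τ => (hX₂ τ).le

theorem eq_PH_of_X₂_neg {lam : ℝ} {γ : ℝ → Pt} {p : Pt} (hX₂ : ∀ τ, (γ τ).1 < 0)
    (hlim : Tendsto γ atBot (𝓝 p)) (hp : IsPastLimit lam p) : p = PH :=
  hp.eq_PH <| le_of_tendsto' hlim.fst_nhds fun τ => (hX₂ τ).le

namespace Config.Traces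

variable {S : Config} {V0 lam : ℝ} {γ : ℝ → Pt} (hS : S.Traces V0 lam γ)

include hS

theorem rev : S.rev.Traces V0 lam fun τ => -γ (-τ) where
  radius_pos τ := hS.radius_pos (-τ)
  lapse_pos τ := hS.lapse_pos (-τ)
  radius_deriv τ := (hasDerivAt_comp_neg (hS.radius_deriv (-τ))).congr_deriv (neg_mul _ _).symm
  lapse_deriv τ := (hasDerivAt_comp_neg (hS.lapse_deriv (-τ))).congr_deriv (neg_mul _ _).symm
  scalar_deriv τ := (hasDerivAt_comp_neg (hS.scalar_deriv (-τ))).congr_deriv (mul_neg _ _).symm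
  density_eq τ := by
    rw [normSq_neg]
    exact hS.density_eq (-τ)
  potential τ := by
    rw [normSq_neg, surf_neg]
    exact hS.potential (-τ)

theorem continuous_radius : Continuous S.radius :=
  continuous_iff_continuousAt.2 fun τ => (hS.radius_deriv τ).continuousAt

section Horizon

theorem strictMono_radius (hX₂ : ∀ τ, 0 < (γ τ).1) : StrictMono S.radius :=
  strictMono_of_hasDerivAt_pos hS.radius_deriv fun τ => mul_pos (hX₂ τ) (hS.radius_pos τ)

theorem exists_antitoneOn_radius_mul_exp (hγ : IsFlowLine lam γ) (hX₂ : ∀ τ, 0 < (γ τ).1)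
    (hlim : Tendsto γ atTop (𝓝 PHbar)) :
    ∃ T, AntitoneOn (fun τ => S.radius τ * Real.exp (γ τ).1) (Set.Ici T) := by
  have hrate := hlim.snd_nhds.fst_nhds.sub (((continuous_growth lam).tendsto PHbar).comp hlim)
  rw [← neg_PH, growth_neg, growth_PH] at hrate
  obtain ⟨T, hT⟩ := eventually_atTop.1 (hrate.eventually_lt_const (u := -1) (by simp [PH]))
  refine ⟨T, antitoneOn_Ici_of_hasDerivAt_nonpos
    (fun t _ => (hS.radius_deriv t).fun_mul (hγ.hasDerivAt_X₂ t).exp) fun t ht => ?_⟩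
  have hle : (γ t).1 + ((γ t).1 * (γ t).2.1 - (γ t).2.2 ^ 2 - growth lam (γ t) * (γ t).1) ≤ 0 := by
    have hrate_t : (γ t).2.1 - growth lam (γ t) < -1 := hT t ht
    linarith [sq_nonneg (γ t).2.2, mul_lt_mul_of_pos_left hrate_t (hX₂ t)]
  have hpos := mul_pos (hS.radius_pos t) (Real.exp_pos (γ t).1)
  nlinarith

theorem exists_tendsto_radius (hγ : IsFlowLine lam γ) (hX₂ : ∀ τ, 0 < (γ τ).1)
    (hlim : Tendsto γ atTop (𝓝 PHbar)) : ∃ rH > 0, Tendsto S.radius atTop (𝓝 rH) := by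
  obtain ⟨T, hanti⟩ := hS.exists_antitoneOn_radius_mul_exp hγ hX₂ hlim
  have hmono := (hS.strictMono_radius hX₂).monotone
  have hbdd : BddAbove (Set.range S.radius) := by
    refine ⟨S.radius T * Real.exp (γ T).1, Set.forall_mem_range.2 fun t => ?_⟩
    calc S.radius t ≤ S.radius (max t T) := hmono (le_max_left t T)
      _ ≤ S.radius (max t T) * Real.exp (γ (max t T)).1 :=
        le_mul_of_one_le_right (hS.radius_pos _).le (Real.one_le_exp (hX₂ _).le)
      _ ≤ S.radius T * Real.exp (γ T).1 :=
        hanti Set.self_mem_Ici (le_max_right t T) (le_max_right t T)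
  exact ⟨_, (hS.radius_pos 0).trans_le (le_ciSup hbdd 0), tendsto_atTop_ciSup hmono hbdd⟩

theorem tendsto_lapse_zero (hlim : Tendsto γ atBot (𝓝 PH)) : Tendsto S.lapse atBot (𝓝 0) :=
  tendsto_zero_of_hasDerivAt_mul_self one_pos hS.lapse_pos hS.lapse_deriv hlim.snd_nhds.fst_nhds

theorem horizon_atTop (hγ : IsFlowLine lam γ) (hX₂ : ∀ τ, 0 < (γ τ).1)
    (hlim : Tendsto γ atTop (𝓝 PHbar)) :
    StrictMono S.radius ∧ (∃ rH > 0, Tendsto S.radius atTop (𝓝 rH)) ∧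
      Tendsto S.lapse atTop (𝓝 0) :=
  ⟨hS.strictMono_radius hX₂, hS.exists_tendsto_radius hγ hX₂ hlim,
    tendsto_atTop_of_tendsto_comp_neg
      (hS.rev.tendsto_lapse_zero (neg_PHbar ▸ tendsto_neg_comp_neg_atBot hlim))⟩

theorem horizon_atBot (hγ : IsFlowLine lam γ) (hX₂ : ∀ τ, (γ τ).1 < 0)
    (hlim : Tendsto γ atBot (𝓝 PH)) :
    StrictAnti S.radius ∧ (∃ rH > 0, Tendsto S.radius atBot (𝓝 rH)) ∧
      Tendsto S.lapse atBot (𝓝 0) := by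
  obtain ⟨rH, hrH, hradius⟩ := hS.rev.exists_tendsto_radius hγ.neg
    (fun τ => neg_pos.2 (hX₂ (-τ))) (neg_PH ▸ tendsto_neg_comp_neg_atTop hlim)
  refine ⟨strictAnti_of_hasDerivAt_neg hS.radius_deriv fun τ =>
    mul_neg_of_neg_of_pos (hX₂ τ) (hS.radius_pos τ), ⟨rH, hrH, ?_⟩, hS.tendsto_lapse_zero hlim⟩
  simpa only [radius_rev, Function.comp_def, neg_neg] using hradius.comp tendsto_neg_atBot_atTop

end Horizon

section MaximumRadius

variable {τ₀ : ℝ}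

theorem radius_lt (hpast : ∀ τ < τ₀, 0 < (γ τ).1) (hfuture : ∀ τ > τ₀, (γ τ).1 < 0) {τ : ℝ}
    (hτ : τ ≠ τ₀) : S.radius τ < S.radius τ₀ := by
  rcases hτ.lt_or_gt with hlt | hgt
  · refine strictMonoOn_of_hasDerivWithinAt_pos (convex_Iic τ₀) hS.continuous_radius.continuousOn
      (fun t _ => (hS.radius_deriv t).hasDerivWithinAt) (fun t ht => ?_) hlt.le Set.self_mem_Iic hlt
    rw [interior_Iic] at ht
    exact mul_pos (hpast t ht) (hS.radius_pos t)
  · refine strictAntiOn_of_hasDerivWithinAt_neg (convex_Ici τ₀) hS.continuous_radius.continuousOn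
      (fun t _ => (hS.radius_deriv t).hasDerivWithinAt) (fun t ht => ?_) Set.self_mem_Ici hgt.le hgt
    rw [interior_Ici] at ht
    exact mul_neg_of_neg_of_pos (hfuture t ht) (hS.radius_pos t)

theorem x2_eq_zero (hX₂ : (γ τ₀).1 = 0) : S.x2 τ₀ = 0 := by rw [hS.x2_eq, hX₂, zero_div]

end MaximumRadius

end Config.Traces

namespace Config.IsSolution

variable {S : Config} {V : ℝ → ℝ} (hS : S.IsSolution V) {τ₀ : ℝ} (hx2 : S.x2 τ₀ = 0)

include hS hx2

theorem hasDerivAt_x2_of_eq_zero :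
    HasDerivAt S.x2 (S.density τ₀ / S.radius τ₀ * -S.y1 τ₀ ^ 2) τ₀ :=
  (hS.hasDerivAt_x2 τ₀).congr_deriv (by rw [hx2, zero_mul, zero_sub])

theorem normDeriv_x2_of_eq_zero : S.normDeriv S.x2 τ₀ = -S.y1 τ₀ ^ 2 := by
  have hr := hS.radius_pos τ₀
  have hd := hS.density_pos τ₀
  rw [normDeriv, hat_eq_of_hasDerivAt (hS.hasDerivAt_x2_of_eq_zero hx2), sqrt_gaussK hr]
  field_simp

theorem not_flareOut : ¬ S.FlareOut τ₀ := fun hflare => by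
  have hr := hS.radius_pos τ₀
  have hd := hS.density_pos τ₀
  have hhat : S.hat S.radius = S.x2 := funext fun t => (x2_eq_hat_radius (hS.radius_pos t)).symm
  have hderiv := hS.hasDerivAt_x2_of_eq_zero hx2
  have hdiv : HasDerivAt (fun t => S.x2 t / √(1 - S.x2 t ^ 2))
      (S.density τ₀ / S.radius τ₀ * -S.y1 τ₀ ^ 2) τ₀ :=
    (hderiv.fun_div (((hderiv.fun_pow 2).const_sub 1).sqrt (by simp [hx2]))
      (by simp [hx2])).congr_deriv (by simp [hx2])
  have hpos := hflare.2
  rw [hhat, hat_eq_of_hasDerivAt hdiv, hx2] at hpos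
  refine hpos.not_ge (div_nonpos_of_nonpos_of_nonneg (div_nonpos_of_nonpos_of_nonneg ?_ hd.le)
    (Real.sqrt_nonneg _))
  exact mul_nonpos_of_nonneg_of_nonpos (div_pos hd hr).le (neg_nonpos.2 (sq_nonneg _))

end Config.IsSolution

namespace Config.Traces

variable {S : Config} {V0 lam : ℝ} {γ : ℝ → Pt} (hS : S.Traces V0 lam γ)

include hS

theorem maximum_radius (hγ : IsFlowLine lam γ) (hf : IsFinite γ) {τ₀ : ℝ} (hX₂ : (γ τ₀).1 = 0)
    (hpast : ∀ τ < τ₀, 0 < (γ τ).1) (hfuture : ∀ τ > τ₀, (γ τ).1 < 0) :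
    (∀ τ, τ ≠ τ₀ → S.radius τ < S.radius τ₀) ∧ S.x2 τ₀ = 0 ∧
      S.normDeriv S.x2 τ₀ = -S.y1 τ₀ ^ 2 ∧ ¬ S.FlareOut τ₀ :=
  have hsol := hS.isSolution hγ hf
  have hx2 := hS.x2_eq_zero hX₂
  ⟨fun _ hτ => hS.radius_lt hpast hfuture hτ, hx2, hsol.normDeriv_x2_of_eq_zero hx2,
    hsol.not_flareOut hx2⟩

theorem eq_PM_or_eq_PH_or_nakedSingularity_atBot (hγ : IsFlowLine lam γ) (hf : IsFinite γ) {p : Pt}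
    (hlim : Tendsto γ atBot (𝓝 p)) (hp : IsPastLimit lam p) :
    p = PM ∨ p = PH ∨ S.NakedSingularity atBot := by
  rcases hp with hp | hp | ⟨hlam, rfl⟩
  · exact Or.inl hp
  · exact Or.inr (or_iff_not_imp_left.2 (hS.nakedSingularity_of_mem_critCurve hγ hf hlim hp))
  · exact Or.inr (Or.inr (hS.nakedSingularity_of_tendsto_Plam hγ hf hlim hlam))

theorem eq_PMbar_or_eq_PHbar_or_nakedSingularity_atTop (hγ : IsFlowLine lam γ) (hf : IsFinite γ)
    {q : Pt} (hlim : Tendsto γ atTop (𝓝 q)) (hq : IsPastLimit lam (-q)) :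
    q = PMbar ∨ q = PHbar ∨ S.NakedSingularity atTop := by
  have hrev := hS.rev.eq_PM_or_eq_PH_or_nakedSingularity_atBot hγ.neg hf.neg
    (tendsto_neg_comp_neg_atBot hlim) hq
  rw [neg_eq_PM_iff, neg_eq_PH_iff] at hrev
  exact hrev.imp_right (Or.imp_right NakedSingularity.of_rev)

end Config.Traces

/-! ### The anti-de Sitter points -/

theorem neg_PAdS : -PAdS = PAdSbar := by simp only [PAdS, PAdSbar, Prod.neg_mk, neg_zero]

theorem surf_PAdS : surf PAdS = 3 / 2 := by
  simp only [surf, PAdS]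
  linarith [inv_sqrt_two_sq]

theorem field_PAdS_ne_zero {lam : ℝ} (hlam : lam ≠ 0) : field lam PAdS ≠ 0 := fun h => by
  have hY₁ := congrArg (fun p : Pt => p.2.2) h
  simp only [field_snd_snd, surf_PAdS] at hY₁
  simp [PAdS, hlam] at hY₁

theorem field_PAdSbar_ne_zero {lam : ℝ} (hlam : lam ≠ 0) : field lam PAdSbar ≠ 0 := by
  rw [← neg_PAdS, field_neg]
  exact field_PAdS_ne_zero hlam

namespace Config

variable {S : Config} {l : Filter ℝ}

namespace AsymptoticallyAdS

section

variable (hr : ∀ τ, 0 < S.radius τ) (h : S.AsymptoticallyAdS l)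

include hr h

theorem exists_tendsto_x2_sq_div_radius_sq :
    ∃ k > 0, Tendsto (fun τ => S.x2 τ ^ 2 / S.radius τ ^ 2) l (𝓝 k) := by
  obtain ⟨L, hL, hB⟩ := h.2.1
  exact ⟨1 / L ^ 2, by positivity, hB.congr fun τ => by rw [x2_eq_hat_radius (hr τ), metricB]⟩

theorem tendsto_x2_sq : Tendsto (fun τ => S.x2 τ ^ 2) l atTop := by
  obtain ⟨k, hk, hlim⟩ := h.exists_tendsto_x2_sq_div_radius_sq hr
  exact (hlim.pos_mul_atTop hk ((tendsto_pow_atTop two_ne_zero).comp h.1)).congr fun τ =>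
    div_mul_cancel₀ _ (pow_ne_zero 2 (hr τ).ne')

theorem eventually_x2_ne_zero : ∀ᶠ τ in l, S.x2 τ ≠ 0 :=
  ((h.tendsto_x2_sq hr).eventually_gt_atTop 0).mono fun _ hτ => sq_pos_iff.1 hτ

theorem tendsto_x3_div_x2 : Tendsto (fun τ => S.x3 τ / S.x2 τ) l (𝓝 1) := by
  refine ((h.2.2.div_const 2).congr fun τ => ?_).trans_eq (by norm_num)
  rw [x3_eq_radius_mul_accel (hr τ), x2_eq_hat_radius (hr τ), div_div_eq_mul_div]
  ring

end

theorem rev (h : S.AsymptoticallyAdS atBot) : S.rev.AsymptoticallyAdS atTop := by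
  obtain ⟨hr, ⟨L, hL, hB⟩, hA⟩ := h
  refine ⟨hr.comp tendsto_neg_atTop_atBot, ⟨L, hL, ?_⟩, ?_⟩
  · refine (hB.comp tendsto_neg_atTop_atBot).congr fun τ => ?_
    rw [Function.comp_apply, metricB_rev, radius_rev]
  · refine (hA.comp tendsto_neg_atTop_atBot).congr fun τ => ?_
    simp only [Function.comp_apply, accel_rev, radius_rev, hat_rev]
    rw [mul_neg, neg_div (S.radius (-τ)), neg_div_neg_eq]

end AsymptoticallyAdS

namespace IsSolution

theorem exists_charge_eq {V0 lam : ℝ} (h : S.IsSolution (expPotential V0 lam)) :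
    ∃ c, ∀ τ, (S.y1 τ - lam / √2 * S.x3 τ) * (S.radius τ * S.lapse τ) = c := by
  have hderiv (τ : ℝ) : HasDerivAt
      (fun τ => (S.y1 τ - lam / √2 * S.x3 τ) * (S.radius τ * S.lapse τ)) 0 τ := by
    have hy1 := h.hasDerivAt_y1 τ
    rw [deriv_expPotential] at hy1
    exact ((hy1.fun_sub ((h.hasDerivAt_x3 τ).const_mul (lam / √2))).fun_mul
      ((h.hasDerivAt_radius τ).fun_mul (h.hasDerivAt_lapse τ))).congr_deriv (by ring)
  exact ⟨_, fun τ => is_const_of_deriv_eq_zero (fun t => (hderiv t).differentiableAt)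
    (fun t => (hderiv t).deriv) τ 0⟩

section

variable {V : ℝ → ℝ} (h : S.IsSolution V)

include h

theorem eventually_x2_pos (hr : Tendsto S.radius atTop atTop)
    (hx2 : ∀ᶠ τ in atTop, S.x2 τ ≠ 0) : ∀ᶠ τ in atTop, 0 < S.x2 τ := by
  obtain ⟨T, hT⟩ := eventually_atTop.1 hx2
  have hcont : Continuous S.x2 :=
    continuous_iff_continuousAt.2 fun τ => (h.hasDerivAt_x2 τ).continuousAt
  filter_upwards [eventually_ge_atTop T] with s hs
  by_contra! hneg
  -- If `x2 ≤ 0` at `s`, then `x2` stays negative and `r` cannot grow beyond `r s`.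
  have hx2_nonpos : ∀ t ≥ s, S.x2 t ≤ 0 := fun t ht => by
    by_contra! hpos
    obtain ⟨x, hx, hx0⟩ := intermediate_value_Icc ht hcont.continuousOn ⟨hneg, hpos.le⟩
    exact hT x (hs.trans hx.1) hx0
  have hanti := antitoneOn_Ici_of_hasDerivAt_nonpos (T := s) (fun t _ => h.hasDerivAt_radius t)
    fun t ht => mul_nonpos_of_nonpos_of_nonneg (mul_nonpos_of_nonneg_of_nonpos
      (div_pos (h.density_pos t) (h.radius_pos t)).le (hx2_nonpos t ht)) (h.radius_pos t).le
  obtain ⟨t, hlt, hst⟩ := ((hr.eventually_gt_atTop (S.radius s)).and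
    (eventually_ge_atTop s)).exists
  exact (hanti Set.self_mem_Ici hst hst).not_gt hlt

variable (hA : S.AsymptoticallyAdS atTop)

include hA

theorem eventually_x2_pos_of_asymptoticallyAdS : ∀ᶠ τ in atTop, 0 < S.x2 τ :=
  h.eventually_x2_pos hA.1 (hA.eventually_x2_ne_zero h.radius_pos)

theorem exists_le_radius_mul_lapse : ∃ c > 0, ∀ᶠ τ in atTop, c ≤ S.radius τ * S.lapse τ := by
  obtain ⟨T, hT⟩ := eventually_atTop.1 ((h.eventually_x2_pos_of_asymptoticallyAdS hA).and
    ((hA.tendsto_x3_div_x2 h.radius_pos).eventually_const_lt zero_lt_one))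
  have hanti := antitoneOn_Ici_of_hasDerivAt_nonpos (T := T)
    (fun t _ => ((h.hasDerivAt_radius t).fun_mul (h.hasDerivAt_lapse t)).fun_neg) fun t ht => by
      have hradius := h.radius_pos t
      have hdensity := h.density_pos t
      have hlapse := h.lapse_pos t
      have hx2 := (hT t ht).1
      have hx3 := (div_pos_iff_of_pos_right hx2).1 (hT t ht).2
      exact neg_nonpos.2 (by positivity)
  refine ⟨S.radius T * S.lapse T, mul_pos (h.radius_pos T) (h.lapse_pos T), ?_⟩
  filter_upwards [eventually_ge_atTop T] with t ht
  exact neg_le_neg_iff.1 (hanti Set.self_mem_Ici ht ht)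

end

variable {V0 lam : ℝ} (h : S.IsSolution (expPotential V0 lam)) (hA : S.AsymptoticallyAdS atTop)

include h hA

theorem tendsto_charge_div_x2 :
    Tendsto (fun τ => (S.y1 τ - lam / √2 * S.x3 τ) / S.x2 τ) atTop (𝓝 0) := by
  obtain ⟨c, hc⟩ := h.exists_charge_eq
  obtain ⟨a, ha, hle⟩ := h.exists_le_radius_mul_lapse hA
  refine tendsto_zero_of_sq <| squeeze_zero' (.of_forall fun τ => sq_nonneg _) ?_
    ((hA.tendsto_x2_sq h.radius_pos).const_div_atTop ((c / a) ^ 2))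
  filter_upwards [hle] with t ht
  rw [div_pow, div_pow, ← hc t, mul_pow]
  gcongr
  rw [le_div_iff₀ (pow_pos ha 2)]
  gcongr

theorem tendsto_y1_div_x2 : Tendsto (fun τ => S.y1 τ / S.x2 τ) atTop (𝓝 (lam / √2)) :=
  (((h.tendsto_charge_div_x2 hA).add
    ((hA.tendsto_x3_div_x2 h.radius_pos).const_mul (lam / √2))).congr fun τ => by ring).trans_eq
    (by rw [zero_add, mul_one])

theorem exists_antitoneOn_log_x2_sub {κ : ℝ} (hκ : 1 - (lam / √2) ^ 2 < κ) :
    ∃ T, AntitoneOn (fun τ => Real.log (S.x2 τ) - κ * Real.log (S.radius τ)) (Set.Ici T) := by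
  have hrate := ((hA.tendsto_x3_div_x2 h.radius_pos).sub
    ((h.tendsto_y1_div_x2 hA).pow 2)).eventually_lt_const hκ
  obtain ⟨T, hT⟩ :=
    eventually_atTop.1 ((h.eventually_x2_pos_of_asymptoticallyAdS hA).and hrate)
  have hderiv : ∀ t ≥ T, HasDerivAt
      (fun τ => Real.log (S.x2 τ) - κ * Real.log (S.radius τ)) (S.density t / S.radius t *
        S.x2 t * (S.x3 t / S.x2 t - (S.y1 t / S.x2 t) ^ 2 - κ)) t := fun t ht => by
    have hx2 := (hT t ht).1.ne'
    have hradius := (h.radius_pos t).ne'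
    refine (((h.hasDerivAt_x2 t).log hx2).fun_sub
      (((h.hasDerivAt_radius t).log hradius).const_mul κ)).congr_deriv ?_
    field_simp
  refine ⟨T, antitoneOn_Ici_of_hasDerivAt_nonpos hderiv fun t ht => ?_⟩
  exact mul_nonpos_of_nonneg_of_nonpos
    (mul_pos (div_pos (h.density_pos t) (h.radius_pos t)) (hT t ht).1).le
    (sub_neg.2 (hT t ht).2).le

theorem tendsto_log_x2_sub_atTop {κ : ℝ} (hκ : κ < 1) :
    Tendsto (fun τ => Real.log (S.x2 τ) - κ * Real.log (S.radius τ)) atTop atTop := by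
  obtain ⟨k, hk, hlim⟩ := hA.exists_tendsto_x2_sq_div_radius_sq h.radius_pos
  have hsum := ((hlim.log hk.ne').const_mul (1 / 2)).add_atTop
    ((Real.tendsto_log_atTop.comp hA.1).const_mul_atTop (sub_pos.2 hκ))
  refine hsum.congr' ?_
  filter_upwards [h.eventually_x2_pos_of_asymptoticallyAdS hA] with t hx2
  rw [Function.comp_apply, ← div_pow, Real.log_pow, Real.log_div hx2.ne' (h.radius_pos t).ne']
  push_cast
  ring

omit hA in
theorem not_asymptoticallyAdS_atTop (hlam : lam ≠ 0) : ¬ S.AsymptoticallyAdS atTop := fun hA => by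
  have hpos : 0 < (lam / √2) ^ 2 := sq_pos_of_ne_zero (div_ne_zero hlam (by positivity))
  obtain ⟨κ, hκ, hκ'⟩ := exists_between (show 1 - (lam / √2) ^ 2 < 1 by linarith)
  obtain ⟨T, hanti⟩ := h.exists_antitoneOn_log_x2_sub hA hκ
  obtain ⟨t, hlt, hTt⟩ := (((h.tendsto_log_x2_sub_atTop hA hκ').eventually_gt_atTop _).and
    (eventually_ge_atTop T)).exists
  exact (hanti Set.self_mem_Ici hTt hTt).not_gt hlt

omit hA in
theorem not_asymptoticallyAdS_atBot (hlam : lam ≠ 0) : ¬ S.AsymptoticallyAdS atBot := fun hA =>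
  h.rev.not_asymptoticallyAdS_atTop hlam hA.rev

end IsSolution

end Config

/-! ### Solutions and their orbits -/

namespace Config

section Existence

variable {lam : ℝ} {γ : ℝ → Pt} (hγ : IsFlowLine lam γ) (hf : IsFinite γ)

include hγ hf

theorem exists_realizes_zero (hs : ∀ τ, surf (γ τ) = 0) : ∃ S : Config, S.Realizes 0 lam γ :=
  (exists_traces hγ hf (Or.inl ⟨rfl, hs⟩)).imp fun _ hS => hS.realizes hγ hf

theorem exists_realizes_of_pos (hs : ∀ τ, surf (γ τ) < 0) {V0 : ℝ} (hV : 0 < V0) :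
    ∃ S : Config, S.Realizes V0 lam γ :=
  (exists_traces hγ hf (Or.inr ⟨hV, hs⟩)).imp fun _ hS => hS.realizes hγ hf

end Existence

namespace Realizes

variable {S : Config} {V0 lam : ℝ} {γ : ℝ → Pt} (h : S.Realizes V0 lam γ)

include h

theorem surf_eq_zero (hV : V0 = 0) (τ : ℝ) : surf (γ τ) = 0 := by
  simpa [expPotential, hV] using h.traces.potential τ

theorem surf_neg (hV : 0 < V0) (τ : ℝ) : surf (γ τ) < 0 := by
  rw [← neg_pos, ← h.traces.potential τ]
  exact mul_pos (mul_pos (mul_pos hV (Real.exp_pos _)) (pow_pos (h.1.radius_pos τ) 2))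
    (sub_pos.2 (h.isFinite τ))

theorem isOrbit (hV : 0 ≤ V0) : IsOrbit lam γ :=
  ⟨h.isFlowLine, fun τ => ⟨hV.eq_or_lt.elim (fun h0 => (h.surf_eq_zero h0.symm τ).le)
    fun hpos => (h.surf_neg hpos τ).le, (h.isFinite τ).le⟩⟩

theorem isSchwarzschild_of_tendsto (hγ : IsOrbit lam γ) (hbot : Tendsto γ atBot (𝓝 PH))
    (htop : Tendsto γ atTop (𝓝 PM)) : V0 = 0 ∧ S.IsSchwarzschild :=
  have hcurve := isSchwarzschildCurve_of_tendsto hγ hbot htop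
  ⟨h.traces.amplitude_eq_zero h.isFinite (hcurve.surf_eq_zero 0), hcurve.isSchwarzschild h.traces⟩

theorem isSchwarzschild_of_tendsto_or_tendsto (hγ : IsOrbit lam γ)
    (hlim : (Tendsto γ atBot (𝓝 PH) ∧ Tendsto γ atTop (𝓝 PM)) ∨
      (Tendsto γ atBot (𝓝 PMbar) ∧ Tendsto γ atTop (𝓝 PHbar))) : V0 = 0 ∧ S.IsSchwarzschild := by
  rcases hlim with ⟨hbot, htop⟩ | ⟨hbot, htop⟩
  · exact h.isSchwarzschild_of_tendsto hγ hbot htop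
  · exact (h.rev.isSchwarzschild_of_tendsto hγ.neg (neg_PHbar ▸ tendsto_neg_comp_neg_atBot htop)
      (neg_PMbar ▸ tendsto_neg_comp_neg_atTop hbot)).imp_right IsSchwarzschild.of_rev

theorem nakedSingularity_atBot {p : Pt} (hp : p ∈ critCurve) (hlim : Tendsto γ atBot (𝓝 p))
    (hne : p ≠ PH) : S.NakedSingularity atBot :=
  h.traces.nakedSingularity_of_mem_critCurve h.isFlowLine h.isFinite hlim hp hne

theorem nakedSingularity_atTop {q : Pt} (hq : q ∈ critCurveBar) (hlim : Tendsto γ atTop (𝓝 q))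
    (hne : q ≠ PHbar) : S.NakedSingularity atTop :=
  (h.rev.nakedSingularity_atBot ((neg_mem_critCurve_iff q).2 hq) (tendsto_neg_comp_neg_atBot hlim)
    (neg_eq_PH_iff.not.2 hne)).of_rev

theorem isSchwarzschild_or_nakedSingularity_of_mem_surfM (hM : ∀ τ, γ τ ∈ surfM)
    (hne : ∃ τ, γ τ ≠ PM) : S.IsSchwarzschild ∨ S.NakedSingularity atBot := by
  have hf := h.isFinite
  have hγ : IsOrbit lam γ :=
    ⟨h.isFlowLine, fun τ => ⟨((mem_surfM_iff _).1 (hM τ)).1.le, (hf τ).le⟩⟩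
  obtain ⟨p, hp, hlim⟩ := hγ.1.exists_tendsto_critCurve_atBot hf hM hne
  by_cases hPH : p = PH
  · exact Or.inl (h.isSchwarzschild_of_tendsto hγ (hPH ▸ hlim) (hγ.1.tendsto_PM_atTop hf hM)).2
  · exact Or.inr (h.nakedSingularity_atBot hp hlim hPH)

theorem isSchwarzschild_or_nakedSingularity_of_surf_eq_zero (hs : ∀ τ, surf (γ τ) = 0)
    (hne : ∀ τ, γ τ ≠ PM ∧ γ τ ≠ PMbar) :
    S.IsSchwarzschild ∨ S.NakedSingularity atBot ∨ S.NakedSingularity atTop := by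
  rcases h.isFlowLine.mem_surfM_or_mem_surfMbar (fun τ => (h.isFinite τ).le) hs with hM | hM
  · exact (h.isSchwarzschild_or_nakedSingularity_of_mem_surfM hM ⟨0, (hne 0).1⟩).imp_right Or.inl
  · exact (h.rev.isSchwarzschild_or_nakedSingularity_of_mem_surfM
      (fun τ => (neg_mem_surfM_iff _).2 (hM (-τ)))
      ⟨0, neg_eq_PM_iff.not.2 (hne (-0)).2⟩).imp IsSchwarzschild.of_rev
        fun hrev => Or.inr hrev.of_rev

theorem regular_or_nakedSingularity {p q : Pt} (hlimp : Tendsto γ atBot (𝓝 p))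
    (hp : IsPastLimit lam p) (hlimq : Tendsto γ atTop (𝓝 q)) (hq : IsPastLimit lam (-q)) :
    (p = PM ∨ p = PH ∨ S.NakedSingularity atBot) ∧
      (q = PMbar ∨ q = PHbar ∨ S.NakedSingularity atTop) :=
  ⟨h.traces.eq_PM_or_eq_PH_or_nakedSingularity_atBot h.isFlowLine h.isFinite hlimp hp,
    h.traces.eq_PMbar_or_eq_PHbar_or_nakedSingularity_atTop h.isFlowLine h.isFinite hlimq hq⟩

theorem nakedSingularity_atBot_or_atTop (hlam : lam ≠ 0) (hs : ∀ τ, surf (γ τ) < 0) :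
    S.NakedSingularity atBot ∨ S.NakedSingularity atTop := by
  have hγ := h.isFlowLine
  obtain ⟨p, hlimp, hp⟩ := hγ.exists_isPastLimit h.isFinite hs
  obtain ⟨q, hlimq, hq⟩ := hγ.exists_isPastLimit_neg h.isFinite hs
  have hends := h.regular_or_nakedSingularity hlimp hp hlimq hq
  have hregular := hγ.not_tendsto_regular hs hlam hlimp hlimq
  tauto

theorem isSchwarzschild_or_nakedSingularity (hlam : lam ≠ 0) (hV : 0 ≤ V0)
    (hne : ∀ τ, γ τ ≠ PM ∧ γ τ ≠ PMbar) :
    S.IsSchwarzschild ∨ S.NakedSingularity atBot ∨ S.NakedSingularity atTop :=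
  hV.eq_or_lt.elim
    (fun h0 => h.isSchwarzschild_or_nakedSingularity_of_surf_eq_zero (h.surf_eq_zero h0.symm) hne)
    fun hpos => Or.inr (h.nakedSingularity_atBot_or_atTop hlam (h.surf_neg hpos))

end Realizes

end Config

theorem exists_orbit_PH_PM_unique (lam : ℝ) :
    ∃ γ : ℝ → Pt, (IsOrbit lam γ ∧ Tendsto γ atBot (𝓝 PH) ∧ Tendsto γ atTop (𝓝 PM)) ∧
      (∀ τ, γ τ ∈ surfM) ∧ IsFinite γ ∧
      (∀ δ : ℝ → Pt, IsOrbit lam δ → Tendsto δ atBot (𝓝 PH) → Tendsto δ atTop (𝓝 PM) →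
        ∃ c : ℝ, ∀ τ, δ τ = γ (τ + c)) := by
  obtain ⟨γ, hγ⟩ := exists_isSchwarzschildCurve lam
  exact ⟨γ, ⟨hγ.isOrbit, hγ.tendsto_PH, hγ.tendsto_PM⟩, hγ.mem_surfM, hγ.isFinite,
    fun δ hδ hbot htop => hγ.exists_eq_shift (isSchwarzschildCurve_of_tendsto hδ hbot htop)⟩

namespace IsFlowLine

variable {lam : ℝ} {γ : ℝ → Pt} (h : IsFlowLine lam γ)

include h

theorem exists_angle (hM : ∀ τ, γ τ ∈ surfM) :
    ∃ θ : ℝ → ℝ,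
      (∀ τ, θ τ ∈ Set.Icc (Real.arccos (2 / √5)) (Real.pi / 2) ∧
        (γ τ).1 = Real.cos (θ τ) ∧ (γ τ).2.1 = Real.sin (θ τ) - Real.cos (θ τ) ∧
        HasDerivAt θ (-((Real.cos (θ τ) - Real.sin (θ τ)) / 2) *
          (1 + 2 * (γ τ).2.2 ^ 2 + Real.cos (2 * θ τ) - 2 * Real.sin (2 * θ τ))) τ ∧
        HasDerivAt (fun t => (γ t).2.2) ((γ τ).2.2 *
          ((Real.cos (θ τ) + Real.sin (θ τ)) / 2) *
          (1 + 2 * (γ τ).2.2 ^ 2 + Real.cos (2 * θ τ) - 2 * Real.sin (2 * θ τ))) τ) ∧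
      ((∃ c₁ : ℝ, ∀ τ, (γ τ).2.2 = c₁ * (Real.cos (θ τ) - Real.sin (θ τ))) ∨
        ∀ τ, θ τ = Real.pi / 4) :=
  ⟨fun t => surfAngle (γ t), fun τ => ⟨surfAngle_mem_Icc (hM τ), (cos_surfAngle (hM τ)).symm,
    snd_fst_eq_sin_sub_cos_surfAngle (hM τ), h.hasDerivAt_surfAngle_trig (hM τ),
    h.hasDerivAt_Y₁_trig (hM τ)⟩, h.Y₁_eq_const_mul_or_surfAngle_eq hM⟩

theorem X₂_trichotomy_of_tendsto (hs : ∀ τ, surf (γ τ) < 0) (hlam : lam ≠ 0) {p q : Pt}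
    (hlimp : Tendsto γ atBot (𝓝 p)) (hp : IsPastLimit lam p)
    (hlimq : Tendsto γ atTop (𝓝 q)) (hq : IsPastLimit lam (-q)) :
    (∃ τ₀, (γ τ₀).1 = 0 ∧ (∀ τ < τ₀, 0 < (γ τ).1) ∧ ∀ τ > τ₀, (γ τ).1 < 0) ∨
      ((∀ τ, 0 < (γ τ).1) ∧ q = PHbar) ∨ (∀ τ, (γ τ).1 < 0) ∧ p = PH :=
  (h.X₂_trichotomy hs hlam).imp_right (Or.imp
    (fun hX₂ => ⟨hX₂, eq_PHbar_of_X₂_pos hX₂ hlimq hq⟩)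
    fun hX₂ => ⟨hX₂, eq_PH_of_X₂_neg hX₂ hlimp hp⟩)

theorem not_tendsto_PAdS_PAdSbar (hlam : lam ≠ 0) :
    ¬ Tendsto γ atTop (𝓝 PAdS) ∧ ¬ Tendsto γ atBot (𝓝 PAdS) ∧
      ¬ Tendsto γ atTop (𝓝 PAdSbar) ∧ ¬ Tendsto γ atBot (𝓝 PAdSbar) :=
  ⟨fun hl => field_PAdS_ne_zero hlam (h.field_eq_zero_of_tendsto_atTop hl),
    fun hl => field_PAdS_ne_zero hlam (h.field_eq_zero_of_tendsto_atBot hl),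
    fun hl => field_PAdSbar_ne_zero hlam (h.field_eq_zero_of_tendsto_atTop hl),
    fun hl => field_PAdSbar_ne_zero hlam (h.field_eq_zero_of_tendsto_atBot hl)⟩

end IsFlowLine

end ExpPotential

end

theorem mainTheorem4 (lam : ℝ) :
    -- solutions with `V₀ ≥ 0` trace finite orbits, on `I = 0` exactly when `V₀ = 0`
    (∀ (V0 : ℝ) (S : Config) (γ : ℝ → Pt), 0 ≤ V0 → S.Realizes V0 lam γ →
      IsOrbit lam γ ∧ IsFinite γ ∧ (V0 = 0 → ∀ τ, surf (γ τ) = 0) ∧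
        (0 < V0 → ∀ τ, surf (γ τ) < 0)) ∧
    -- conversely, each finite orbit is traced by a solution
    (∀ γ : ℝ → Pt, IsOrbit lam γ → IsFinite γ →
      ((∀ τ, surf (γ τ) = 0) → ∃ S : Config, S.Realizes 0 lam γ) ∧
      ((∀ τ, surf (γ τ) < 0) → ∀ V0 > 0, ∃ S : Config, S.Realizes V0 lam γ)) ∧
    -- invariance of the surface `I = 0` and of its two parts `M` and `M̄`
    {p : Pt | surf p = 0 ∧ normSq p ≤ 1} = surfM ∪ surfMbar ∧ Disjoint surfM surfMbar ∧
    (∀ (J : Set ℝ) (γ : ℝ → Pt), J.OrdConnected →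
      (∀ τ ∈ J, HasDerivWithinAt γ (field lam (γ τ)) J τ) → ∀ τ₀ ∈ J,
        (surf (γ τ₀) = 0 → ∀ τ ∈ J, surf (γ τ) = 0) ∧
        (γ τ₀ ∈ surfM → ∀ τ ∈ J, γ τ ∈ surfM) ∧
        (γ τ₀ ∈ surfMbar → ∀ τ ∈ J, γ τ ∈ surfMbar)) ∧
    -- the dynamics on `M̄` is the reverse of the one on `M`
    (∀ γ : ℝ → Pt, IsOrbit lam γ → IsOrbit lam (fun τ => -γ (-τ))) ∧
    (∀ p : Pt, p ∈ surfM ↔ -p ∈ surfMbar) ∧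
    -- the orbits on `M`
    (∀ γ : ℝ → Pt, IsOrbit lam γ → (∀ τ, γ τ ∈ surfM) →
      ∃ θ : ℝ → ℝ,
        (∀ τ, θ τ ∈ Set.Icc (Real.arccos (2 / √5)) (Real.pi / 2) ∧
          (γ τ).1 = Real.cos (θ τ) ∧ (γ τ).2.1 = Real.sin (θ τ) - Real.cos (θ τ) ∧
          HasDerivAt θ (-((Real.cos (θ τ) - Real.sin (θ τ)) / 2) *
            (1 + 2 * (γ τ).2.2 ^ 2 + Real.cos (2 * θ τ) - 2 * Real.sin (2 * θ τ))) τ ∧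
          HasDerivAt (fun t => (γ t).2.2) ((γ τ).2.2 *
            ((Real.cos (θ τ) + Real.sin (θ τ)) / 2) *
            (1 + 2 * (γ τ).2.2 ^ 2 + Real.cos (2 * θ τ) - 2 * Real.sin (2 * θ τ))) τ) ∧
        ((∃ c₁ : ℝ, ∀ τ, (γ τ).2.2 = c₁ * (Real.cos (θ τ) - Real.sin (θ τ))) ∨
          ∀ τ, θ τ = Real.pi / 4)) ∧
    -- there is a unique orbit from the horizon to Minkowski, and it is Schwarzschild
    (∃ γ : ℝ → Pt, (IsOrbit lam γ ∧ Tendsto γ atBot (𝓝 PH) ∧ Tendsto γ atTop (𝓝 PM)) ∧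
      (∀ τ, γ τ ∈ surfM) ∧ IsFinite γ ∧
      (∀ δ : ℝ → Pt, IsOrbit lam δ → Tendsto δ atBot (𝓝 PH) → Tendsto δ atTop (𝓝 PM) →
        ∃ c : ℝ, ∀ τ, δ τ = γ (τ + c))) ∧
    (∀ γ : ℝ → Pt, IsOrbit lam γ →
      (Tendsto γ atBot (𝓝 PH) ∧ Tendsto γ atTop (𝓝 PM)) ∨
        (Tendsto γ atBot (𝓝 PMbar) ∧ Tendsto γ atTop (𝓝 PHbar)) →
      ∀ (V0 : ℝ) (S : Config), 0 ≤ V0 → S.Realizes V0 lam γ → V0 = 0 ∧ S.IsSchwarzschild) ∧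
    -- the other orbits on `M` and on `M̄` are naked singularities
    (∀ γ : ℝ → Pt, IsOrbit lam γ → IsFinite γ → (∀ τ, γ τ ∈ surfM) → (∀ τ, γ τ ≠ PM) →
      Tendsto γ atTop (𝓝 PM) ∧ ∃ p ∈ critCurve, Tendsto γ atBot (𝓝 p) ∧
        (p ≠ PH → ∀ (V0 : ℝ) (S : Config), 0 ≤ V0 → S.Realizes V0 lam γ →
          S.NakedSingularity atBot)) ∧
    (∀ γ : ℝ → Pt, IsOrbit lam γ → IsFinite γ → (∀ τ, γ τ ∈ surfMbar) → (∀ τ, γ τ ≠ PMbar) →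
      Tendsto γ atBot (𝓝 PMbar) ∧ ∃ p ∈ critCurveBar, Tendsto γ atTop (𝓝 p) ∧
        (p ≠ PHbar → ∀ (V0 : ℝ) (S : Config), 0 ≤ V0 → S.Realizes V0 lam γ →
          S.NakedSingularity atTop)) ∧
    (lam ≠ 0 →
      -- the orbits outside `M` and `M̄`
      (∀ γ : ℝ → Pt, IsOrbit lam γ → IsFinite γ → (∀ τ, surf (γ τ) < 0) →
        ∃ p q : Pt, Tendsto γ atBot (𝓝 p) ∧ Tendsto γ atTop (𝓝 q) ∧
          (p = PM ∨ p ∈ critCurve ∨ (6 < lam ^ 2 ∧ p = Plam lam)) ∧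
          (q = PMbar ∨ q ∈ critCurveBar ∨ (6 < lam ^ 2 ∧ q = PlamBar lam)) ∧
          -- the passage through the maximum radius
          ((∃ τ₀, (γ τ₀).1 = 0 ∧ (∀ τ < τ₀, 0 < (γ τ).1) ∧ (∀ τ > τ₀, (γ τ).1 < 0) ∧
              ∀ (V0 : ℝ) (S : Config), 0 < V0 → S.Realizes V0 lam γ →
                (∀ τ, τ ≠ τ₀ → S.radius τ < S.radius τ₀) ∧
                S.x2 τ₀ = 0 ∧ S.normDeriv S.x2 τ₀ = -S.y1 τ₀ ^ 2 ∧ ¬ S.FlareOut τ₀) ∨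
            ((∀ τ, 0 < (γ τ).1) ∧ q = PHbar ∧
              ∀ (V0 : ℝ) (S : Config), 0 < V0 → S.Realizes V0 lam γ →
                StrictMono S.radius ∧ (∃ rH > 0, Tendsto S.radius atTop (𝓝 rH)) ∧
                Tendsto S.lapse atTop (𝓝 0)) ∨
            ((∀ τ, (γ τ).1 < 0) ∧ p = PH ∧
              ∀ (V0 : ℝ) (S : Config), 0 < V0 → S.Realizes V0 lam γ →
                StrictAnti S.radius ∧ (∃ rH > 0, Tendsto S.radius atBot (𝓝 rH)) ∧
                Tendsto S.lapse atBot (𝓝 0))) ∧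
          -- at least one end is singular, and each end other than Minkowski or horizon is
          ¬ ((p = PM ∨ p = PH) ∧ (q = PMbar ∨ q = PHbar)) ∧
          ∀ (V0 : ℝ) (S : Config), 0 < V0 → S.Realizes V0 lam γ →
            (p = PM ∨ p = PH ∨ S.NakedSingularity atBot) ∧
            (q = PMbar ∨ q = PHbar ∨ S.NakedSingularity atTop)) ∧
      -- hence no other non-stationary solution is free of naked singularities
      (∀ (V0 : ℝ) (S : Config) (γ : ℝ → Pt), 0 ≤ V0 → S.Realizes V0 lam γ →
        (∀ τ, γ τ ≠ PM ∧ γ τ ≠ PMbar) →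
        S.IsSchwarzschild ∨ S.NakedSingularity atBot ∨ S.NakedSingularity atTop) ∧
      -- no asymptotically anti-de Sitter solution, whatever the sign of the potential
      field lam PAdS ≠ 0 ∧ field lam PAdSbar ≠ 0 ∧
      (∀ γ : ℝ → Pt, IsFlowLine lam γ → (∀ τ, normSq (γ τ) ≤ 1) →
        ¬ Tendsto γ atTop (𝓝 PAdS) ∧ ¬ Tendsto γ atBot (𝓝 PAdS) ∧
        ¬ Tendsto γ atTop (𝓝 PAdSbar) ∧ ¬ Tendsto γ atBot (𝓝 PAdSbar)) ∧
      (∀ (V0 : ℝ) (S : Config), S.IsSolution (expPotential V0 lam) →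
        ¬ S.AsymptoticallyAdS atTop ∧ ¬ S.AsymptoticallyAdS atBot)) := by
  refine ⟨fun _ _ _ hV h => ⟨h.isOrbit hV, h.isFinite, h.surf_eq_zero, h.surf_neg⟩,
    fun _ h hf => ⟨Config.exists_realizes_zero h.1 hf,
      fun hs _ => Config.exists_realizes_of_pos h.1 hf hs⟩,
    surf_eq_zero_inter_ball_eq, disjoint_surfM_surfMbar,
    fun _ _ hJ hγ _ hs => ⟨fun h _ ht => surf_eq_zero_of_surf_eq_zero hJ hγ hs ht h,
      fun h _ ht => mem_surfM_of_mem_surfM hJ hγ hs ht h,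
      fun h _ ht => mem_surfMbar_of_mem_surfMbar hJ hγ hs ht h⟩,
    fun _ h => h.neg, fun p => (neg_mem_surfMbar_iff p).symm, fun _ h => h.1.exists_angle,
    exists_orbit_PH_PM_unique lam,
    fun _ h hlim _ _ _ hS => hS.isSchwarzschild_of_tendsto_or_tendsto h hlim,
    fun _ h hf hM hne => ⟨h.1.tendsto_PM_atTop hf hM,
      (h.1.exists_tendsto_critCurve_atBot hf hM ⟨0, hne 0⟩).imp fun _ hp =>
        ⟨hp.1, hp.2, fun hPH _ _ _ hS => hS.nakedSingularity_atBot hp.1 hp.2 hPH⟩⟩,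
    fun _ h hf hM hne => ⟨h.1.tendsto_PMbar_atBot hf hM,
      (h.1.exists_tendsto_critCurveBar_atTop hf hM ⟨0, hne 0⟩).imp fun _ hq =>
        ⟨hq.1, hq.2, fun hPH _ _ _ hS => hS.nakedSingularity_atTop hq.1 hq.2 hPH⟩⟩,
    fun hlam => ⟨fun γ h hf hs => ?_,
      fun _ _ _ hV hS hne => hS.isSchwarzschild_or_nakedSingularity hlam hV hne,
      field_PAdS_ne_zero hlam, field_PAdSbar_ne_zero hlam,
      fun _ h _ => h.not_tendsto_PAdS_PAdSbar hlam,
      fun _ _ hS => ⟨hS.not_asymptoticallyAdS_atTop hlam, hS.not_asymptoticallyAdS_atBot hlam⟩⟩⟩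
  obtain ⟨p, hlimp, hp⟩ := h.1.exists_isPastLimit hf hs
  obtain ⟨q, hlimq, hq⟩ := h.1.exists_isPastLimit_neg hf hs
  refine ⟨p, q, hlimp, hlimq, hp, isPastLimit_neg_iff.1 hq, ?_,
    h.1.not_tendsto_regular hs hlam hlimp hlimq,
    fun _ _ _ hS => hS.regular_or_nakedSingularity hlimp hp hlimq hq⟩
  refine (h.1.X₂_trichotomy_of_tendsto hs hlam hlimp hp hlimq hq).imp
    (fun ⟨τ₀, h0, hpast, hfuture⟩ => ⟨τ₀, h0, hpast, hfuture, fun _ _ _ hS =>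
      hS.traces.maximum_radius h.1 hf h0 hpast hfuture⟩)
    (Or.imp (fun ⟨hX₂, hqH⟩ => ⟨hX₂, hqH, fun _ _ _ hS =>
      hS.traces.horizon_atTop h.1 hX₂ (hqH ▸ hlimq)⟩) fun ⟨hX₂, hpH⟩ => ⟨hX₂, hpH, fun _ _ _ hS =>
        hS.traces.horizon_atBot h.1 hX₂ (hpH ▸ hlimp)⟩)
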